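/- Let $C$ be a smooth irreducible curve over $\mathbb C$ and let $X\subset\mathbb P^N$ be an $n$-dimensional scroll over $C$, with structure map $\pi\colon X\to C$; that is, $X$ is a smooth closed subvariety of $\mathbb P^N$ with hyperplane bundle $\mathcal L=\mathcal O_{\mathbb P^N}(1)|_X$, and $(X,\mathcal L)$ is isomorphic over $C$ to $(\mathbb P(\mathcal F),\mathcal O_{\mathbb P(\mathcal F)}(1))$ for a vector bundle $\mathcal F$ of rank $n$ on $C$. Let $V=H^0(\mathbb P^N,\mathcal O(1))$ and $V_X=V\otimes\mathcal O_X$. For $k\ge 0$ let $\mathcal P^k_X(\mathcal L)$ be the sheaf of principal parts of order $k$ of $\mathcal L$, let $j_k\colon V_X\to\mathcal P^k_X(\mathcal L)$ be the homomorphism that sends a section to its $k$-jet, and set $$\mathcal Q_k=\operatorname{Coker} j_k,\qquad \mathcal E_k=\mathcal P^k_X(\mathcal L)^\vee/\mathcal Q_k^\vee .$$ Let $k\ge 1$ be such that $kn\le N$ and the generic rank of $j_k$ is $kn+1$. Then: (i) $\mathcal Q_k^\vee$ is locally free of rank $\binom{n+k}{n}-(kn+1)$. (ii) There exist a locally free sheaf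 $\mathcal M_k$ of rank $\binom{n+k-1}{n-1}-n$ and exact sequences $$0\to\mathcal Q_{k-1}^\vee\to\mathcal Q_k^\vee\to\mathcal M_k^\vee\to 0,$$ $$0\to(\pi^*\Omega_C)^{\otimes(k-1)}\otimes\Omega_X\otimes\mathcal L\to S^k\Omega_X\otimes\mathcal L\to\mathcal M_k\to 0 .$$ (iii) $\mathcal E_k$ is locally free of rank $kn+1$, and there exists an exact sequence $$0\to\mathcal E_{k-1}\to\mathcal E_k\to(\pi^*T_C)^{\otimes(k-1)}\otimes T_X\otimes\mathcal L^{-1}\to 0 .$$ -/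

import Mathlib

open CategoryTheory AlgebraicGeometry TopologicalSpace
open scoped TensorProduct

noncomputable section

namespace Scroll

/-! ### Commutative algebra over `ℂ` -/

section Sym

variable {A A' : Type} [CommRing A] [CommRing A'] {M M' : Type} [AddCommGroup M] [Module A M]
  [AddCommGroup M'] [Module A' M']

variable (A M) in
/-- `S^k M`: the part of degree `k` of the symmetric algebra, that is, the `k`-th power of the
submodule of elements of degree one. -/
def symPower (k : ℕ) : Submodule A (SymmetricAlgebra A M) :=
  LinearMap.range (SymmetricAlgebra.ι A M) ^ k

/-- The ring homomorphism of symmetric algebras induced by a semilinear map. -/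
def symAlgMap (φ : A →+* A') (f : M →ₛₗ[φ] M') :
    SymmetricAlgebra A M →+* SymmetricAlgebra A' M' :=
  letI : Algebra A (SymmetricAlgebra A' M') :=
    ((algebraMap A' (SymmetricAlgebra A' M')).comp φ).toAlgebra
  ((SymmetricAlgebra.lift (A := SymmetricAlgebra A' M')
    ({ toFun := fun m => SymmetricAlgebra.ι A' M' (f m)
       map_add' := fun x y => by simp
       map_smul' := fun a x => by
        rw [LinearMap.map_smulₛₗ, LinearMap.map_smul, Algebra.smul_def, Algebra.smul_def]
        rfl } : M →ₗ[A] SymmetricAlgebra A' M') :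
      SymmetricAlgebra A M →ₐ[A] SymmetricAlgebra A' M') :
      SymmetricAlgebra A M →+* SymmetricAlgebra A' M')

theorem symAlgMap_ι (φ : A →+* A') (f : M →ₛₗ[φ] M') (m : M) :
    symAlgMap φ f (SymmetricAlgebra.ι A M m) = SymmetricAlgebra.ι A' M' (f m) := by
  let _ : Algebra A (SymmetricAlgebra A' M') :=
    ((algebraMap A' (SymmetricAlgebra A' M')).comp φ).toAlgebra
  exact SymmetricAlgebra.lift_ι_apply _ _

theorem symAlgMap_algebraMap (φ : A →+* A') (f : M →ₛₗ[φ] M') (a : A) :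
    symAlgMap φ f (algebraMap A _ a) = algebraMap A' _ (φ a) := by
  let _ : Algebra A (SymmetricAlgebra A' M') :=
    ((algebraMap A' (SymmetricAlgebra A' M')).comp φ).toAlgebra
  exact AlgHom.commutes _ _

/-- The same map as a semilinear map. -/
def symAlgMapₛₗ (φ : A →+* A') (f : M →ₛₗ[φ] M') :
    SymmetricAlgebra A M →ₛₗ[φ] SymmetricAlgebra A' M' where
  toFun := symAlgMap φ f
  map_add' := map_add _
  map_smul' a x := by
    rw [Algebra.smul_def, Algebra.smul_def, map_mul, symAlgMap_algebraMap]

theorem symAlgMap_mem (φ : A →+* A') (f : M →ₛₗ[φ] M') (k : ℕ) :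
    ∀ x ∈ symPower A M k, symAlgMapₛₗ φ f x ∈ symPower A' M' k := by
  induction k with
  | zero =>
    intro x hx
    simp only [symPower, pow_zero] at hx ⊢
    obtain ⟨a, rfl⟩ := Submodule.mem_one.1 hx
    exact Submodule.mem_one.2 ⟨φ a, (symAlgMap_algebraMap φ f a).symm⟩
  | succ k ih =>
    intro x hx
    simp only [symPower, pow_succ] at hx
    refine Submodule.mul_induction_on hx ?_ ?_
    · rintro m hm _ ⟨y, rfl⟩
      have : symAlgMapₛₗ φ f (m * SymmetricAlgebra.ι A M y) =
          symAlgMapₛₗ φ f m * SymmetricAlgebra.ι A' M' (f y) := by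
        change symAlgMap φ f _ = symAlgMap φ f _ * _
        rw [map_mul, symAlgMap_ι]
      rw [this, symPower, pow_succ]
      exact Submodule.mul_mem_mul (ih m hm) ⟨f y, rfl⟩
    · intro x y hx hy
      rw [map_add]
      exact add_mem hx hy

/-- The map `S^k M → S^k M'` induced by a semilinear map. -/
def symMap (φ : A →+* A') (f : M →ₛₗ[φ] M') (k : ℕ) : symPower A M k →ₛₗ[φ] symPower A' M' k :=
  ((symAlgMapₛₗ φ f).domRestrict (symPower A M k)).codRestrict _
    fun x => symAlgMap_mem φ f k x x.2

end Sym

section Algebra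

variable {A A' : Type} [CommRing A] [CommRing A'] [Algebra ℂ A] [Algebra ℂ A']

/-- The map `Ω_A → Ω_A'`, `a db ↦ φ(a) dφ(b)`, induced by a homomorphism of `ℂ`-algebras. -/
def kaehlerMap (φ : A →ₐ[ℂ] A') : Ω[A⁄ℂ] →ₛₗ[(φ : A →+* A')] Ω[A'⁄ℂ] :=
  letI : Algebra A A' := (φ : A →+* A').toAlgebra
  haveI : IsScalarTower ℂ A A' := IsScalarTower.of_algebraMap_eq fun r => (φ.commutes r).symm
  { toFun := KaehlerDifferential.map ℂ ℂ A A'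
    map_add' := map_add _
    map_smul' := fun a x => by
      rw [map_smul, ← algebraMap_smul A' a]
      rfl }

theorem kaehlerMap_D (φ : A →ₐ[ℂ] A') (a : A) :
    kaehlerMap φ (KaehlerDifferential.D ℂ A a) = KaehlerDifferential.D ℂ A' (φ a) := by
  let _ : Algebra A A' := (φ : A →+* A').toAlgebra
  have : IsScalarTower ℂ A A' := IsScalarTower.of_algebraMap_eq fun r => (φ.commutes r).symm
  exact KaehlerDifferential.map_D ℂ ℂ A A' a

variable (A) in
theorem kaehler_induction {p : Ω[A⁄ℂ] → Prop} (x : Ω[A⁄ℂ]) (h0 : p 0)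
    (hadd : ∀ x y, p x → p y → p (x + y))
    (h : ∀ a b : A, p (a • KaehlerDifferential.D ℂ A b)) : p x := by
  have hx : x ∈ Submodule.span A (Set.range (KaehlerDifferential.D ℂ A)) := by
    rw [KaehlerDifferential.span_range_derivation]; trivial
  obtain ⟨c, rfl⟩ := (Finsupp.mem_span_range_iff_exists_finsupp).1 hx
  exact Finset.sum_induction _ p hadd h0 fun b _ => h _ b

section Jet

variable {M M' : Type} [AddCommGroup M] [Module A M] [Module ℂ M] [IsScalarTower ℂ A M]
  [AddCommGroup M'] [Module A' M'] [Module ℂ M'] [IsScalarTower ℂ A' M']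

variable (M) in
/-- Multiplication by `1 ⊗ a - a ⊗ 1` on `A ⊗_ℂ M`, on which the left factor `A` acts by
multiplication on `A` and the right factor of `A ⊗_ℂ A` by multiplication on `M`. -/
def delta (a : A) : A ⊗[ℂ] M →ₗ[A] A ⊗[ℂ] M :=
  TensorProduct.AlgebraTensorModule.lTensor A A (Algebra.lsmul ℂ ℂ M a) - a • LinearMap.id

theorem delta_tmul (a b : A) (m : M) :
    delta M a (b ⊗ₜ[ℂ] m) = b ⊗ₜ[ℂ] (a • m) - (a * b) ⊗ₜ[ℂ] m := by
  simp [delta, TensorProduct.smul_tmul']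

variable (A M) in
/-- `I^k (A ⊗_ℂ M)`, where `I ⊆ A ⊗_ℂ A` is the kernel of the multiplication `A ⊗_ℂ A → A`.
As the ideal `I` is generated by the elements `1 ⊗ a - a ⊗ 1`, it is obtained from
`I^0 (A ⊗_ℂ M) = A ⊗_ℂ M` by applying `k` times all the operators `delta M a`. -/
def diagPow : ℕ → Submodule A (A ⊗[ℂ] M)
  | 0 => ⊤
  | k + 1 => ⨆ a : A, (diagPow k).map (delta M a)

variable (A M) in
/-- The module of principal parts of order `k` of `M`,
`P^k(M) = (A ⊗_ℂ A) / I^(k+1) ⊗_A M = (A ⊗_ℂ M) / I^(k+1) (A ⊗_ℂ M)`,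
as an `A`-module through the left factor. -/
abbrev Jet (k : ℕ) : Type := (A ⊗[ℂ] M) ⧸ diagPow A M (k + 1)

/-- The `k`-jet `1 ⊗ m` of `m`. -/
def jet (k : ℕ) (m : M) : Jet A M k := Submodule.Quotient.mk ((1 : A) ⊗ₜ[ℂ] m)

theorem semilinear_complex (φ : A →ₐ[ℂ] A') (f : M →ₛₗ[(φ : A →+* A')] M') (r : ℂ) (m : M) :
    f (r • m) = r • f m := by
  rw [← algebraMap_smul A r m, LinearMap.map_smulₛₗ]
  simp

/-- The map `A ⊗_ℂ M → A' ⊗_ℂ M'` induced by a semilinear map. -/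
def tmulMap (φ : A →ₐ[ℂ] A') (f : M →ₛₗ[(φ : A →+* A')] M') :
    A ⊗[ℂ] M →ₛₗ[(φ : A →+* A')] A' ⊗[ℂ] M' where
  toFun := TensorProduct.map φ.toLinearMap
    { toFun := f, map_add' := map_add f, map_smul' := semilinear_complex φ f }
  map_add' := map_add _
  map_smul' a x := by
    induction x with
    | zero => simp
    | tmul b m => simp [TensorProduct.smul_tmul']
    | add x y hx hy => simp only [smul_add, map_add, hx, hy]

@[simp] theorem tmulMap_tmul (φ : A →ₐ[ℂ] A') (f : M →ₛₗ[(φ : A →+* A')] M') (a : A) (m : M) :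
    tmulMap φ f (a ⊗ₜ[ℂ] m) = φ a ⊗ₜ[ℂ] f m := rfl

theorem tmulMap_delta (φ : A →ₐ[ℂ] A') (f : M →ₛₗ[(φ : A →+* A')] M') (a : A) (x : A ⊗[ℂ] M) :
    tmulMap φ f (delta M a x) = delta M' (φ a) (tmulMap φ f x) := by
  induction x with
  | zero => simp
  | tmul b m => simp [delta_tmul]
  | add x y hx hy => simp only [map_add, hx, hy]

theorem tmulMap_mem (φ : A →ₐ[ℂ] A') (f : M →ₛₗ[(φ : A →+* A')] M') (k : ℕ) :
    diagPow A M k ≤ (diagPow A' M' k).comap (tmulMap φ f) := by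
  induction k with
  | zero => intro x _; trivial
  | succ k ih =>
    refine iSup_le fun a => ?_
    rintro _ ⟨x, hx, rfl⟩
    rw [Submodule.mem_comap, tmulMap_delta]
    exact Submodule.mem_iSup_of_mem (φ a) ⟨_, ih hx, rfl⟩

/-- The map `P^k(M) → P^k(M')` induced by a semilinear map. -/
def jetMap (φ : A →ₐ[ℂ] A') (f : M →ₛₗ[(φ : A →+* A')] M') (k : ℕ) :
    Jet A M k →ₛₗ[(φ : A →+* A')] Jet A' M' k :=
  Submodule.mapQ _ _ (tmulMap φ f) (tmulMap_mem φ f (k + 1))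

theorem jetMap_jet (φ : A →ₐ[ℂ] A') (f : M →ₛₗ[(φ : A →+* A')] M') (k : ℕ) (m : M) :
    jetMap φ f k (jet k m) = jet k (f m) := by
  simp [jetMap, jet]

end Jet

end Algebra

/-! ### Quasi-coherent sheaves through their sections over a base of affine open sets -/

/-- A base `I` of open subsets (`mem i` is the open set of index `i`) of the space `Pt`, with a
presheaf of `ℂ`-algebras on it. -/
structure AlgBase where
  Pt : Type
  I : Type
  [ord : Preorder I]
  mem : I → Set Pt
  A : I → Type
  [ring : ∀ i, CommRing (A i)]
  [alg : ∀ i, Algebra ℂ (A i)]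
  res : ∀ {i j : I}, i ≤ j → A j →ₐ[ℂ] A i
  res_refl : ∀ (i : I) (a : A i), res (le_refl i) a = a
  res_res : ∀ {i j l : I} (h : i ≤ j) (h' : j ≤ l) (a : A l),
    res h (res h' a) = res (h.trans h') a

attribute [instance] AlgBase.ord AlgBase.ring AlgBase.alg

/-- The restriction homomorphism of rings. -/
abbrev AlgBase.resHom (B : AlgBase) {i j : B.I} (h : i ≤ j) : B.A j →+* B.A i :=
  (B.res h : B.A j →+* B.A i)

/-- A presheaf of modules on the base, which stands for its associated sheaf. It is applied to bases
of affine open sets, over which cokernels, tensor products, symmetric powers, differentials,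
principal parts and inverse images of quasi-coherent sheaves are computed on sections. -/
structure PMod (B : AlgBase) where
  M : B.I → Type
  [grp : ∀ i, AddCommGroup (M i)]
  [mod : ∀ i, Module (B.A i) (M i)]
  res : ∀ {i j : B.I} (h : i ≤ j), M j →ₛₗ[B.resHom h] M i
  res_refl : ∀ (i : B.I) (m : M i), res (le_refl i) m = m
  res_res : ∀ {i j l : B.I} (h : i ≤ j) (h' : j ≤ l) (m : M l),
    res h (res h' m) = res (h.trans h') m

attribute [instance] PMod.grp PMod.mod

section Modules

variable {B : AlgBase}

/-- Homomorphisms of presheaves of modules. -/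
structure PMod.Hom (F G : PMod B) where
  app : ∀ i, F.M i →ₗ[B.A i] G.M i
  naturality : ∀ {i j : B.I} (h : i ≤ j) (m : F.M j), app i (F.res h m) = G.res h (app j m)

namespace PMod

/-- `F` is isomorphic to `G`. -/
def IsIsomorphic (F G : PMod B) : Prop :=
  ∃ e : Hom F G, ∀ i, Function.Bijective (e.app i)

/-- The sheaf `F` is locally free of rank `r`: every point has a neighbourhood over which there
are `r` sections of `F` whose restrictions to all smaller members of the base are a basis. -/
def IsLocallyFree (F : PMod B) (r : ℕ) : Prop :=
  ∀ x : B.Pt, ∃ i, x ∈ B.mem i ∧ ∃ b : Fin r → F.M i, ∀ (j : B.I) (h : j ≤ i),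
    LinearIndependent (B.A j) (fun m => F.res h (b m)) ∧
      Submodule.span (B.A j) (Set.range fun m => F.res h (b m)) = ⊤

/-- Exactness of `0 → F → G → H → 0` as a sequence of sheaves, that is, on the stalks. -/
structure IsShortExact {F G H : PMod B} (f : Hom F G) (g : Hom G H) : Prop where
  injective : ∀ (i : B.I) (s : F.M i), f.app i s = 0 →
    ∀ x ∈ B.mem i, ∃ (j : B.I) (h : j ≤ i), x ∈ B.mem j ∧ F.res h s = 0
  zero : ∀ (i : B.I) (s : F.M i), g.app i (f.app i s) = 0
  exact : ∀ (i : B.I) (t : G.M i), g.app i t = 0 →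
    ∀ x ∈ B.mem i, ∃ (j : B.I) (h : j ≤ i), x ∈ B.mem j ∧ ∃ s : F.M j, f.app j s = G.res h t
  surjective : ∀ (i : B.I) (u : H.M i),
    ∀ x ∈ B.mem i, ∃ (j : B.I) (h : j ≤ i), x ∈ B.mem j ∧ ∃ t : G.M j, g.app j t = H.res h u

/-- The homomorphism `f` has generic rank `r`: over every non-empty member of the base, the rank of
the image of `f` is `r`. It is applied to integral schemes and affine open sets, where the sections
of the structure sheaf are a domain with the function field as field of fractions, so that this is
the rank of `f` at the generic point. -/
def HasGenericRank {F G : PMod B} (f : Hom F G) (r : ℕ) : Prop :=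
  ∀ i, (B.mem i).Nonempty → Module.finrank (B.A i) (LinearMap.range (f.app i)) = r

/-- The structure sheaf. -/
def unit (B : AlgBase) : PMod B where
  M := B.A
  res h :=
    { toFun := B.res h
      map_add' := map_add _
      map_smul' := fun a m => by simp }
  res_refl := B.res_refl
  res_res := B.res_res

/-- The free sheaf of rank `r`. -/
def free (B : AlgBase) (r : ℕ) : PMod B where
  M i := Fin r → B.A i
  res h :=
    { toFun := fun v m => B.res h (v m)
      map_add' := fun v w => by ext; simp
      map_smul' := fun a v => by ext; simp }
  res_refl i v := funext fun m => B.res_refl i (v m)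
  res_res h h' v := funext fun m => B.res_res h h' (v m)

/-- The tensor product. -/
def tensor (F G : PMod B) : PMod B where
  M i := F.M i ⊗[B.A i] G.M i
  res h := TensorProduct.map (F.res h) (G.res h)
  res_refl i m := by
    induction m with
    | zero => simp
    | tmul x y => simp [F.res_refl, G.res_refl]
    | add x y hx hy => rw [map_add, hx, hy]
  res_res h h' m := by
    induction m with
    | zero => simp
    | tmul x y => simp [F.res_res, G.res_res]
    | add x y hx hy => simp only [map_add, hx, hy]

/-- The tensor power `F^{⊗ k}`. -/
def pow (F : PMod B) : ℕ → PMod B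
  | 0 => unit B
  | k + 1 => tensor (pow F k) F

/-- The symmetric power `S^k F`. -/
def sym (F : PMod B) (k : ℕ) : PMod B where
  M i := symPower (B.A i) (F.M i) k
  res h := symMap _ (F.res h) k
  res_refl i m := by
    refine Subtype.ext ?_
    obtain ⟨x, hx⟩ := m
    change symAlgMap _ _ x = x
    clear hx
    induction x using SymmetricAlgebra.induction with
    | algebraMap r => rw [symAlgMap_algebraMap]; exact congrArg _ (B.res_refl i r)
    | ι x => rw [symAlgMap_ι, F.res_refl]
    | mul a b ha hb => rw [map_mul, ha, hb]
    | add a b ha hb => rw [map_add, ha, hb]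
  res_res h h' m := by
    refine Subtype.ext ?_
    obtain ⟨x, hx⟩ := m
    change symAlgMap _ _ (symAlgMap _ _ x) = symAlgMap _ _ x
    clear hx
    induction x using SymmetricAlgebra.induction with
    | algebraMap r => simp only [symAlgMap_algebraMap]; exact congrArg _ (B.res_res h h' r)
    | ι x => simp only [symAlgMap_ι, F.res_res]
    | mul a b ha hb => simp only [map_mul, ha, hb]
    | add a b ha hb => simp only [map_add, ha, hb]

/-- The cotangent sheaf. -/
def cotangent (B : AlgBase) : PMod B where
  M i := Ω[B.A i⁄ℂ]
  res h := kaehlerMap (B.res h)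
  res_refl i m := by
    induction m using kaehler_induction with
    | h0 => simp
    | hadd x y hx hy => rw [map_add, hx, hy]
    | h a b => rw [LinearMap.map_smulₛₗ, kaehlerMap_D]; simp [B.res_refl]
  res_res h h' m := by
    induction m using kaehler_induction with
    | h0 => simp
    | hadd x y hx hy => simp only [map_add, hx, hy]
    | h a b => simp only [LinearMap.map_smulₛₗ, kaehlerMap_D]; simp [B.res_res]

/-- The action of `ℂ` on sections. -/
abbrev complexModule (F : PMod B) (i : B.I) : Module ℂ (F.M i) :=
  Module.compHom (F.M i) (algebraMap ℂ (B.A i))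

theorem complexTower (F : PMod B) (i : B.I) :
    letI := F.complexModule i
    IsScalarTower ℂ (B.A i) (F.M i) :=
  letI := F.complexModule i
  ⟨fun r a m => by
    rw [Algebra.smul_def, mul_smul]
    rfl⟩

attribute [local instance] complexModule complexTower

/-- The sheaf of principal parts `P^k(F)`. -/
def principalParts (k : ℕ) (F : PMod B) : PMod B where
  M i := Jet (B.A i) (F.M i) k
  res h := jetMap (B.res h) (F.res h) k
  res_refl i m := by
    obtain ⟨x, rfl⟩ := Submodule.Quotient.mk_surjective _ m
    change Submodule.Quotient.mk (tmulMap _ _ x) = _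
    congr 1
    induction x with
    | zero => simp
    | tmul a m => simp [B.res_refl, F.res_refl]
    | add x y hx hy => rw [map_add, hx, hy]
  res_res h h' m := by
    obtain ⟨x, rfl⟩ := Submodule.Quotient.mk_surjective _ m
    change Submodule.Quotient.mk (tmulMap _ _ (tmulMap _ _ x)) = Submodule.Quotient.mk _
    congr 1
    induction x with
    | zero => simp
    | tmul a m => simp [B.res_res, F.res_res]
    | add x y hx hy => simp only [map_add, hx, hy]

/-- Global sections. -/
def GlobalSection (F : PMod B) : Type :=
  { s : ∀ i, F.M i // ∀ {i j : B.I} (h : i ≤ j), F.res h (s j) = s i }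

/-- The homomorphism `O^r → P^k(F)` that sends the `m`-th basis vector to the `k`-jet of the global
section `s m`. -/
def jetHom (k : ℕ) {r : ℕ} (F : PMod B) (s : Fin r → F.GlobalSection) :
    Hom (free B r) (principalParts k F) where
  app i := Fintype.linearCombination (B.A i)
    (fun m => (jet k ((s m).1 i) : Jet (B.A i) (F.M i) k))
  naturality {i j} h v := by
    change ∑ m, B.res h (v m) • jet k ((s m).1 i) =
      jetMap (B.res h) (F.res h) k (∑ m, v m • jet k ((s m).1 j))
    rw [map_sum]
    refine Finset.sum_congr rfl fun m _ => ?_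
    rw [LinearMap.map_smulₛₗ, jetMap_jet, (s m).2 h]
    rfl

/-- The cokernel. -/
def coker {F G : PMod B} (f : Hom F G) : PMod B where
  M i := G.M i ⧸ LinearMap.range (f.app i)
  res h := Submodule.mapQ _ _ (G.res h) (by
    rintro _ ⟨x, rfl⟩
    exact ⟨F.res h x, f.naturality h x⟩)
  res_refl i m := by
    obtain ⟨x, rfl⟩ := Submodule.Quotient.mk_surjective _ m
    simp [G.res_refl]
  res_res h h' m := by
    obtain ⟨x, rfl⟩ := Submodule.Quotient.mk_surjective _ m
    simp [G.res_res]

/-- The projection to the cokernel. -/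
def cokerProj {F G : PMod B} (f : Hom F G) : Hom G (coker f) where
  app _ := Submodule.mkQ _
  naturality _ _ := rfl

/-- Sections over `i` of the dual sheaf: the homomorphisms from `F` to the structure sheaf over the
part of the base below `i`. -/
def dualSections (F : PMod B) (i : B.I) :
    AddSubgroup (∀ j : {j : B.I // j ≤ i}, F.M j.1 →ₗ[B.A j.1] B.A j.1) where
  carrier := { f | ∀ (j l : {j : B.I // j ≤ i}) (h : l.1 ≤ j.1) (m : F.M j.1),
    f l (F.res h m) = B.res h (f j m) }
  zero_mem' j l h m := by simp
  add_mem' hf hg j l h m := by simp [hf j l h m, hg j l h m]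
  neg_mem' hf j l h m := by simp [hf j l h m]

instance (F : PMod B) (i : B.I) : Module (B.A i) (F.dualSections i) where
  smul a f := ⟨fun j => B.res j.2 a • f.1 j, fun j l h m => by
    simp [f.2 j l h m, B.res_res]⟩
  one_smul f := Subtype.ext <| funext fun j => by
    change B.res j.2 1 • f.1 j = f.1 j
    simp
  mul_smul a b f := Subtype.ext <| funext fun j => by
    change B.res j.2 (a * b) • f.1 j = B.res j.2 a • B.res j.2 b • f.1 j
    rw [map_mul, mul_smul]
  smul_zero a := Subtype.ext <| funext fun j => by
    change B.res j.2 a • (0 : F.M j.1 →ₗ[B.A j.1] B.A j.1) = 0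
    simp
  smul_add a f g := Subtype.ext <| funext fun j => by
    change B.res j.2 a • (f.1 j + g.1 j) = B.res j.2 a • f.1 j + B.res j.2 a • g.1 j
    simp
  add_smul a b f := Subtype.ext <| funext fun j => by
    change B.res j.2 (a + b) • f.1 j = B.res j.2 a • f.1 j + B.res j.2 b • f.1 j
    rw [map_add, add_smul]
  zero_smul f := Subtype.ext <| funext fun j => by
    change B.res j.2 0 • f.1 j = 0
    simp

/-- The dual sheaf `F^∨ = Hom(F, O)`. -/
def dual (F : PMod B) : PMod B where
  M i := F.dualSections i
  res {i j} h :=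
    { toFun := fun f => ⟨fun l => f.1 ⟨l.1, l.2.trans h⟩, fun l l' h' m =>
        f.2 ⟨l.1, l.2.trans h⟩ ⟨l'.1, l'.2.trans h⟩ h' m⟩
      map_add' := fun f g => rfl
      map_smul' := fun a f => Subtype.ext <| funext fun l => by
        change B.res (l.2.trans h) a • f.1 ⟨l.1, l.2.trans h⟩ =
          B.res l.2 (B.res h a) • f.1 ⟨l.1, l.2.trans h⟩
        rw [B.res_res] }
  res_refl _ _ := rfl
  res_res _ _ _ := rfl

/-- The dual homomorphism. -/
def dualMap {F G : PMod B} (f : Hom F G) : Hom (dual G) (dual F) where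
  app i :=
    { toFun := fun u => ⟨fun j => (u.1 j).comp (f.app j.1), fun j l h m => by
        simp [f.naturality, u.2 j l h]⟩
      map_add' := fun u v => rfl
      map_smul' := fun a u => rfl }
  naturality _ _ := rfl

end PMod

end Modules

/-- The base obtained by a change of index set. -/
abbrev AlgBase.reindex (B : AlgBase) {J : Type} [Preorder J] (g : J → B.I) (hg : Monotone g) :
    AlgBase where
  Pt := B.Pt
  I := J
  mem j := B.mem (g j)
  A j := B.A (g j)
  res h := B.res (hg h)
  res_refl j := B.res_refl (g j)
  res_res h h' := B.res_res (hg h) (hg h')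

/-- A presheaf of modules, on the base obtained by a change of index set. -/
def PMod.reindex {B : AlgBase} (F : PMod B) {J : Type} [Preorder J] (g : J → B.I)
    (hg : Monotone g) : PMod (B.reindex g hg) where
  M j := F.M (g j)
  grp j := F.grp (g j)
  mod j := F.mod (g j)
  res h := F.res (hg h)
  res_refl j := F.res_refl (g j)
  res_res h h' := F.res_res (hg h) (hg h')

/-- A global section, on the base obtained by a change of index set. -/
def PMod.GlobalSection.reindex {B : AlgBase} {F : PMod B} (s : F.GlobalSection) {J : Type}
    [Preorder J] (g : J → B.I) (hg : Monotone g) : (F.reindex g hg).GlobalSection :=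
  ⟨fun j => s.1 (g j), fun h => s.2 (hg h)⟩

/-- A morphism of ringed spaces, described on bases: the open set `i` is mapped into `idx i`. -/
structure BaseHom (B B' : AlgBase) where
  idx : B.I → B'.I
  mono : ∀ {i j : B.I}, i ≤ j → idx i ≤ idx j
  map : ∀ i, B'.A (idx i) →ₐ[ℂ] B.A i
  naturality : ∀ {i j : B.I} (h : i ≤ j) (a : B'.A (idx j)),
    map i (B'.res (mono h) a) = B.res h (map j a)

section ExtendScalars

variable {R S R' S' : Type} [CommRing R] [CommRing S] [CommRing R'] [CommRing S']

/-- `S ⊗_R M`, where `S` is an `R`-algebra through `φ`. -/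
def Ext (φ : R →+* S) (M : Type) [AddCommGroup M] [Module R M] : Type :=
  letI : Algebra R S := φ.toAlgebra
  S ⊗[R] M

instance (φ : R →+* S) (M : Type) [AddCommGroup M] [Module R M] : AddCommGroup (Ext φ M) :=
  letI : Algebra R S := φ.toAlgebra
  (TensorProduct.addCommGroup : AddCommGroup (S ⊗[R] M))

instance (φ : R →+* S) (M : Type) [AddCommGroup M] [Module R M] : Module S (Ext φ M) :=
  letI : Algebra R S := φ.toAlgebra
  (TensorProduct.leftModule : Module S (S ⊗[R] M))

variable {M M' : Type} [AddCommGroup M] [Module R M] [AddCommGroup M'] [Module R' M']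

/-- The element `s ⊗ m` of `S ⊗_R M`. -/
def Ext.tmul (φ : R →+* S) (s : S) (m : M) : Ext φ M :=
  letI : Algebra R S := φ.toAlgebra
  s ⊗ₜ[R] m

theorem Ext.induction {φ : R →+* S} {p : Ext φ M → Prop} (x : Ext φ M) (h0 : p 0)
    (h : ∀ s m, p (Ext.tmul φ s m)) (hadd : ∀ x y, p x → p y → p (x + y)) : p x :=
  letI : Algebra R S := φ.toAlgebra
  TensorProduct.induction_on (motive := p) x h0 h hadd

/-- The map `S ⊗_R M → S' ⊗_R' M'`, `s ⊗ m ↦ σ(s) ⊗ f(m)`. -/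
def Ext.map {φ : R →+* S} {φ' : R' →+* S'} (ρ : R →+* R') (σ : S →+* S')
    (hσ : ∀ r, σ (φ r) = φ' (ρ r)) (f : M →ₛₗ[ρ] M') : Ext φ M →ₛₗ[σ] Ext φ' M' :=
  letI : Algebra R S := φ.toAlgebra
  letI : Algebra R' S' := φ'.toAlgebra
  let σ' : S →ₛₗ[ρ] S' :=
    { toFun := σ
      map_add' := map_add σ
      map_smul' := fun r s => by
        rw [Algebra.smul_def, Algebra.smul_def, map_mul]
        exact congrArg (· * σ s) (hσ r) }
  { toFun := TensorProduct.map σ' f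
    map_add' := map_add (TensorProduct.map σ' f)
    map_smul' := fun s x => by
      change TensorProduct.map σ' f (s • (x : S ⊗[R] M)) = σ s • TensorProduct.map σ' f x
      refine TensorProduct.induction_on (motive := fun x =>
        TensorProduct.map σ' f (s • x) = σ s • TensorProduct.map σ' f x) x (by simp) ?_ ?_
      · intro t m
        simp [TensorProduct.smul_tmul', σ']
      · intro x y hx hy
        rw [smul_add, map_add, hx, hy, map_add, smul_add] }

theorem Ext.map_tmul {φ : R →+* S} {φ' : R' →+* S'} (ρ : R →+* R') (σ : S →+* S')
    (hσ : ∀ r, σ (φ r) = φ' (ρ r)) (f : M →ₛₗ[ρ] M') (s : S) (m : M) :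
    Ext.map ρ σ hσ f (Ext.tmul φ s m) = Ext.tmul φ' (σ s) (f m) := rfl

end ExtendScalars

/-- The inverse image of a quasi-coherent sheaf. -/
def PMod.pullback {B B' : AlgBase} (p : BaseHom B B') (F : PMod B') : PMod B where
  M i := Ext (p.map i : B'.A (p.idx i) →+* B.A i) (F.M (p.idx i))
  res {i j} h := Ext.map (B'.resHom (p.mono h)) (B.resHom h)
    (fun r => by simpa using (p.naturality h r).symm) (F.res (p.mono h))
  res_refl i m := by
    induction m using Ext.induction with
    | h0 => simp
    | h s m => rw [Ext.map_tmul, F.res_refl]; exact congrArg (Ext.tmul _ · m) (B.res_refl i s)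
    | hadd x y hx hy => rw [map_add, hx, hy]
  res_res {i j l} h h' m := by
    induction m using Ext.induction with
    | h0 => simp
    | h s m =>
      simp only [Ext.map_tmul, F.res_res]
      exact congrArg (Ext.tmul _ · _) (B.res_res h h' s)
    | hadd x y hx hy => simp only [map_add, hx, hy]

/-! ### Schemes over `ℂ` and the hyperplane bundle -/

/-- The standard grading. -/
abbrev grading (m : ℕ) : ℕ → Submodule ℂ (MvPolynomial (Fin m) ℂ) :=
  MvPolynomial.homogeneousSubmodule (Fin m) ℂ

attribute [local instance] MvPolynomial.gradedAlgebra

/-- The projective space over `ℂ` with `m` homogeneous coordinates, of dimension `m - 1`. -/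
abbrev PP (m : ℕ) : Scheme.{0} := Proj (grading m)

/-- Its structure morphism. -/
def PP.toSpec (m : ℕ) : PP m ⟶ Spec (.of ℂ) :=
  Proj.toSpecZero (grading m) ≫ Spec.map (CommRingCat.ofHom (algebraMap ℂ (grading m 0)))

/-- The standard open set `x_i ≠ 0`. -/
def PP.chart {m : ℕ} (i : Fin m) : (PP m).Opens :=
  Proj.basicOpen (grading m) (MvPolynomial.X i)

/-- The function `x_j / x_i` on the open set `x_i ≠ 0`. -/
def PP.ratio {m : ℕ} (i j : Fin m) : Γ(PP m, PP.chart i) :=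
  (Proj.awayToSection (grading m) (MvPolynomial.X i)).hom
    (HomogeneousLocalization.Away.mk (grading m) (d := 1) (MvPolynomial.isHomogeneous_X ℂ i) 1
      (MvPolynomial.X j) (MvPolynomial.isHomogeneous_X ℂ j))

/-- Restriction of regular functions. -/
def rs {T : Scheme.{0}} {U V : T.Opens} (h : V ≤ U) : Γ(T, U) →+* Γ(T, V) :=
  (T.presheaf.map (homOfLE h).op).hom

theorem rs_rs {T : Scheme.{0}} {U V W : T.Opens} (h : V ≤ U) (h' : W ≤ V) (a : Γ(T, U)) :
    rs h' (rs h a) = rs (h'.trans h) a := by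
  simp only [rs, ← CommRingCat.comp_apply, ← Functor.map_comp]
  rfl

theorem rs_refl {T : Scheme.{0}} {U : T.Opens} (h : U ≤ U) (a : Γ(T, U)) : rs h a = a := by
  simp [rs]

theorem PP.ratio_mul {m : ℕ} (i j l : Fin m) {U : (PP m).Opens} (hi : U ≤ PP.chart i)
    (hj : U ≤ PP.chart j) :
    rs hi (PP.ratio i l) = rs hi (PP.ratio i j) * rs hj (PP.ratio j l) := by
  apply Subtype.ext
  ext ⟨x, hx⟩
  have key : ∀ (a b : Fin m) (ha : U ≤ PP.chart a),
      ((rs ha (PP.ratio a b)).1 ⟨x, hx⟩).val = Localization.mk (MvPolynomial.X b)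
        ⟨MvPolynomial.X a, ha hx⟩ := by
    intro a b ha
    change (((ProjectiveSpectrum.Proj.awayToSection (grading m) _).1 _).val ⟨x, ha hx⟩).val = _
    erw [ProjectiveSpectrum.Proj.awayToSection_apply]
    change IsLocalization.map _ _ _ (Localization.mk _ _) = _
    rw [Localization.mk_eq_mk', IsLocalization.map_mk', Localization.mk_eq_mk']
    simp
  change ((rs hi (PP.ratio i l)).1 ⟨x, hx⟩).val =
    ((rs hi (PP.ratio i j)).1 ⟨x, hx⟩ * (rs hj (PP.ratio j l)).1 ⟨x, hx⟩).val
  rw [HomogeneousLocalization.val_mul, key, key, key, Localization.mk_mul,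
    Localization.mk_eq_mk_iff, Localization.r_iff_exists]
  refine ⟨1, ?_⟩
  simp
  ring

theorem le_preimage_top {T S : Scheme.{0}} (f : T ⟶ S) (U : T.Opens) : U ≤ f ⁻¹ᵁ ⊤ :=
  fun _ _ => trivial

/-- The `ℂ`-algebra structure on regular functions of a scheme over `ℂ`. -/
def structureHom {T : Scheme.{0}} (f : T ⟶ Spec (.of ℂ)) (U : T.Opens) : ℂ →+* Γ(T, U) :=
  ((Scheme.ΓSpecIso (.of ℂ)).inv ≫ f.appLE ⊤ U (le_preimage_top f U)).hom

theorem rs_structureHom {T : Scheme.{0}} (f : T ⟶ Spec (.of ℂ)) {U V : T.Opens} (h : V ≤ U)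
    (r : ℂ) : rs h (structureHom f U r) = structureHom f V r := by
  change ((Scheme.ΓSpecIso (.of ℂ)).inv ≫ f.appLE ⊤ U (le_preimage_top f U) ≫
    T.presheaf.map (homOfLE h).op).hom r = _
  rw [Scheme.Hom.appLE_map]
  rfl

/-- The base of all affine open sets of a scheme over `ℂ`. -/
abbrev affineBase {T : Scheme.{0}} (f : T ⟶ Spec (.of ℂ)) : AlgBase where
  Pt := T
  I := T.affineOpens
  mem U := (U.1 : Set T)
  A U := Γ(T, U.1)
  alg U := (structureHom f U.1).toAlgebra
  res {U V} h :=
    letI := (structureHom f U.1).toAlgebra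
    letI := (structureHom f V.1).toAlgebra
    { rs (T := T) (U := V.1) (V := U.1) h with
      commutes' := rs_structureHom f h }
  res_refl _ a := rs_refl _ a
  res_res _ _ a := rs_rs _ _ a

section Twist

variable {T : Scheme.{0}} {m : ℕ} (f : T ⟶ PP m)

/-- The open set of `T` where the homogeneous coordinate `x_i` does not vanish. -/
def stdOpen (i : Fin m) : T.Opens := f ⁻¹ᵁ PP.chart i

/-- The function `x_j / x_i` on `stdOpen f i`. -/
def ratio (i j : Fin m) : Γ(T, stdOpen f i) := (f.app (PP.chart i)).hom (PP.ratio i j)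

theorem ratio_mul (i j l : Fin m) {U : T.Opens} (hi : U ≤ stdOpen f i) (hj : U ≤ stdOpen f j) :
    rs hi (ratio f i l) = rs hi (ratio f i j) * rs hj (ratio f j l) := by
  have key : ∀ (a b : Fin m) (h : PP.chart i ⊓ PP.chart j ≤ PP.chart a) (ha : U ≤ stdOpen f a),
      rs ha (ratio f a b) = rs (show U ≤ f ⁻¹ᵁ (PP.chart i ⊓ PP.chart j) from le_inf hi hj)
        ((f.app (PP.chart i ⊓ PP.chart j)).hom (rs h (PP.ratio a b))) := by
    intro a b h ha
    have := congrArg (fun φ => φ.hom (PP.ratio a b)) (f.naturality (homOfLE h).op)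
    simp only [CommRingCat.hom_comp, RingHom.comp_apply] at this
    change _ = rs _ ((f.app (PP.chart i ⊓ PP.chart j)).hom
      (((PP m).presheaf.map (homOfLE h).op).hom (PP.ratio a b)))
    rw [this]
    exact (rs_rs _ _ _).symm
  rw [key i l inf_le_left hi, key i j inf_le_left hi, key j l inf_le_right hj,
    PP.ratio_mul i j l inf_le_left inf_le_right, map_mul, map_mul]

/-- Sections over `U` of `f^* O(1)`, the line bundle with generator `x_i` over `stdOpen f i`: the
families of functions `t_i` on `U ∩ stdOpen f i` such that `t_i x_i = t_j x_j`. -/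
def twistSections (U : T.Opens) : AddSubgroup (∀ i : Fin m, Γ(T, U ⊓ stdOpen f i)) where
  carrier := { t | ∀ (i j : Fin m) (V : T.Opens) (hi : V ≤ U ⊓ stdOpen f i)
    (hj : V ≤ U ⊓ stdOpen f j),
    rs hi (t i) = rs (hi.trans inf_le_right) (ratio f i j) * rs hj (t j) }
  zero_mem' i j V hi hj := by simp
  add_mem' hs ht i j V hi hj := by
    simp only [Pi.add_apply, map_add, hs i j V hi hj, ht i j V hi hj, mul_add]
  neg_mem' ht i j V hi hj := by
    simp only [Pi.neg_apply, map_neg, ht i j V hi hj, mul_neg]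

instance (U : T.Opens) : Module Γ(T, U) (twistSections f U) where
  smul a t := ⟨fun i => rs inf_le_left a * t.1 i, fun i j V hi hj => by
    simp only [map_mul, rs_rs, t.2 i j V hi hj]
    ring⟩
  one_smul t := Subtype.ext <| funext fun i => by
    change rs inf_le_left 1 * t.1 i = t.1 i
    simp
  mul_smul a b t := Subtype.ext <| funext fun i => by
    change rs inf_le_left (a * b) * t.1 i = rs inf_le_left a * (rs inf_le_left b * t.1 i)
    rw [map_mul, mul_assoc]
  smul_zero a := Subtype.ext <| funext fun i => by
    change rs inf_le_left a * (0 : Γ(T, U ⊓ stdOpen f i)) = 0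
    simp
  smul_add a s t := Subtype.ext <| funext fun i => by
    change rs inf_le_left a * (s.1 i + t.1 i) = rs inf_le_left a * s.1 i + rs inf_le_left a * t.1 i
    rw [mul_add]
  add_smul a b t := Subtype.ext <| funext fun i => by
    change rs inf_le_left (a + b) * t.1 i = rs inf_le_left a * t.1 i + rs inf_le_left b * t.1 i
    rw [map_add, add_mul]
  zero_smul t := Subtype.ext <| funext fun i => by
    change rs inf_le_left 0 * t.1 i = 0
    simp

instance (p : T ⟶ Spec (.of ℂ)) (U : T.affineOpens) :
    Module ((affineBase p).A U) (twistSections f U.1) :=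
  inferInstanceAs (Module Γ(T, U.1) (twistSections f U.1))

/-- The line bundle `f^* O(1)`. -/
def twist (p : T ⟶ Spec (.of ℂ)) : PMod (affineBase p) where
  M U := twistSections f U.1
  res {_ _} h :=
    { toFun := fun t => ⟨fun i => rs (inf_le_inf_right _ h) (t.1 i), fun i j W hi hj => by
        simp only [rs_rs]
        exact t.2 i j W _ _⟩
      map_add' := fun s t => Subtype.ext <| funext fun i => map_add _ _ _
      map_smul' := fun a t => Subtype.ext <| funext fun i => by
        change rs _ (rs inf_le_left a * t.1 i) = rs inf_le_left (rs h a) * rs _ (t.1 i)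
        simp only [map_mul, rs_rs] }
  res_refl U t := Subtype.ext <| funext fun i => rs_refl _ _
  res_res h h' t := Subtype.ext <| funext fun i => rs_rs _ _ _

/-- The section `x_l` of `f^* O(1)`. -/
def coordSection (p : T ⟶ Spec (.of ℂ)) (l : Fin m) : (twist f p).GlobalSection :=
  ⟨fun U => ⟨fun i => rs inf_le_right (ratio f i l), fun i j V hi hj => by
    simp only [rs_rs]
    exact ratio_mul f i j l _ _⟩, fun h => Subtype.ext <| funext fun i => rs_rs _ _ _⟩

end Twist

/-! ### Scrolls -/

/-- `(X, L)`, where `L` is the hyperplane bundle of `i : X → P^N`, is a scroll with fibres of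
dimension `n - 1` over `C` through `π`: it is the projective bundle `P(F) → C` of a vector bundle
`F` of rank `n`, with `L` as its tautological line bundle `O_{P(F)}(1)`. That is, locally over `C`
there are isomorphisms of `X` with the product of `C` and a projective space of dimension `n - 1`
that turn `L` into `O(1)`. -/
def IsScroll {X C : Scheme.{0}} (pX : X ⟶ Spec (.of ℂ)) (pC : C ⟶ Spec (.of ℂ)) {N : ℕ}
    (i : X ⟶ PP (N + 1)) (π : X ⟶ C) (n : ℕ) : Prop :=
  ∀ c : C, ∃ W : C.Opens, c ∈ W ∧ ∃ g : (π ⁻¹ᵁ W).toScheme ⟶ PP n,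
    IsPullback g (π ∣_ W) (PP.toSpec n) (W.ι ≫ pC) ∧
      PMod.IsIsomorphic (twist ((π ⁻¹ᵁ W).ι ≫ i) ((π ⁻¹ᵁ W).ι ≫ pX))
        (twist g ((π ⁻¹ᵁ W).ι ≫ pX))

/-- The index set of a base of affine open sets `U` of `X`: those on which some homogeneous
coordinate of the projective space vanishes nowhere, together with an affine open set `W` of `C`
that contains the image of `U`. -/
structure Chart {X C : Scheme.{0}} {N : ℕ} (i : X ⟶ PP (N + 1)) (π : X ⟶ C) where
  U : X.affineOpens
  W : C.affineOpens
  le : U.1 ≤ π ⁻¹ᵁ W.1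
  std : ∃ l, U.1 ≤ stdOpen i l

instance {X C : Scheme.{0}} {N : ℕ} (i : X ⟶ PP (N + 1)) (π : X ⟶ C) : Preorder (Chart i π) where
  le c d := c.U ≤ d.U ∧ c.W ≤ d.W
  le_refl c := ⟨le_refl c.U, le_refl c.W⟩
  le_trans _ _ _ h h' := ⟨h.1.trans h'.1, h.2.trans h'.2⟩

theorem Chart.mono {X C : Scheme.{0}} {N : ℕ} (i : X ⟶ PP (N + 1)) (π : X ⟶ C) :
    Monotone fun c : Chart i π => c.U :=
  fun c d h => (show c.U ≤ d.U ∧ c.W ≤ d.W from h).1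

section ScrollSheaves

variable {X C : Scheme.{0}} (pX : X ⟶ Spec (.of ℂ)) (pC : C ⟶ Spec (.of ℂ)) {N : ℕ}
  (i : X ⟶ PP (N + 1)) (π : X ⟶ C)

/-- The base of charts, with the structure sheaf of `X`. -/
abbrev chartBase : AlgBase :=
  (affineBase pX).reindex (fun c : Chart i π => c.U) (Chart.mono i π)

/-- The hyperplane bundle `L` of `X`, the inverse image of `O(1)`. -/
def hyperplaneBundle : PMod (chartBase pX i π) :=
  (twist i pX).reindex (fun c : Chart i π => c.U) (Chart.mono i π)

/-- The homomorphism `j_k : V ⊗ O_X → P^k(L)`, where `V` has the homogeneous coordinates as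
basis. -/
def jetMorphism (k : ℕ) :
    PMod.Hom (PMod.free (chartBase pX i π) (N + 1))
      ((hyperplaneBundle pX i π).principalParts k) :=
  PMod.jetHom k _ fun l => (coordSection i pX l).reindex _ (Chart.mono i π)

/-- `Q_k = Coker j_k`. -/
def Q (k : ℕ) : PMod (chartBase pX i π) := PMod.coker (jetMorphism pX i π k)

/-- `E_k = P^k(L)^∨ / Q_k^∨`. -/
def E (k : ℕ) : PMod (chartBase pX i π) :=
  PMod.coker (PMod.dualMap (PMod.cokerProj (jetMorphism pX i π k)))

/-- The morphism `π` of schemes over `ℂ`, on bases. -/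
def projHom (hπ : π ≫ pC = pX) : BaseHom (chartBase pX i π) (affineBase pC) where
  idx c := c.W
  mono h := h.2
  map c :=
    letI := (structureHom pX c.U.1).toAlgebra
    letI := (structureHom pC c.W.1).toAlgebra
    ({ (π.appLE c.W.1 c.U.1 c.le).hom with
        commutes' := fun r => by
          subst hπ
          change (π.appLE c.W.1 c.U.1 c.le).hom (structureHom pC c.W.1 r) =
            structureHom (π ≫ pC) c.U.1 r
          change ((Scheme.ΓSpecIso (.of ℂ)).inv ≫ pC.appLE ⊤ c.W.1 (le_preimage_top pC c.W.1) ≫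
            π.appLE c.W.1 c.U.1 c.le).hom r = _
          rw [Scheme.Hom.appLE_comp_appLE]
          rfl } : Γ(C, c.W.1) →ₐ[ℂ] Γ(X, c.U.1))
  naturality {c d} h a := by
    change (π.appLE c.W.1 c.U.1 c.le).hom (rs h.2 a) =
      rs h.1 ((π.appLE d.W.1 d.U.1 d.le).hom a)
    change (C.presheaf.map (homOfLE h.2).op ≫ π.appLE c.W.1 c.U.1 c.le).hom a =
      (π.appLE d.W.1 d.U.1 d.le ≫ X.presheaf.map (homOfLE h.1).op).hom a
    rw [Scheme.Hom.appLE_map, Scheme.Hom.map_appLE]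

/-- The cotangent sheaf `Ω_X`. -/
abbrev cotangentX : PMod (chartBase pX i π) := PMod.cotangent (chartBase pX i π)

/-- The inverse image `π^* Ω_C` of the cotangent sheaf of `C`. -/
abbrev pullCotangentC (hπ : π ≫ pC = pX) : PMod (chartBase pX i π) :=
  (PMod.cotangent (affineBase pC)).pullback (projHom pX pC i π hπ)

/-- The inverse image `π^* T_C` of the tangent sheaf of `C`. -/
abbrev pullTangentC (hπ : π ≫ pC = pX) : PMod (chartBase pX i π) :=
  (PMod.cotangent (affineBase pC)).dual.pullback (projHom pX pC i π hπ)

end ScrollSheaves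

end Scroll

end

/-! Near every point X has coordinates adapted to the scroll. Over a small open set W of C with a
coordinate t, X is the product of W and the projective space of dimension n-1; where x_a does not
vanish, t and the n-1 quotients x_c/x_a are coordinates of X. The components of a section of O(1) on
the product are polynomials in these quotients over the functions on W, and the transition factor
between two standard open sets forces their degree to be at most one (`exists_linear`). Hence, for a
suitable local generator e of L, every homogeneous coordinate of P^N restricts to (q₀ + ∑ q_c x_c) e
with q₀ and q_c coming from the curve (`exists_localCoord`).

Put ξ_c = 1 ⊗ x_c - x_c ⊗ 1, and let o be the index with x_o = t. By Taylor expansion the monomials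
ξ^α e with |α| ≤ k are a basis of P^k(L) (`isBasis_jetMon`). The jet of a function on the curve is a
polynomial in ξ_o alone, so the jet of a section of the form above involves only the monomials ξ_o^m
and ξ_o^m ξ_c (`jet_mem_span_jetMon`). There are exactly kn+1 of these in degree at most k
(`card_scrollExpLE`), which is the assumed generic rank. So the image of j_k has full rank in the
free summand that they span. The quotient of the summand by the image is torsion, which the dual
does not see: a functional that vanishes on the image vanishes on the whole summand
(`apply_eq_zero_of_finrank_eq`). It follows that, locally, the coordinates of the remaining
monomials are a basis of Q_k^∨, and the classes of the kn+1 distinguished coordinates are a basis of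
E_k (`IsGenericSpan`).

For the exact sequences, S^k Ω ⊗ L maps onto the kernel of P^k(L) → P^(k-1)(L). The image of
(π^*Ω_C)^(k-1) ⊗ Ω_X ⊗ L in S^k Ω ⊗ L has the basis dt^(k-1) dx_a ⊗ e, the distinguished monomials
of degree k; the cokernel M_k therefore has the other monomials of degree k as a local basis. Left
exactness of the dual sequences is formal, and functionals are extended by zero in the monomial
basis to obtain local surjectivity (`IsScrollBase.isShortExact_dualCoker`,
`IsScrollBase.isShortExact_quotient`). The last term of the sequence of the E_k first appears as the
dual of a tensor product. It is identified with the tensor product of the duals by a perfect pairing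
(`Pairing.ofDual`); perfectness is expressed by dual systems of generators, because the
differentials are only projective on a general affine open set. -/

noncomputable section

namespace Scroll

section

/-! ### Bases as families -/

/-- The family `v` is a basis. -/
def IsBasis (A : Type*) {ι M : Type*} [CommRing A] [AddCommGroup M] [Module A M] (v : ι → M) :
    Prop :=
  LinearIndependent A v ∧ Submodule.span A (Set.range v) = ⊤

/-- The basis with the given elements. -/
def IsBasis.basis {A ι M : Type*} [CommRing A] [AddCommGroup M] [Module A M] {v : ι → M}
    (h : IsBasis A v) : Module.Basis ι A M :=
  Module.Basis.mk h.1 h.2.ge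

@[simp] theorem IsBasis.basis_apply {A ι M : Type*} [CommRing A] [AddCommGroup M] [Module A M]
    {v : ι → M} (h : IsBasis A v) (i : ι) : h.basis i = v i := by
  simp [IsBasis.basis]

theorem _root_.Module.Basis.isBasis {A ι M : Type*} [CommRing A] [AddCommGroup M] [Module A M]
    (b : Module.Basis ι A M) : IsBasis A b :=
  ⟨b.linearIndependent, b.span_eq⟩

/-! ### Principal parts of an algebra with coordinates -/

section Taylor

variable {A : Type} [CommRing A] [Algebra ℂ A] {σ : Type} (x : σ → A)

/-- The functions x define an étale map to affine space. The base change of the differentials of the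
polynomial ring goes to `Ω[A⁄ℂ]` by carrying a basis to a basis, so it is bijective. In the exact
sequence of the tower ℂ → ℂ[X] → A this kills both the relative differentials and, as `A` is
formally smooth over ℂ, the relative `H1Cotangent`. -/
theorem formallySmooth_of_isBasis [Algebra.FormallySmooth ℂ A]
    (hx : IsBasis A fun i => KaehlerDifferential.D ℂ A (x i)) :
    letI : Algebra (MvPolynomial σ ℂ) A := (MvPolynomial.aeval x).toAlgebra
    Algebra.FormallySmooth (MvPolynomial σ ℂ) A := by
  let _ : Algebra (MvPolynomial σ ℂ) A := (MvPolynomial.aeval x).toAlgebra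
  have : IsScalarTower ℂ (MvPolynomial σ ℂ) A :=
    IsScalarTower.of_algebraMap_eq fun r => ((MvPolynomial.aeval x).commutes r).symm
  let b := (KaehlerDifferential.mvPolynomialBasis ℂ σ).baseChange A
  have hb : ∀ i, KaehlerDifferential.mapBaseChange ℂ (MvPolynomial σ ℂ) A (b i) = hx.basis i := by
    intro i
    simp only [b, Module.Basis.baseChange_apply, IsBasis.basis_apply,
      KaehlerDifferential.mvPolynomialBasis_apply, KaehlerDifferential.mapBaseChange_tmul,
      KaehlerDifferential.map_D, one_smul]
    congr 1
    exact MvPolynomial.aeval_X x i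
  have hbij : Function.Bijective (KaehlerDifferential.mapBaseChange ℂ (MvPolynomial σ ℂ) A) := by
    have : KaehlerDifferential.mapBaseChange ℂ (MvPolynomial σ ℂ) A =
        (b.equiv hx.basis (Equiv.refl σ)).toLinearMap := by
      refine b.ext fun i => ?_
      rw [hb]
      simp
    rw [this]
    exact (b.equiv hx.basis (Equiv.refl σ)).bijective
  have hsub : Subsingleton (Algebra.H1Cotangent (MvPolynomial σ ℂ) A) := by
    refine ⟨fun y z => ?_⟩
    suffices h : ∀ y : Algebra.H1Cotangent (MvPolynomial σ ℂ) A, y = 0 by rw [h y, h z]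
    intro y
    have h0 : Algebra.H1Cotangent.δ ℂ (MvPolynomial σ ℂ) A y = 0 := by
      apply hbij.1
      rw [map_zero]
      exact (Algebra.H1Cotangent.exact_δ_mapBaseChange ℂ (MvPolynomial σ ℂ) A _).2 ⟨y, rfl⟩
    obtain ⟨w, rfl⟩ := (Algebra.H1Cotangent.exact_map_δ ℂ (MvPolynomial σ ℂ) A y).1 h0
    rw [Subsingleton.elim w 0, map_zero]
  have hΩ : Subsingleton Ω[A⁄MvPolynomial σ ℂ] := by
    refine ⟨fun y z => ?_⟩
    suffices h : ∀ y : Ω[A⁄MvPolynomial σ ℂ], y = 0 by rw [h y, h z]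
    intro y
    obtain ⟨w, rfl⟩ := KaehlerDifferential.map_surjective ℂ (MvPolynomial σ ℂ) A y
    obtain ⟨v, rfl⟩ := hbij.2 w
    exact (KaehlerDifferential.exact_mapBaseChange_map ℂ (MvPolynomial σ ℂ) A _).2 ⟨v, rfl⟩
  exact ⟨inferInstance, hsub⟩

/-- Send the variables to `y`; modulo `J` this agrees with `c`, so `c` modulo `J` is a homomorphism
over the polynomial ring. Formal smoothness over that ring lifts it, and linearity over that ring is
what fixes the values at the `x i`. -/
theorem exists_lift_of_isBasis [Algebra.FormallySmooth ℂ A]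
    (hx : IsBasis A fun i => KaehlerDifferential.D ℂ A (x i)) {T : Type} [CommRing T] [Algebra ℂ T]
    (J : Ideal T) (hJ : IsNilpotent J) (c : A →ₐ[ℂ] T) (y : σ → T) (hy : ∀ i, y i - c (x i) ∈ J) :
    ∃ τ : A →ₐ[ℂ] T, (∀ i, τ (x i) = y i) ∧ ∀ a, τ a - c a ∈ J := by
  let _ : Algebra (MvPolynomial σ ℂ) A := (MvPolynomial.aeval x).toAlgebra
  have : Algebra.FormallySmooth (MvPolynomial σ ℂ) A := formallySmooth_of_isBasis x hx
  have : IsScalarTower ℂ (MvPolynomial σ ℂ) A :=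
    IsScalarTower.of_algebraMap_eq fun r => ((MvPolynomial.aeval x).commutes r).symm
  let ψ : MvPolynomial σ ℂ →ₐ[ℂ] T := MvPolynomial.aeval y
  let _ : Algebra (MvPolynomial σ ℂ) T := ψ.toAlgebra
  have : IsScalarTower ℂ (MvPolynomial σ ℂ) T :=
    IsScalarTower.of_algebraMap_eq fun r => (ψ.commutes r).symm
  have hc : ((Ideal.Quotient.mk J).comp (c : A →+* T)).comp (algebraMap (MvPolynomial σ ℂ) A) =
      (Ideal.Quotient.mk J).comp (algebraMap (MvPolynomial σ ℂ) T) := by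
    refine MvPolynomial.ringHom_ext (fun r => ?_) fun i => ?_
    · have h1 : algebraMap (MvPolynomial σ ℂ) A (MvPolynomial.C r) = algebraMap ℂ A r :=
        (MvPolynomial.aeval x).commutes r
      have h2 : algebraMap (MvPolynomial σ ℂ) T (MvPolynomial.C r) = algebraMap ℂ T r :=
        ψ.commutes r
      simp only [RingHom.comp_apply, h1, h2]
      simp
    · have h1 : algebraMap (MvPolynomial σ ℂ) A (MvPolynomial.X i) = x i :=
        MvPolynomial.aeval_X x i
      have h2 : algebraMap (MvPolynomial σ ℂ) T (MvPolynomial.X i) = y i :=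
        MvPolynomial.aeval_X _ i
      simp only [RingHom.comp_apply, h1, h2]
      exact (Ideal.Quotient.eq.2 (hy i)).symm
  let g : A →ₐ[MvPolynomial σ ℂ] T ⧸ J :=
    { (Ideal.Quotient.mk J).comp (c : A →+* T) with
      commutes' := fun p => congrArg (fun f => f p) hc }
  let τ := Algebra.FormallySmooth.lift J hJ g
  refine ⟨τ.restrictScalars ℂ, fun i => ?_, fun a => ?_⟩
  · have h1 : algebraMap (MvPolynomial σ ℂ) A (MvPolynomial.X i) = x i :=
      MvPolynomial.aeval_X x i
    change τ (x i) = _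
    rw [← h1, τ.commutes]
    exact MvPolynomial.aeval_X _ i
  · change τ a - _ ∈ J
    rw [← Ideal.Quotient.eq]
    exact Algebra.FormallySmooth.mk_lift J hJ g a

variable (A σ) in
/-- Truncated polynomials. -/
abbrev Trunc (k : ℕ) : Type := MvPolynomial σ A ⧸ MvPolynomial.idealOfVars σ A ^ (k + 1)

/-- Taylor expansion of functions in the coordinates `x`. -/
theorem exists_taylor [Algebra.FormallySmooth ℂ A]
    (hx : IsBasis A fun i => KaehlerDifferential.D ℂ A (x i)) (k : ℕ) :
    ∃ τ : A →ₐ[ℂ] Trunc A σ k,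
      (∀ i, τ (x i) = Ideal.Quotient.mk _ (MvPolynomial.C (x i) + MvPolynomial.X i)) ∧
      ∀ a, τ a - Ideal.Quotient.mk _ (MvPolynomial.C a) ∈
        (MvPolynomial.idealOfVars σ A).map (Ideal.Quotient.mk _) := by
  -- The homomorphism to deform is the inclusion of constants; replacing `x i` by `x i + X i`
  -- changes it only by an element of the nilpotent ideal of the variables.
  refine exists_lift_of_isBasis x hx ((MvPolynomial.idealOfVars σ A).map (Ideal.Quotient.mk _))
    ⟨k + 1, by rw [← Ideal.map_pow, Ideal.zero_eq_bot, Ideal.map_quotient_self]⟩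
    (IsScalarTower.toAlgHom ℂ A (Trunc A σ k))
    (fun i => Ideal.Quotient.mk _ (MvPolynomial.C (x i) + MvPolynomial.X i)) fun i => ?_
  have : (Ideal.Quotient.mk (MvPolynomial.idealOfVars σ A ^ (k + 1)))
      (MvPolynomial.C (x i) + MvPolynomial.X i) - IsScalarTower.toAlgHom ℂ A (Trunc A σ k) (x i) =
      Ideal.Quotient.mk _ (MvPolynomial.X i) := by
    rw [map_add]
    exact add_sub_cancel_left _ _
  rw [this]
  exact Ideal.mem_map_of_mem _ (Ideal.subset_span ⟨i, rfl⟩)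

/-- The element `1 ⊗ a - a ⊗ 1`. -/
def diff (a : A) : A ⊗[ℂ] A := 1 ⊗ₜ a - a ⊗ₜ 1

theorem diff_mem (a : A) : diff a ∈ KaehlerDifferential.ideal ℂ A := by
  rw [← KaehlerDifferential.span_range_eq_ideal]
  exact Ideal.subset_span ⟨a, rfl⟩

/-- Substitution of the elements `diff (x i)` in a polynomial. -/
def diffEval : MvPolynomial σ A →ₐ[A] A ⊗[ℂ] A := MvPolynomial.aeval fun i => diff (x i)

/-- The monomial of exponent `α` in the elements `diff (x i)`. -/
def diffMon (α : σ →₀ ℕ) : A ⊗[ℂ] A := α.prod fun i m => diff (x i) ^ m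

theorem diffEval_monomial (α : σ →₀ ℕ) (a : A) :
    diffEval x (MvPolynomial.monomial α a) = a • diffMon x α := by
  rw [diffEval, MvPolynomial.aeval_monomial, Algebra.smul_def]
  rfl

theorem diffMon_mem (α : σ →₀ ℕ) : diffMon x α ∈ KaehlerDifferential.ideal ℂ A ^ α.degree := by
  rw [diffMon, Finsupp.degree_apply, Finsupp.prod, ← Finset.prod_pow_eq_pow_sum]
  exact Ideal.prod_mem_prod fun i _ => Ideal.pow_mem_pow (diff_mem _) _

/-- The Taylor expansion `τ` gives a map `θ`, a ⊗ b ↦ a τ(b), that sends `diff (x i)` to the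
variable X_i and the ideal of the diagonal into the ideal of the variables. So `θ` undoes `diffEval`
up to degree k and kills the power k + 1 of the ideal of the diagonal. -/
theorem diffEval_mem_of_degree_le {k : ℕ} {p : MvPolynomial σ A}
    (hp : ∀ α ∈ p.support, α.degree ≤ k) (h : diffEval x p ∈ KaehlerDifferential.ideal ℂ A ^ (k + 1))
    [Algebra.FormallySmooth ℂ A]
    (hx : IsBasis A fun i => KaehlerDifferential.D ℂ A (x i)) : p = 0 := by
  obtain ⟨τ, hτ, hτ'⟩ := exists_taylor x hx k
  let θ : A ⊗[ℂ] A →ₐ[A] Trunc A σ k :=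
    Algebra.TensorProduct.lift (Algebra.ofId A _) τ fun _ _ => Commute.all _ _
  have hθ : ∀ a, θ (diff a) = τ a - Ideal.Quotient.mk _ (MvPolynomial.C a) := by
    intro a
    simp only [diff, map_sub, θ, Algebra.TensorProduct.lift_tmul, map_one, one_mul, mul_one]
    rfl
  have hI : (KaehlerDifferential.ideal ℂ A).map (θ : A ⊗[ℂ] A →+* Trunc A σ k) ≤
      (MvPolynomial.idealOfVars σ A).map (Ideal.Quotient.mk _) := by
    rw [← KaehlerDifferential.span_range_eq_ideal, Ideal.map_span, Ideal.span_le]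
    rintro _ ⟨_, ⟨a, rfl⟩, rfl⟩
    exact (hθ a).symm ▸ hτ' a
  have hcomp : ∀ p, θ (diffEval x p) = Ideal.Quotient.mk _ p := by
    intro p
    have : θ.comp (diffEval x) = Ideal.Quotient.mkₐ A _ := by
      refine MvPolynomial.algHom_ext fun i => ?_
      simp only [AlgHom.comp_apply, diffEval, MvPolynomial.aeval_X, hθ, hτ]
      simp
    exact congrArg (fun f => f p) this
  have h0 : θ (diffEval x p) = 0 := by
    have h1 := Ideal.mem_map_of_mem (θ : A ⊗[ℂ] A →+* Trunc A σ k) h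
    rw [Ideal.map_pow] at h1
    have h2 := Ideal.pow_right_mono hI (k + 1) h1
    rw [← Ideal.map_pow, Ideal.map_quotient_self] at h2
    exact h2
  rw [hcomp, Ideal.Quotient.eq_zero_iff_mem, MvPolynomial.mem_pow_idealOfVars_iff] at h0
  by_contra hne
  obtain ⟨α, hα⟩ := Finset.nonempty_iff_ne_empty.2 (mt MvPolynomial.support_eq_empty.1 hne)
  have := hp α hα
  have := h0 α hα
  omega

/-- This is the identification of I/I² with the module of differentials: a combination of the
differentials of the `x i` lifts to a linear polynomial in the `diff (x i)`. -/
theorem exists_diffEval_of_mem_ideal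
    (hx : Submodule.span A (Set.range fun i => KaehlerDifferential.D ℂ A (x i)) = ⊤)
    (z : A ⊗[ℂ] A) (hz : z ∈ KaehlerDifferential.ideal ℂ A) :
    ∃ p, z - diffEval x p ∈ KaehlerDifferential.ideal ℂ A ^ 2 := by
  have key : ∀ w : Ω[A⁄ℂ], ∃ (p : MvPolynomial σ A)
      (hp : diffEval x p ∈ KaehlerDifferential.ideal ℂ A),
      KaehlerDifferential.fromIdeal ℂ A ⟨_, hp⟩ = w := by
    intro w
    have hw : w ∈ Submodule.span A (Set.range fun i => KaehlerDifferential.D ℂ A (x i)) :=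
      hx ▸ Submodule.mem_top
    induction hw using Submodule.span_induction with
    | mem w hw =>
      obtain ⟨i, rfl⟩ := hw
      have h : diffEval x (MvPolynomial.X i) = diff (x i) := by simp [diffEval]
      refine ⟨MvPolynomial.X i, h ▸ diff_mem _, ?_⟩
      exact congrArg (KaehlerDifferential.fromIdeal ℂ A) (Subtype.ext h)
    | zero =>
      exact ⟨0, by simp, (congrArg (KaehlerDifferential.fromIdeal ℂ A)
        (Subtype.ext (map_zero _))).trans (map_zero _)⟩
    | add w w' _ _ h h' =>
      obtain ⟨p, hp, rfl⟩ := h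
      obtain ⟨q, hq, rfl⟩ := h'
      refine ⟨p + q, by rw [map_add]; exact add_mem hp hq, ?_⟩
      exact (congrArg (KaehlerDifferential.fromIdeal ℂ A)
        (Subtype.ext (map_add _ _ _))).trans 
        (map_add (KaehlerDifferential.fromIdeal ℂ A) ⟨_, hp⟩ ⟨_, hq⟩)
    | smul a w _ h =>
      obtain ⟨p, hp, rfl⟩ := h
      have hs : diffEval x (a • p) = (algebraMap A (A ⊗[ℂ] A) a) * diffEval x p := by
        rw [map_smul, Algebra.smul_def]
      refine ⟨a • p, hs ▸ Ideal.mul_mem_left _ _ hp, ?_⟩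
      rw [← algebraMap_smul (A ⊗[ℂ] A) a (KaehlerDifferential.fromIdeal ℂ A ⟨_, hp⟩)]
      exact (congrArg (KaehlerDifferential.fromIdeal ℂ A)
        (Subtype.ext hs)).trans 
        (map_smul (KaehlerDifferential.fromIdeal ℂ A) (algebraMap A (A ⊗[ℂ] A) a) ⟨_, hp⟩)
  obtain ⟨p, hp, h⟩ := key (KaehlerDifferential.fromIdeal ℂ A ⟨z, hz⟩)
  exact ⟨p, (Ideal.toCotangent_eq _ (x := ⟨z, hz⟩) (y := ⟨_, hp⟩)).1 h.symm⟩

/-- Leading terms are multiplicative, so degree m + 1 reduces to degrees one and m. -/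
theorem exists_diffEval_of_mem_pow
    (hx : Submodule.span A (Set.range fun i => KaehlerDifferential.D ℂ A (x i)) = ⊤) (m : ℕ) :
    ∀ z ∈ KaehlerDifferential.ideal ℂ A ^ m,
      ∃ p, z - diffEval x p ∈ KaehlerDifferential.ideal ℂ A ^ (m + 1) := by
  induction m with
  | zero =>
    intro z _
    -- The constant term of an element of A ⊗ A is its restriction to the diagonal.
    refine ⟨MvPolynomial.C (Algebra.TensorProduct.lmul' ℂ z), ?_⟩
    have : diffEval x (MvPolynomial.C (Algebra.TensorProduct.lmul' ℂ z)) =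
        (Algebra.TensorProduct.lmul' ℂ z) ⊗ₜ[ℂ] (1 : A) := by
      rw [diffEval, MvPolynomial.aeval_C]; rfl
    rw [this, zero_add, pow_one]
    change Algebra.TensorProduct.lmul' ℂ _ = 0
    simp
  | succ m ih =>
    intro z hz
    rw [pow_succ'] at hz
    refine Submodule.mul_induction_on hz ?_ ?_
    · intro a ha b hb
      obtain ⟨p, hp⟩ := exists_diffEval_of_mem_ideal x hx a ha
      obtain ⟨q, hq⟩ := ih b hb
      refine ⟨p * q, ?_⟩
      have hp' : diffEval x p ∈ KaehlerDifferential.ideal ℂ A := by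
        have := sub_mem ha (Ideal.pow_le_self two_ne_zero hp)
        simpa using this
      -- The two summands lie in I² · I^m and in I · I^(m+1), both equal to the required power.
      have e : a * b - diffEval x (p * q) =
          (a - diffEval x p) * b + diffEval x p * (b - diffEval x q) := by
        rw [map_mul]; ring
      rw [e]
      refine add_mem ?_ ?_
      · have := Ideal.mul_mem_mul hp hb
        rwa [← pow_add, show 2 + m = m + 1 + 1 by omega] at this
      · have := Ideal.mul_mem_mul hp' hq
        rwa [← pow_succ'] at this
    · rintro a b ⟨p, hp⟩ ⟨q, hq⟩
      refine ⟨p + q, ?_⟩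
      rw [map_add, add_sub_add_comm]
      exact add_mem hp hq

theorem exists_diffEval
    (hx : Submodule.span A (Set.range fun i => KaehlerDifferential.D ℂ A (x i)) = ⊤) (m : ℕ)
    (z : A ⊗[ℂ] A) : ∃ p, z - diffEval x p ∈ KaehlerDifferential.ideal ℂ A ^ m := by
  induction m with
  | zero => exact ⟨0, by simp⟩
  | succ m ih =>
    obtain ⟨p, hp⟩ := ih
    obtain ⟨q, hq⟩ := exists_diffEval_of_mem_pow x hx m _ hp
    exact ⟨p + q, by rwa [map_add, ← sub_sub]⟩

/-- Exponents of total degree at most `k`. -/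
abbrev ExpLE (σ : Type) (k : ℕ) : Type := { α : σ →₀ ℕ // α.degree ≤ k }

/-- Successive approximation replaces an element by a polynomial in the `diff (x i)`, and the terms
of degree above k are already in the power k + 1 of the ideal. -/
theorem span_diffMon_sup
    (hx : Submodule.span A (Set.range fun i => KaehlerDifferential.D ℂ A (x i)) = ⊤) (k : ℕ) :
    Submodule.span A (Set.range fun α : ExpLE σ k => diffMon x α.1) ⊔
      (KaehlerDifferential.ideal ℂ A ^ (k + 1)).restrictScalars A = ⊤ := by
  rw [eq_top_iff]
  intro z _
  obtain ⟨p, hp⟩ := exists_diffEval x hx (k + 1) z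
  rw [← sub_add_cancel z (diffEval x p)]
  refine add_mem (Submodule.mem_sup_right hp) ?_
  rw [p.as_sum, map_sum]
  refine sum_mem fun α _ => ?_
  rw [diffEval_monomial]
  refine Submodule.smul_mem _ _ ?_
  by_cases h : α.degree ≤ k
  · exact Submodule.mem_sup_left (Submodule.subset_span ⟨⟨α, h⟩, rfl⟩)
  · exact Submodule.mem_sup_right (Ideal.pow_le_pow_right (by omega) (diffMon_mem x α))

end Taylor

end

section

/-! ### Modules of principal parts and their monomial bases -/

section JetModule

variable {A : Type} [CommRing A] [Algebra ℂ A] {M : Type} [AddCommGroup M] [Module A M]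
  [Module ℂ M] [IsScalarTower ℂ A M]

/-- The map `A ⊗ A → A ⊗ M`, `a ⊗ b ↦ a ⊗ b m`. -/
def jetIns (m : M) : A ⊗[ℂ] A →ₗ[A] A ⊗[ℂ] M :=
  TensorProduct.AlgebraTensorModule.lTensor A A ((LinearMap.toSpanSingleton A M m).restrictScalars ℂ)

@[simp] theorem jetIns_tmul (m : M) (a b : A) : jetIns m (a ⊗ₜ[ℂ] b) = a ⊗ₜ[ℂ] (b • m) := rfl

theorem jetIns_one (m : M) : jetIns m (1 : A ⊗[ℂ] A) = (1 : A) ⊗ₜ[ℂ] m := by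
  rw [Algebra.TensorProduct.one_def, jetIns_tmul, one_smul]

theorem jetIns_diff_mul (m : M) (a : A) (z : A ⊗[ℂ] A) :
    jetIns m (diff a * z) = delta M a (jetIns m z) := by
  induction z with
  | zero => simp
  | tmul b c => simp [diff, sub_mul, delta_tmul, mul_smul]
  | add y z hy hz => rw [mul_add, map_add, map_add, map_add, hy, hz]

theorem jetIns_smul (m : M) (a : A) (z : A ⊗[ℂ] A) :
    jetIns (a • m) z = jetIns m ((1 ⊗ₜ a) * z) := by
  induction z with
  | zero => simp
  | tmul b c => simp [mul_smul, smul_comm a c m]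
  | add y z hy hz => rw [mul_add, map_add, map_add, hy, hz]

/-- Linearity in `m` fails only by a term with one more factor from the ideal of the diagonal. This
makes the map from S^k Ω ⊗ M to P^k(M) well defined. -/
theorem jetIns_smul_eq (m : M) (a : A) (z : A ⊗[ℂ] A) :
    jetIns (a • m) z = a • jetIns m z + jetIns m (diff a * z) := by
  rw [jetIns_smul, ← map_smul, ← map_add]
  congr 1
  rw [Algebra.smul_def, ← add_mul, diff]
  simp

theorem jetIns_add (m m' : M) (z : A ⊗[ℂ] A) :
    jetIns (m + m') z = jetIns m z + jetIns m' z := by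
  induction z with
  | zero => simp
  | tmul b c => simp [TensorProduct.tmul_add]
  | add y z hy hz => rw [map_add, map_add, map_add, hy, hz]; abel

theorem jetIns_mem (m : M) (k : ℕ) :
    ∀ z ∈ KaehlerDifferential.ideal ℂ A ^ k, jetIns m z ∈ diagPow A M k := by
  induction k with
  | zero => intro z _; trivial
  | succ k ih =>
    intro z hz
    rw [pow_succ'] at hz
    refine Submodule.mul_induction_on hz ?_ ?_
    · intro a ha b hb
      have ha' : a ∈ Submodule.span A (Set.range fun s : A => (1 : A) ⊗ₜ[ℂ] s - s ⊗ₜ[ℂ] (1 : A)) := by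
        rw [KaehlerDifferential.submodule_span_range_eq_ideal]; exact ha
      clear ha hz
      induction ha' using Submodule.span_induction with
      | mem a ha =>
        obtain ⟨a, rfl⟩ := ha
        change jetIns m (diff a * b) ∈ _
        rw [jetIns_diff_mul]
        exact Submodule.mem_iSup_of_mem a ⟨_, ih b hb, rfl⟩
      | zero => simp
      | add a a' _ _ h h' => rw [add_mul, map_add]; exact add_mem h h'
      | smul c a _ h => rw [smul_mul_assoc, map_smul]; exact Submodule.smul_mem _ _ h
    · intro a b ha hb
      rw [map_add]
      exact add_mem ha hb

variable (A M) in
-- The recursive definition is traded for explicit generators, on which powers of the ideal of the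
-- diagonal and images of products of differentials can be recognised.
theorem diagPow_eq_span (k : ℕ) :
    diagPow A M k =
      Submodule.span A (Set.range fun p : (Fin k → A) × M => jetIns p.2 (∏ l, diff (p.1 l))) := by
  induction k with
  | zero =>
    refine (eq_top_iff.2 fun z _ => ?_).symm
    induction z with
    | zero => exact zero_mem _
    | tmul b m =>
      have : b ⊗ₜ[ℂ] m = b • jetIns m (1 : A ⊗[ℂ] A) := by
        rw [jetIns_one, TensorProduct.smul_tmul', smul_eq_mul, mul_one]
      rw [this]
      exact Submodule.smul_mem _ _ (Submodule.subset_span ⟨(Fin.elim0, m), by simp⟩)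
    | add y z hy hz => exact add_mem (hy trivial) (hz trivial)
  | succ k ih =>
    refine le_antisymm (iSup_le fun a => ?_) ?_
    · rw [ih, Submodule.map_span, Submodule.span_le]
      rintro _ ⟨_, ⟨⟨c, m⟩, rfl⟩, rfl⟩
      refine Submodule.subset_span ⟨(Fin.cons a c, m), ?_⟩
      simp [Fin.prod_univ_succ, jetIns_diff_mul]
    · rw [Submodule.span_le]
      rintro _ ⟨⟨c, m⟩, rfl⟩
      refine jetIns_mem m (k + 1) _ ?_
      have : ∏ l, diff (c l) ∈ ∏ _l : Fin (k + 1), KaehlerDifferential.ideal ℂ A :=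
        Ideal.prod_mem_prod fun i _ => diff_mem _
      simpa using this

theorem diagPow_succ_le (k : ℕ) : diagPow A M (k + 1) ≤ diagPow A M k := by
  rw [diagPow_eq_span, Submodule.span_le]
  rintro _ ⟨⟨c, m⟩, rfl⟩
  refine jetIns_mem m k _ (Ideal.pow_le_pow_right (Nat.le_succ k) ?_)
  have : ∏ l, diff (c l) ∈ ∏ _l : Fin (k + 1), KaehlerDifferential.ideal ℂ A :=
    Ideal.prod_mem_prod fun i _ => diff_mem _
  simpa using this

/-- The truncation `P^(k+1)(M) → P^k(M)`. -/
def jetTrunc (k : ℕ) : Jet A M (k + 1) →ₗ[A] Jet A M k :=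
  Submodule.factor (diagPow_succ_le (k + 1))

theorem jetTrunc_surjective (k : ℕ) : Function.Surjective (jetTrunc k : Jet A M (k + 1) →ₗ[A] _) :=
  Submodule.factor_surjective (diagPow_succ_le (k + 1))

@[simp] theorem jetTrunc_mk (k : ℕ) (z : A ⊗[ℂ] M) :
    jetTrunc k (Submodule.Quotient.mk z : Jet A M (k + 1)) = Submodule.Quotient.mk z := rfl

/-! Jets when `M` has a generator -/

theorem jetIns_bijective {e : M} (he : IsBasis A fun _ : Unit => e) :
    Function.Bijective (jetIns e : A ⊗[ℂ] A →ₗ[A] A ⊗[ℂ] M) := by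
  have hb : Function.Bijective (LinearMap.toSpanSingleton A M e) := by
    have : LinearMap.toSpanSingleton A M e =
        ((LinearEquiv.funUnique Unit A A).symm.trans he.basis.equivFun.symm).toLinearMap := by
      ext
      simp [Module.Basis.equivFun_symm_apply]
    rw [this]
    exact LinearEquiv.bijective _
  let f := (LinearEquiv.ofBijective _ hb).restrictScalars ℂ
  exact (TensorProduct.AlgebraTensorModule.congr (LinearEquiv.refl A A) f).bijective

/-- Every element of M is some b e, and inserting b e amounts to multiplying by 1 ⊗ b before
inserting e. So the generators of `diagPow` are images of elements of the power of the ideal, and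
`jetIns e` is injective. -/
theorem mem_pow_of_jetIns_mem {e : M} (he : IsBasis A fun _ : Unit => e) (k : ℕ) (z : A ⊗[ℂ] A)
    (hz : jetIns e z ∈ diagPow A M k) : z ∈ KaehlerDifferential.ideal ℂ A ^ k := by
  have : diagPow A M k ≤
      ((KaehlerDifferential.ideal ℂ A ^ k).restrictScalars A).map (jetIns e) := by
    rw [diagPow_eq_span, Submodule.span_le]
    rintro _ ⟨⟨c, m⟩, rfl⟩
    obtain ⟨b, hb⟩ : ∃ b : A, b • e = m := by
      have : m ∈ Submodule.span A (Set.range fun _ : Unit => e) := he.2 ▸ Submodule.mem_top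
      rw [Set.range_const, Submodule.mem_span_singleton] at this
      exact this
    refine ⟨(1 ⊗ₜ b) * ∏ l, diff (c l), Ideal.mul_mem_left _ _ ?_, ?_⟩
    · have : ∏ l, diff (c l) ∈ ∏ _l : Fin k, KaehlerDifferential.ideal ℂ A :=
        Ideal.prod_mem_prod fun i _ => diff_mem _
      simpa using this
    · rw [← jetIns_smul, hb]
  obtain ⟨y, hy, h⟩ := this hz
  rwa [← (jetIns_bijective he).1 h]

variable {σ : Type} (x : σ → A)

/-- The class of `diffMon x α` times the jet of `e`. -/
def jetMon (k : ℕ) (e : M) (α : σ →₀ ℕ) : Jet A M k :=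
  Submodule.Quotient.mk (jetIns e (diffMon x α))

theorem jetMon_eq_zero {k : ℕ} (e : M) {α : σ →₀ ℕ} (h : k < α.degree) : jetMon x k e α = 0 :=
  (Submodule.Quotient.mk_eq_zero _).2
    (jetIns_mem e _ _ (Ideal.pow_le_pow_right h (diffMon_mem x α)))

/-- A relation is a polynomial of degree at most k whose value lies in the power k + 1 of the ideal,
hence is zero by the Taylor expansion. Generation is `span_diffMon_sup`, carried over by the
generator `e`. -/
theorem isBasis_jetMon [Algebra.FormallySmooth ℂ A]
    (hx : IsBasis A fun i => KaehlerDifferential.D ℂ A (x i)) {e : M}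
    (he : IsBasis A fun _ : Unit => e) (k : ℕ) :
    IsBasis A fun α : ExpLE σ k => jetMon x k e α.1 := by
  constructor
  · rw [linearIndependent_iff]
    intro c hc
    let p : MvPolynomial σ A := c.sum fun α a => MvPolynomial.monomial α.1 a
    have hp : diffEval x p = c.sum fun α a => a • diffMon x α.1 := by
      simp only [p, Finsupp.sum, map_sum, diffEval_monomial]
    have hcoeff : ∀ β : ExpLE σ k, p.coeff β.1 = c β := by
      intro β
      classical
      simp only [p, Finsupp.sum, MvPolynomial.coeff_sum, MvPolynomial.coeff_monomial,
        Subtype.val_inj]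
      rw [Finset.sum_ite_eq']
      simp +contextual [eq_comm]
    have h0 : p = 0 := by
      refine diffEval_mem_of_degree_le x (k := k) (fun α hα => ?_) ?_ hx
      · by_contra hlt
        rw [MvPolynomial.mem_support_iff] at hα
        refine hα ?_
        classical
        simp only [p, Finsupp.sum, MvPolynomial.coeff_sum, MvPolynomial.coeff_monomial]
        refine Finset.sum_eq_zero fun β _ => if_neg ?_
        rintro rfl
        exact hlt β.2
      · refine mem_pow_of_jetIns_mem he _ _ ?_
        rw [← Submodule.Quotient.mk_eq_zero, hp]
        rw [Finsupp.linearCombination_apply] at hc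
        rw [← hc]
        simp only [Finsupp.sum, map_sum, map_smul, jetMon, ← Submodule.mkQ_apply]
    ext β
    rw [← hcoeff, h0]
    simp
  · rw [eq_top_iff]
    intro z _
    obtain ⟨z, rfl⟩ := Submodule.Quotient.mk_surjective _ z
    obtain ⟨z, rfl⟩ := (jetIns_bijective he).2 z
    have hz : z ∈ Submodule.span A (Set.range fun α : ExpLE σ k => diffMon x α.1) ⊔
      (KaehlerDifferential.ideal ℂ A ^ (k + 1)).restrictScalars A :=
      span_diffMon_sup x hx.2 k ▸ Submodule.mem_top
    obtain ⟨y, hy, w, hw, rfl⟩ := Submodule.mem_sup.1 hz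
    have : (Submodule.Quotient.mk (jetIns e (y + w)) : Jet A M k) =
        ((diagPow A M (k + 1)).mkQ.comp (jetIns e)) y := by
      rw [map_add, LinearMap.comp_apply, Submodule.mkQ_apply, Submodule.Quotient.eq,
        add_sub_cancel_left]
      exact jetIns_mem e _ _ hw
    rw [this]
    have h2 := Submodule.mem_map_of_mem (f := (diagPow A M (k + 1)).mkQ.comp (jetIns e)) hy
    rw [Submodule.map_span, ← Set.range_comp] at h2
    exact h2

end JetModule

/-! ### Naturality of jets -/

section Naturality

variable {A A' : Type} [CommRing A] [CommRing A'] [Algebra ℂ A] [Algebra ℂ A']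
  {M M' : Type} [AddCommGroup M] [Module A M] [Module ℂ M] [IsScalarTower ℂ A M]
  [AddCommGroup M'] [Module A' M'] [Module ℂ M'] [IsScalarTower ℂ A' M']
  (φ : A →ₐ[ℂ] A') (f : M →ₛₗ[(φ : A →+* A')] M')

theorem map_diff (a : A) : Algebra.TensorProduct.map φ φ (diff a) = diff (φ a) := by
  simp [diff]

theorem map_diffMon {σ : Type} (x : σ → A) (α : σ →₀ ℕ) :
    Algebra.TensorProduct.map φ φ (diffMon x α) = diffMon (fun i => φ (x i)) α := by
  simp only [diffMon, Finsupp.prod, map_prod, map_pow, map_diff]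

theorem tmulMap_jetIns (m : M) (z : A ⊗[ℂ] A) :
    tmulMap φ f (jetIns m z) = jetIns (f m) (Algebra.TensorProduct.map φ φ z) := by
  induction z with
  | zero => simp
  | tmul a b => simp
  | add y z hy hz => simp only [map_add, hy, hz]

theorem jetMap_mk (k : ℕ) (z : A ⊗[ℂ] M) :
    jetMap φ f k (Submodule.Quotient.mk z) = Submodule.Quotient.mk (tmulMap φ f z) := rfl

theorem jetMap_jetMon {σ : Type} (x : σ → A) (k : ℕ) (e : M) (α : σ →₀ ℕ) :
    jetMap φ f k (jetMon x k e α) = jetMon (fun i => φ (x i)) k (f e) α := by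
  rw [jetMon, jetMap_mk, tmulMap_jetIns, map_diffMon]
  rfl

theorem jetTrunc_jetMap (k : ℕ) (z : Jet A M (k + 1)) :
    jetTrunc k (jetMap φ f (k + 1) z) = jetMap φ f k (jetTrunc k z) := by
  obtain ⟨z, rfl⟩ := Submodule.Quotient.mk_surjective _ z
  rfl

end Naturality

end

section

/-! ### Symmetric powers of free modules -/

section SymBasis

/-- Exponents of total degree `k`. -/
abbrev ExpEq (σ : Type) (k : ℕ) : Type := { α : σ →₀ ℕ // α.degree = k }

variable {A : Type} [CommRing A] {M : Type} [AddCommGroup M] [Module A M] {σ : Type} (w : σ → M)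

theorem prod_ι_mem {ι : Type} (s : Finset ι) (v : ι → M) (m : ι → ℕ) :
    ∏ i ∈ s, SymmetricAlgebra.ι A M (v i) ^ m i ∈ symPower A M (∑ i ∈ s, m i) := by
  classical
  induction s using Finset.induction_on with
  | empty => simp [symPower, Submodule.mem_one]
  | insert i s hi ih =>
    rw [Finset.prod_insert hi, Finset.sum_insert hi, symPower, pow_add]
    exact Submodule.mul_mem_mul (Submodule.pow_mem_pow _ (LinearMap.mem_range_self _ _) _) ih

/-- The monomial of exponent `α` in the elements `w i`, of degree `k`. -/
def symMon (k : ℕ) (α : ExpEq σ k) : symPower A M k :=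
  ⟨α.1.prod fun i m => SymmetricAlgebra.ι A M (w i) ^ m, by
    have := prod_ι_mem (A := A) α.1.support w α.1
    rwa [← Finsupp.degree_apply, α.2] at this⟩

theorem symPower_eq_span (hw : Submodule.span A (Set.range w) = ⊤) (k : ℕ) :
    symPower A M k =
      Submodule.span A (Set.range fun a : Fin k → σ => ∏ l, SymmetricAlgebra.ι A M (w (a l))) := by
  induction k with
  | zero =>
    rw [symPower, pow_zero, Submodule.one_eq_span]
    congr 1
    ext y
    simp
  | succ k ih =>
    have h1 : LinearMap.range (SymmetricAlgebra.ι A M) =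
        Submodule.span A (Set.range fun i => SymmetricAlgebra.ι A M (w i)) := by
      rw [LinearMap.range_eq_map, ← hw, Submodule.map_span, ← Set.range_comp]
      rfl
    rw [symPower, pow_succ', ← symPower, ih, h1, Submodule.span_mul_span]
    congr 1
    ext y
    constructor
    · rintro ⟨_, ⟨i, rfl⟩, _, ⟨a, rfl⟩, rfl⟩
      exact ⟨Fin.cons i a, by simp [Fin.prod_univ_succ]⟩
    · rintro ⟨a, rfl⟩
      exact ⟨_, ⟨a 0, rfl⟩, _, ⟨fun l => a l.succ, rfl⟩, by simp [Fin.prod_univ_succ]⟩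

/-- The symmetric algebra of a free module is a polynomial ring, in which the monomials of degree k
remain independent; `symPower_eq_span` shows that they generate the part of degree k. -/
theorem isBasis_symMon (hw : IsBasis A w) (k : ℕ) : IsBasis A (symMon (A := A) w k) := by
  have hval : ∀ α : σ →₀ ℕ, hw.basis.symmetricAlgebra α =
      α.prod fun i m => SymmetricAlgebra.ι A M (w i) ^ m := by
    intro α
    have h : hw.basis.symmetricAlgebra α =
        (SymmetricAlgebra.equivMvPolynomial hw.basis).symm (MvPolynomial.monomial α 1) := rfl
    rw [h, MvPolynomial.monomial_eq]
    simp only [Finsupp.prod, map_one, one_mul, map_prod, map_pow,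
      SymmetricAlgebra.equivMvPolynomial_symm_X, IsBasis.basis_apply]
  constructor
  · refine LinearIndependent.of_comp (symPower A M k).subtype ?_
    have := hw.basis.symmetricAlgebra.linearIndependent.comp
      (fun α : ExpEq σ k => α.1) Subtype.val_injective
    convert this using 1
    exact funext fun α => (hval α.1).symm
  · refine (Submodule.span_range_subtype_eq_top_iff _ fun α => (symMon w k α).2).2 ?_
    refine le_antisymm (Submodule.span_le.2 ?_) ?_
    · rintro _ ⟨α, rfl⟩
      exact (symMon w k α).2
    · refine (symPower_eq_span w hw.2 k).le.trans (Submodule.span_le.2 ?_)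
      rintro _ ⟨a, rfl⟩
      refine Submodule.subset_span ⟨⟨∑ l, Finsupp.single (a l) 1, by simp⟩, ?_⟩
      change (∑ l, Finsupp.single (a l) 1).prod _ = _
      rw [← Finsupp.prod_finsetSum_index (by simp) (by simp [pow_add])]
      simp

theorem symMap_symMon {A' : Type} [CommRing A'] {M' : Type}
    [AddCommGroup M'] [Module A' M'] (ψ : A →+* A') (g : M →ₛₗ[ψ] M') (w : σ → M) (k : ℕ)
    (α : ExpEq σ k) :
    symMap ψ g k (symMon w k α) = symMon (fun i => g (w i)) k α := by
  refine Subtype.ext ?_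
  change symAlgMap _ _ (α.1.prod _) = α.1.prod _
  rw [Finsupp.prod, Finsupp.prod, map_prod]
  exact Finset.prod_congr rfl fun l _ => by rw [map_pow, symAlgMap_ι]

end SymBasis

/-! ### From symmetric powers of differentials to principal parts -/

section SymToJet

variable (A : Type) [CommRing A] [Algebra ℂ A]

/-- The elements of the Rees algebra of the ideal of the diagonal whose coefficient of degree `k`
is in the power of exponent `k + 1`. The quotient is the associated graded ring. -/
def grIdeal : Ideal (reesAlgebra (KaehlerDifferential.ideal ℂ A)) where
  carrier := { f | ∀ k, f.1.coeff k ∈ KaehlerDifferential.ideal ℂ A ^ (k + 1) }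
  zero_mem' k := by simp
  add_mem' hf hg k := by
    simpa using add_mem (hf k) (hg k)
  smul_mem' f g hg k := by
    change (f.1 * g.1).coeff k ∈ _
    rw [Polynomial.coeff_mul]
    refine sum_mem fun p hp => ?_
    rw [Finset.HasAntidiagonal.mem_antidiagonal] at hp
    have := Ideal.mul_mem_mul ((mem_reesAlgebra_iff _ _).1 f.2 p.1) (hg p.2)
    rwa [← pow_add, ← add_assoc, hp] at this

/-- The associated graded ring of the ideal of the diagonal. -/
def GrDiag : Type := reesAlgebra (KaehlerDifferential.ideal ℂ A) ⧸ grIdeal A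

instance : CommRing (GrDiag A) :=
  inferInstanceAs (CommRing (reesAlgebra (KaehlerDifferential.ideal ℂ A) ⧸ grIdeal A))

/-- The projection to the associated graded ring. -/
def grMk : reesAlgebra (KaehlerDifferential.ideal ℂ A) →+* GrDiag A := Ideal.Quotient.mk _

instance : Algebra A (GrDiag A) :=
  ((grMk A).comp ((algebraMap (A ⊗[ℂ] A) (reesAlgebra (KaehlerDifferential.ideal ℂ A))).comp
    (algebraMap A (A ⊗[ℂ] A)))).toAlgebra

instance : Algebra ℂ (GrDiag A) := ((algebraMap A (GrDiag A)).comp (algebraMap ℂ A)).toAlgebra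

instance : IsScalarTower ℂ A (GrDiag A) := IsScalarTower.of_algebraMap_eq fun _ => rfl

variable {A}

theorem grMk_surjective : Function.Surjective (grMk A) := Ideal.Quotient.mk_surjective

theorem grMk_eq_grMk {f g : reesAlgebra (KaehlerDifferential.ideal ℂ A)}
    (h : ∀ k, (f.1 - g.1).coeff k ∈ KaehlerDifferential.ideal ℂ A ^ (k + 1)) :
    grMk A f = grMk A g :=
  Ideal.Quotient.eq.2 h

theorem algebraMap_grDiag (a : A) :
    algebraMap A (GrDiag A) a = grMk A (algebraMap (A ⊗[ℂ] A) _ (algebraMap A (A ⊗[ℂ] A) a)) := rfl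

theorem monomial_mem_rees {k : ℕ} {z : A ⊗[ℂ] A} (hz : z ∈ KaehlerDifferential.ideal ℂ A ^ k) :
    Polynomial.monomial k z ∈ reesAlgebra (KaehlerDifferential.ideal ℂ A) :=
  reesAlgebra.monomial_mem.2 hz

/-- The class of degree `k` of an element of the `k`-th power of the ideal of the diagonal. -/
def grClass (k : ℕ) (z : A ⊗[ℂ] A) (hz : z ∈ KaehlerDifferential.ideal ℂ A ^ k) : GrDiag A :=
  grMk A ⟨Polynomial.monomial k z, monomial_mem_rees hz⟩

theorem grClass_eq {k : ℕ} {y z : A ⊗[ℂ] A} (hy : y ∈ KaehlerDifferential.ideal ℂ A ^ k)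
    (hz : z ∈ KaehlerDifferential.ideal ℂ A ^ k)
    (h : y - z ∈ KaehlerDifferential.ideal ℂ A ^ (k + 1)) : grClass k y hy = grClass k z hz := by
  refine grMk_eq_grMk fun l => ?_
  change (Polynomial.monomial k y - Polynomial.monomial k z).coeff l ∈ _
  rw [← map_sub, Polynomial.coeff_monomial]
  split_ifs with hl
  · exact hl ▸ h
  · exact zero_mem _

theorem grClass_add {k : ℕ} {y z : A ⊗[ℂ] A} (hy : y ∈ KaehlerDifferential.ideal ℂ A ^ k)
    (hz : z ∈ KaehlerDifferential.ideal ℂ A ^ k) :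
    grClass k (y + z) (add_mem hy hz) = grClass k y hy + grClass k z hz := by
  refine (congrArg (grMk A) (Subtype.ext ?_)).trans (map_add (grMk A) _ _)
  exact map_add (Polynomial.monomial k) y z

theorem grClass_mul {k l : ℕ} {y z : A ⊗[ℂ] A} (hy : y ∈ KaehlerDifferential.ideal ℂ A ^ k)
    (hz : z ∈ KaehlerDifferential.ideal ℂ A ^ l) :
    grClass (k + l) (y * z) (by rw [pow_add]; exact Ideal.mul_mem_mul hy hz) =
      grClass k y hy * grClass l z hz := by
  refine (congrArg (grMk A) (Subtype.ext ?_)).trans (map_mul (grMk A) _ _)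
  exact (Polynomial.monomial_mul_monomial k l y z).symm

theorem grClass_smul {k : ℕ} (a : A) {z : A ⊗[ℂ] A} (hz : z ∈ KaehlerDifferential.ideal ℂ A ^ k) :
    grClass k (algebraMap A (A ⊗[ℂ] A) a * z) (Ideal.mul_mem_left _ _ hz) =
      a • grClass k z hz := by
  rw [Algebra.smul_def, algebraMap_grDiag]
  refine (congrArg (grMk A) (Subtype.ext ?_)).trans (map_mul (grMk A) _ _)
  exact (Polynomial.C_mul_monomial (a := algebraMap A (A ⊗[ℂ] A) a) (b := z) (n := k)).symm

theorem diff_mem_pow_one (a : A) : diff a ∈ KaehlerDifferential.ideal ℂ A ^ 1 := by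
  simpa using diff_mem a

/-- The class of degree one of `1 ⊗ a - a ⊗ 1`. -/
def grD (a : A) : GrDiag A := grClass 1 (diff a) (diff_mem_pow_one a)

/-- The derivation of `A` with values in the associated graded ring. -/
def grDerivation : Derivation ℂ A (GrDiag A) :=
  Derivation.mk'
    { toFun := grD
      map_add' := fun a b => by
        rw [grD, grD, grD, ← grClass_add]
        congr 1
        simp only [diff, TensorProduct.tmul_add, TensorProduct.add_tmul]
        abel
      map_smul' := fun r a => by
        rw [RingHom.id_apply, ← algebraMap_smul A r (grD a), grD, grD, ← grClass_smul]
        congr 1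
        rw [← Algebra.smul_def, algebraMap_smul]
        simp [diff, smul_sub, TensorProduct.smul_tmul'] }
    fun a b => by
      change grD (a * b) = a • grD b + b • grD a
      rw [grD, grD, grD, ← grClass_smul, ← grClass_smul, ← grClass_add]
      refine grClass_eq _ _ ?_
      -- The Leibniz rule fails in A ⊗ A only by this product, which lies in the square of the ideal
      -- and so vanishes in degree one of the graded ring.
      have : diff (a * b) - (algebraMap A (A ⊗[ℂ] A) a * diff b +
          algebraMap A (A ⊗[ℂ] A) b * diff a) = diff a * diff b := by
        simp only [diff, Algebra.TensorProduct.algebraMap_apply,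
          Algebra.algebraMap_self_apply, mul_sub, sub_mul,
          Algebra.TensorProduct.tmul_mul_tmul, one_mul, mul_one, mul_comm b a]
        abel
      rw [this, pow_two]
      exact Ideal.mul_mem_mul (diff_mem a) (diff_mem b)

/-- The canonical map from the symmetric algebra of the differentials to the associated graded
ring. -/
def symToGr : SymmetricAlgebra A Ω[A⁄ℂ] →ₐ[A] GrDiag A :=
  SymmetricAlgebra.lift (grDerivation (A := A)).liftKaehlerDifferential

theorem prod_diff_pow_mem {ι : Type} (s : Finset ι) (a : ι → A) (m : ι → ℕ) :
    ∏ i ∈ s, diff (a i) ^ m i ∈ KaehlerDifferential.ideal ℂ A ^ (∑ i ∈ s, m i) := by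
  rw [← Finset.prod_pow_eq_pow_sum]
  exact Ideal.prod_mem_prod fun i _ => Ideal.pow_mem_pow (diff_mem _) _

theorem symToGr_prod {ι : Type} (s : Finset ι) (a : ι → A) (m : ι → ℕ) :
    symToGr (∏ i ∈ s, SymmetricAlgebra.ι A _ (KaehlerDifferential.D ℂ A (a i)) ^ m i) =
      grClass (∑ i ∈ s, m i) _ (prod_diff_pow_mem s a m) := by
  have h1 : ∀ i, symToGr (SymmetricAlgebra.ι A _ (KaehlerDifferential.D ℂ A (a i))) =
      grD (a i) := by
    intro i
    rw [symToGr, SymmetricAlgebra.lift_ι_apply, Derivation.liftKaehlerDifferential_comp_D]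
    rfl
  have h2 : ∀ i l, grD (a i) ^ l = grClass l (diff (a i) ^ l) (Ideal.pow_mem_pow (diff_mem _) _) := by
    intro i l
    rw [grD, grClass, ← map_pow]
    refine congrArg (grMk A) (Subtype.ext ?_)
    change Polynomial.monomial 1 (diff (a i)) ^ l = _
    rw [Polynomial.monomial_pow, one_mul]
  simp only [map_prod, map_pow, h1]
  classical
  induction s using Finset.induction_on with
  | empty =>
    simp only [Finset.prod_empty, Finset.sum_empty]
    exact ((congrArg (grMk A) (Subtype.ext (by simp))).trans (map_one (grMk A))).symm
  | insert i s hi ih =>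
    rw [Finset.prod_insert hi, ih, h2, ← grClass_mul]
    refine congrArg (grMk A) (Subtype.ext ?_)
    change Polynomial.monomial _ _ = Polynomial.monomial _ _
    rw [Finset.prod_insert hi, Finset.sum_insert hi]

/-- The coefficient of degree `k`, modulo the power of exponent `k + 1`. -/
def grCoeff (k : ℕ) :
    GrDiag A →ₗ[A] (A ⊗[ℂ] A) ⧸ (KaehlerDifferential.ideal ℂ A ^ (k + 1)).restrictScalars A where
  toFun := Quotient.lift
    (fun f : reesAlgebra (KaehlerDifferential.ideal ℂ A) => Submodule.Quotient.mk (f.1.coeff k))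
    fun f g h => (Submodule.Quotient.eq _).2 <| by
      have := (Submodule.quotientRel_def (grIdeal A)).1 h k
      rwa [AddSubgroupClass.coe_sub, Polynomial.coeff_sub] at this
  map_add' y z := by
    obtain ⟨f, rfl⟩ := grMk_surjective y
    obtain ⟨g, rfl⟩ := grMk_surjective z
    change Submodule.Quotient.mk ((f.1 + g.1).coeff k) = _
    rw [Polynomial.coeff_add]
    rfl
  map_smul' a z := by
    obtain ⟨f, rfl⟩ := grMk_surjective z
    rw [Algebra.smul_def, algebraMap_grDiag, ← map_mul]
    change Submodule.Quotient.mk ((Polynomial.C (algebraMap A (A ⊗[ℂ] A) a) * f.1).coeff k) = _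
    rw [Polynomial.coeff_C_mul, ← Algebra.smul_def]
    rfl

theorem grCoeff_grClass {k : ℕ} {z : A ⊗[ℂ] A} (hz : z ∈ KaehlerDifferential.ideal ℂ A ^ k) :
    grCoeff k (grClass k z hz) = Submodule.Quotient.mk z := by
  change Submodule.Quotient.mk ((Polynomial.monomial k z).coeff k) = _
  rw [Polynomial.coeff_monomial, if_pos rfl]

/-- The canonical map from the symmetric power to the part of degree `k` of the associated graded
ring. -/
def symToDiag (k : ℕ) : symPower A Ω[A⁄ℂ] k →ₗ[A]
    (A ⊗[ℂ] A) ⧸ (KaehlerDifferential.ideal ℂ A ^ (k + 1)).restrictScalars A :=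
  ((grCoeff k).comp symToGr.toLinearMap).comp (symPower A Ω[A⁄ℂ] k).subtype

theorem symToDiag_prod (k : ℕ) {ι : Type} (s : Finset ι) (a : ι → A) (m : ι → ℕ)
    (hm : ∑ i ∈ s, m i = k) (h) :
    symToDiag k ⟨∏ i ∈ s, SymmetricAlgebra.ι A _ (KaehlerDifferential.D ℂ A (a i)) ^ m i, h⟩ =
      Submodule.Quotient.mk (∏ i ∈ s, diff (a i) ^ m i) := by
  subst hm
  exact (congrArg (grCoeff _) (symToGr_prod s a m)).trans (grCoeff_grClass _)

/-- The product of the differentials of the functions `a l`. -/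
def symProd (k : ℕ) (a : Fin k → A) : symPower A Ω[A⁄ℂ] k :=
  ⟨∏ l, SymmetricAlgebra.ι A _ (KaehlerDifferential.D ℂ A (a l)), by
    simpa using prod_ι_mem Finset.univ (fun l => KaehlerDifferential.D ℂ A (a l)) fun _ => 1⟩

variable (A) in
theorem span_symProd (k : ℕ) : Submodule.span A (Set.range (symProd (A := A) k)) = ⊤ := by
  refine (Submodule.span_range_subtype_eq_top_iff _ fun a => (symProd k a).2).2 ?_
  exact (symPower_eq_span _ (KaehlerDifferential.span_range_derivation ℂ A) k).symm

theorem symToDiag_symProd (k : ℕ) (a : Fin k → A) :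
    symToDiag k (symProd k a) = Submodule.Quotient.mk (∏ l, diff (a l)) := by
  have := symToDiag_prod k Finset.univ a (fun _ => 1) (by simp)
  simp only [pow_one] at this
  exact this (symProd k a).2

theorem symToDiag_symMon {σ : Type} (x : σ → A) (k : ℕ) (α : ExpEq σ k) :
    symToDiag k (symMon (fun i => KaehlerDifferential.D ℂ A (x i)) k α) =
      Submodule.Quotient.mk (diffMon x α.1) :=
  symToDiag_prod k α.1.support x α.1 (by rw [← Finsupp.degree_apply, α.2]) _

/-- Products of exact differentials generate S^k Ω, and a coefficient in front of such a product can
be moved across the tensor sign, so pure tensors with no coefficient suffice. -/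
theorem symTensor_induction {M : Type} [AddCommGroup M] [Module A M] {k : ℕ} {p : symPower A Ω[A⁄ℂ] k ⊗[A] M → Prop}
    (z : symPower A Ω[A⁄ℂ] k ⊗[A] M) (h0 : p 0) (hadd : ∀ x y, p x → p y → p (x + y))
    (h : ∀ a m, p (symProd k a ⊗ₜ[A] m)) : p z := by
  induction z with
  | zero => exact h0
  | add y z hy hz => exact hadd _ _ hy hz
  | tmul s m =>
    have hs : s ∈ Submodule.span A (Set.range (symProd (A := A) k)) :=
      span_symProd A k ▸ Submodule.mem_top
    induction hs using Submodule.span_induction generalizing m with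
    | mem s hs =>
      obtain ⟨c, rfl⟩ := hs
      exact h c m
    | zero => simpa using h0
    | add s s' _ _ h h' => rw [TensorProduct.add_tmul]; exact hadd _ _ (h m) (h' m)
    | smul c s _ h => rw [TensorProduct.smul_tmul]; exact h (c • m)

variable {M : Type} [AddCommGroup M] [Module A M] [Module ℂ M] [IsScalarTower ℂ A M]

/-- The map `a ⊗ b ↦ a ⊗ b m`, on principal parts. -/
def jetInsQ (k : ℕ) (m : M) :
    (A ⊗[ℂ] A) ⧸ (KaehlerDifferential.ideal ℂ A ^ (k + 1)).restrictScalars A →ₗ[A] Jet A M k :=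
  Submodule.mapQ _ _ (jetIns m) fun z hz => jetIns_mem m (k + 1) z hz

theorem prod_diff_mem (k : ℕ) (a : Fin k → A) :
    ∏ l, diff (a l) ∈ KaehlerDifferential.ideal ℂ A ^ k := by
  have : ∏ l, diff (a l) ∈ ∏ _l : Fin k, KaehlerDifferential.ideal ℂ A :=
    Ideal.prod_mem_prod fun i _ => diff_mem _
  simpa using this

theorem jetInsQ_add (k : ℕ) (m m' : M) (z) :
    jetInsQ (A := A) k (m + m') z = jetInsQ k m z + jetInsQ k m' z := by
  obtain ⟨z, rfl⟩ := Submodule.Quotient.mk_surjective _ z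
  exact congrArg Submodule.Quotient.mk (jetIns_add m m' z)

/-- The canonical map `S^k Ω ⊗ M → P^k(M)`. -/
def symToJet (k : ℕ) : symPower A Ω[A⁄ℂ] k ⊗[A] M →ₗ[A] Jet A M k :=
  TensorProduct.lift (LinearMap.mk₂ A (fun s m => jetInsQ k m (symToDiag k s))
    (fun s s' m => by rw [map_add, map_add])
    (fun a s m => by rw [map_smul, map_smul])
    (fun s m m' => jetInsQ_add k m m' _)
    (fun a s m => by
      have hs : s ∈ Submodule.span A (Set.range (symProd (A := A) k)) :=
        span_symProd A k ▸ Submodule.mem_top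
      induction hs using Submodule.span_induction with
      | mem s hs =>
        obtain ⟨c, rfl⟩ := hs
        rw [symToDiag_symProd]
        change Submodule.Quotient.mk (jetIns (a • m) _) = Submodule.Quotient.mk (a • jetIns m _)
        -- The error term has k + 1 factors from the ideal of the diagonal, one more than P^k sees.
        rw [Submodule.Quotient.eq, jetIns_smul_eq, add_sub_cancel_left]
        refine jetIns_mem m _ _ ?_
        rw [pow_succ']
        exact Ideal.mul_mem_mul (diff_mem a) (prod_diff_mem k c)
      | zero => simp
      | add s s' _ _ h h' => rw [map_add, map_add, map_add, h, h', smul_add]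
      | smul c s _ h => rw [map_smul, map_smul, map_smul, h, smul_comm]))

theorem symToJet_symProd (k : ℕ) (a : Fin k → A) (m : M) :
    symToJet k (symProd k a ⊗ₜ[A] m) = Submodule.Quotient.mk (jetIns m (∏ l, diff (a l))) := by
  change jetInsQ k m (symToDiag k (symProd k a)) = _
  rw [symToDiag_symProd]
  rfl

theorem symToJet_symMon {σ : Type} (x : σ → A) (k : ℕ) (α : ExpEq σ k) (m : M) :
    symToJet k (symMon (fun i => KaehlerDifferential.D ℂ A (x i)) k α ⊗ₜ[A] m) =
      jetMon x k m α.1 := by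
  change jetInsQ k m (symToDiag k _) = _
  rw [symToDiag_symMon]
  rfl

theorem jetTrunc_symToJet (k : ℕ) (z : symPower A Ω[A⁄ℂ] (k + 1) ⊗[A] M) :
    jetTrunc k (symToJet (k + 1) z) = 0 := by
  induction z using symTensor_induction with
  | h0 => simp
  | hadd x y hx hy => rw [map_add, map_add, hx, hy, add_zero]
  | h a m =>
    rw [symToJet_symProd, jetTrunc_mk, Submodule.Quotient.mk_eq_zero]
    exact jetIns_mem m _ _ (prod_diff_mem _ a)

/-- The kernel is generated by products of k + 1 elements `diff a` applied to some m, and each of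
these is the image of the product of the differentials of the a's, tensored with m. -/
theorem ker_jetTrunc_le (k : ℕ) :
    LinearMap.ker (jetTrunc k : Jet A M (k + 1) →ₗ[A] Jet A M k) ≤
      LinearMap.range (symToJet (A := A) (M := M) (k + 1)) := by
  intro z hz
  obtain ⟨z, rfl⟩ := Submodule.Quotient.mk_surjective _ z
  rw [LinearMap.mem_ker, jetTrunc_mk, Submodule.Quotient.mk_eq_zero, diagPow_eq_span] at hz
  induction hz using Submodule.span_induction with
  | mem z hz =>
    obtain ⟨⟨a, m⟩, rfl⟩ := hz
    exact ⟨symProd _ a ⊗ₜ m, symToJet_symProd _ a m⟩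
  | zero => exact zero_mem _
  | add y z _ _ hy hz => rw [Submodule.Quotient.mk_add]; exact add_mem hy hz
  | smul c z _ h => rw [Submodule.Quotient.mk_smul]; exact Submodule.smul_mem _ _ h

end SymToJet

/-! ### Functoriality of the map from S^k Ω ⊗ M to P^k(M) -/

section Naturality

variable {A A' : Type} [CommRing A] [CommRing A'] [Algebra ℂ A] [Algebra ℂ A']
  {M M' : Type} [AddCommGroup M] [Module A M] [Module ℂ M] [IsScalarTower ℂ A M]
  [AddCommGroup M'] [Module A' M'] [Module ℂ M'] [IsScalarTower ℂ A' M']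
  (φ : A →ₐ[ℂ] A') (f : M →ₛₗ[(φ : A →+* A')] M')

theorem symMap_symProd (k : ℕ) (a : Fin k → A) :
    symMap (φ : A →+* A') (kaehlerMap φ) k (symProd k a) = symProd k fun l => φ (a l) := by
  refine Subtype.ext ?_
  change symAlgMap _ _ (∏ l : Fin k, _) = ∏ l : Fin k, _
  rw [map_prod]
  exact Finset.prod_congr rfl fun l _ => by rw [symAlgMap_ι, kaehlerMap_D]

theorem symToJet_map (k : ℕ) (z : symPower A Ω[A⁄ℂ] k ⊗[A] M) :
    symToJet k (TensorProduct.map (symMap (φ : A →+* A') (kaehlerMap φ) k) f z) =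
      jetMap φ f k (symToJet k z) := by
  induction z using symTensor_induction with
  | h0 => simp
  | hadd x y hx hy => simp only [map_add, hx, hy]
  | h a m =>
    rw [TensorProduct.map_tmul, symMap_symProd, symToJet_symProd, symToJet_symProd, jetMap_mk,
      tmulMap_jetIns, map_prod (Algebra.TensorProduct.map φ φ)]
    simp only [map_diff]

end Naturality

end

section

/-! ### Linear algebra -/

section LinearAlgebra

variable {A : Type} [CommRing A] {M N : Type} [AddCommGroup M] [Module A M] [AddCommGroup N]
  [Module A N]

theorem IsBasis.comp_equiv {ι κ : Type} {v : ι → M} (hv : IsBasis A v) (e : κ ≃ ι) :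
    IsBasis A fun a => v (e a) := by
  have := (hv.basis.reindex e.symm).isBasis
  convert this using 1
  ext a
  simp

theorem IsBasis.tmul {ι κ : Type} {v : ι → M} {w : κ → N} (hv : IsBasis A v) (hw : IsBasis A w) :
    IsBasis A fun p : ι × κ => v p.1 ⊗ₜ[A] w p.2 := by
  have := (hv.basis.tensorProduct hw.basis).isBasis
  have h : (fun p : ι × κ => v p.1 ⊗ₜ[A] w p.2) = hv.basis.tensorProduct hw.basis := by
    funext p
    rw [Module.Basis.tensorProduct_apply', IsBasis.basis_apply, IsBasis.basis_apply]
  rw [h]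
  exact this

/-- If `f` maps a basis injectively to part of a basis, the rest of that basis gives a basis of the
cokernel. -/
theorem IsBasis.coker {ι κ : Type} {v : ι → M} {w : κ → N} (hw : IsBasis A w)
    (hv : Submodule.span A (Set.range v) = ⊤) (f : M →ₗ[A] N) (g : ι → κ)
    (hf : ∀ a, f (v a) = w (g a)) :
    IsBasis A fun b : { b : κ // b ∉ Set.range g } =>
      (Submodule.Quotient.mk (w b.1) : N ⧸ LinearMap.range f) := by
  have hrange : LinearMap.range f = Submodule.span A (w '' Set.range g) := by
    rw [LinearMap.range_eq_map, ← hv, Submodule.map_span, ← Set.range_comp, ← Set.range_comp]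
    congr 2
    exact funext hf
  constructor
  · have := hw.1
    rw [hrange]
    have h := LinearIndependent.comp hw.1 (fun b : { b : κ // b ∉ Set.range g } => b.1)
      Subtype.val_injective
    have hd : Disjoint (Submodule.span A (Set.range fun b : { b : κ // b ∉ Set.range g } => w b.1))
        (LinearMap.ker (Submodule.span A (w '' Set.range g)).mkQ) := by
      rw [Submodule.ker_mkQ]
      have h1 : (Set.range fun b : { b : κ // b ∉ Set.range g } => w b.1) =
          w '' (Set.range g)ᶜ := by
        ext y
        simp
      rw [h1]
      exact hw.1.disjoint_span_image disjoint_compl_left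
    exact h.map hd
  · rw [eq_top_iff]
    intro z _
    obtain ⟨z, rfl⟩ := Submodule.Quotient.mk_surjective _ z
    have hz : z ∈ Submodule.span A (Set.range w) := hw.2 ▸ Submodule.mem_top
    induction hz using Submodule.span_induction with
    | mem z hz =>
      obtain ⟨b, rfl⟩ := hz
      by_cases hb : b ∈ Set.range g
      · obtain ⟨a, rfl⟩ := hb
        rw [← hf, (Submodule.Quotient.mk_eq_zero _).2 (LinearMap.mem_range_self f _)]
        exact zero_mem _
      · exact Submodule.subset_span ⟨⟨b, hb⟩, rfl⟩
    | zero => exact zero_mem _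
    | add y z _ _ hy hz => rw [Submodule.Quotient.mk_add]; exact add_mem (hy trivial) (hz trivial)
    | smul c z _ h => rw [Submodule.Quotient.mk_smul]; exact Submodule.smul_mem _ _ (h trivial)

theorem IsBasis.injective_of_apply_eq {ι κ : Type} {v : ι → M} {w : κ → N} (hw : IsBasis A w)
    (hv : IsBasis A v) (f : M →ₗ[A] N) (g : ι → κ) (hg : Function.Injective g)
    (hf : ∀ a, f (v a) = w (g a)) : Function.Injective f := by
  rw [injective_iff_map_eq_zero]
  intro y hy
  have h := LinearIndependent.comp hw.1 g hg
  rw [linearIndependent_iff] at h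
  have h0 : Finsupp.linearCombination A (w ∘ g) (hv.basis.repr y) = 0 := by
    rw [← hy]
    conv_rhs => rw [← hv.basis.linearCombination_repr y]
    rw [Finsupp.apply_linearCombination]
    congr 2
    funext a
    simp [hf]
  exact hv.basis.repr.map_eq_zero_iff.1 (h _ h0)

end LinearAlgebra

/-! ### Linear maps and pairings after extension of scalars -/

section ExtendScalars

variable {R S : Type} [CommRing R] [CommRing S] {M N : Type} [AddCommGroup M] [Module R M]
  [AddCommGroup N] [Module R N]

/-- The linear map `S ⊗_R M → N`, `s ⊗ m ↦ s f(m)`. -/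
def Ext.lift {φ : R →+* S} {N : Type} [AddCommGroup N] [Module S N] (f : M →ₛₗ[φ] N) :
    Ext φ M →ₗ[S] N :=
  letI : Algebra R S := φ.toAlgebra
  letI : Module R N := Module.compHom N φ
  haveI : IsScalarTower R S N := ⟨fun r s n => by
    rw [Algebra.smul_def, mul_smul]; rfl⟩
  let f' : M →ₗ[R] N := { toFun := f, map_add' := map_add f, map_smul' := fun r m => f.map_smulₛₗ r m }
  f'.liftBaseChange S

theorem Ext.lift_tmul {φ : R →+* S} {N : Type} [AddCommGroup N] [Module S N] (f : M →ₛₗ[φ] N)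
    (s : S) (m : M) : Ext.lift f (Ext.tmul φ s m) = s • f m := rfl

theorem Ext.smul_tmul {φ : R →+* S} (s t : S) (m : M) :
    s • Ext.tmul φ t m = Ext.tmul φ (s * t) m := rfl

theorem Ext.tmul_add {φ : R →+* S} (s : S) (m n : M) :
    Ext.tmul φ s (m + n) = Ext.tmul φ s m + Ext.tmul φ s n :=
  letI : Algebra R S := φ.toAlgebra
  TensorProduct.tmul_add s m n

theorem Ext.tmul_smul {φ : R →+* S} (s : S) (r : R) (m : M) :
    Ext.tmul φ s (r • m) = φ r • Ext.tmul φ s m :=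
  letI : Algebra R S := φ.toAlgebra
  (TensorProduct.tmul_smul r s m).trans (algebraMap_smul S r (s ⊗ₜ[R] m : S ⊗[R] M)).symm

/-- The semilinear map `m ↦ 1 ⊗ m`. -/
def Ext.mk (φ : R →+* S) : M →ₛₗ[φ] Ext φ M where
  toFun := Ext.tmul φ 1
  map_add' := Ext.tmul_add 1
  map_smul' r m := Ext.tmul_smul 1 r m

theorem Ext.lift_mk {φ : R →+* S} {N : Type} [AddCommGroup N] [Module S N] (f : M →ₛₗ[φ] N)
    (m : M) : Ext.lift f (Ext.mk φ m) = f m :=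
  (Ext.lift_tmul f 1 m).trans (one_smul _ _)

theorem Ext.tmul_eq {φ : R →+* S} (s : S) (m : M) : Ext.tmul φ s m = s • Ext.mk φ m := by
  change _ = s • Ext.tmul φ 1 m
  rw [Ext.smul_tmul, mul_one]

theorem Ext.isBasis (φ : R →+* S) {ι : Type} {v : ι → M} (hv : IsBasis R v) :
    IsBasis S fun a => Ext.mk φ (v a) := by
  let _ : Algebra R S := φ.toAlgebra
  have := (hv.basis.baseChange S).isBasis
  have h : (fun a => Ext.mk φ (v a)) = hv.basis.baseChange S := by
    funext a
    rw [Module.Basis.baseChange_apply, IsBasis.basis_apply]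
    rfl
  rw [h]
  exact this

theorem Ext.hom_ext {φ : R →+* S} {N : Type} [AddCommGroup N] [Module S N] {f g : Ext φ M →ₗ[S] N}
    (h : ∀ m, f (Ext.mk φ m) = g (Ext.mk φ m)) : f = g := by
  ext x
  induction x using Ext.induction with
  | h0 => simp
  | h s m => rw [Ext.tmul_eq, map_smul, map_smul, h]
  | hadd x y hx hy => rw [map_add, map_add, hx, hy]

/-- The extension of scalars of a bilinear map with values in the ring. -/
def Ext.bilin (φ : R →+* S) (b : M →ₗ[R] N →ₗ[R] R) : Ext φ M →ₗ[S] Ext φ N →ₗ[S] S :=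
  Ext.lift
    { toFun := fun m => Ext.lift
        { toFun := fun n => φ (b m n)
          map_add' := fun n n' => by simp
          map_smul' := fun r n => by simp }
      map_add' := fun m m' => Ext.hom_ext fun n => by
        rw [LinearMap.add_apply, Ext.lift_mk, Ext.lift_mk, Ext.lift_mk]
        simp
      map_smul' := fun r m => Ext.hom_ext fun n => by
        rw [LinearMap.smul_apply, Ext.lift_mk, Ext.lift_mk]
        simp }

theorem Ext.bilin_mk (φ : R →+* S) (b : M →ₗ[R] N →ₗ[R] R) (m : M) (n : N) :
    Ext.bilin φ b (Ext.mk φ m) (Ext.mk φ n) = φ (b m n) := by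
  rw [Ext.bilin, Ext.lift_mk]
  exact Ext.lift_mk _ _

end ExtendScalars

end

section

/-! ### Tensor products, symmetric powers and pairings of modules -/

section Plain

variable {A A' : Type} [CommRing A] [CommRing A'] {ψ : A →+* A'}

theorem tensorMap_comm {F F₁ G G₁ F' F₁' G' G₁' : Type} [AddCommGroup F] [AddCommGroup F₁]
    [AddCommGroup G] [AddCommGroup G₁] [AddCommGroup F'] [AddCommGroup F₁'] [AddCommGroup G']
    [AddCommGroup G₁'] [Module A F] [Module A F₁] [Module A G] [Module A G₁] [Module A' F']
    [Module A' F₁'] [Module A' G'] [Module A' G₁'] (r : F →ₛₗ[ψ] F') (r₁ : F₁ →ₛₗ[ψ] F₁')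
    (s : G →ₛₗ[ψ] G') (s₁ : G₁ →ₛₗ[ψ] G₁') (f : F →ₗ[A] F₁) (f' : F' →ₗ[A'] F₁')
    (g : G →ₗ[A] G₁) (g' : G' →ₗ[A'] G₁') (hf : ∀ x, f' (r x) = r₁ (f x))
    (hg : ∀ x, g' (s x) = s₁ (g x)) (z : F ⊗[A] G) :
    TensorProduct.map f' g' (TensorProduct.map r s z) =
      TensorProduct.map r₁ s₁ (TensorProduct.map f g z) := by
  induction z with
  | zero => simp
  | tmul x y => simp [hf, hg]
  | add x y hx hy => simp only [map_add, hx, hy]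

variable {M M' : Type} [AddCommGroup M] [Module A M] [AddCommGroup M'] [Module A' M']

variable (A M) in
/-- Multiplication `S^k M ⊗ M → S^(k+1) M`. -/
def symMulLin (k : ℕ) : symPower A M k ⊗[A] M →ₗ[A] symPower A M (k + 1) :=
  TensorProduct.lift (LinearMap.mk₂ A
    (fun (s : symPower A M k) (m : M) =>
      (⟨s.1 * SymmetricAlgebra.ι A M m, by
        rw [symPower, pow_succ]
        exact Submodule.mul_mem_mul s.2 (LinearMap.mem_range_self _ _)⟩ : symPower A M (k + 1)))
    (fun s s' m => Subtype.ext (add_mul _ _ _))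
    (fun a s m => Subtype.ext (smul_mul_assoc _ _ _))
    (fun s m m' => Subtype.ext (by simp [mul_add]))
    (fun a s m => Subtype.ext (by simp)))

theorem symMulLin_map (k : ℕ) (f : M →ₛₗ[ψ] M') (z : symPower A M k ⊗[A] M) :
    symMulLin A' M' k (TensorProduct.map (symMap ψ f k) f z) =
      symMap ψ f (k + 1) (symMulLin A M k z) := by
  induction z with
  | zero => simp
  | tmul s m =>
    refine Subtype.ext ?_
    change symAlgMap _ _ s.1 * SymmetricAlgebra.ι _ _ _ = symAlgMap _ _ (_ * _)
    rw [map_mul, symAlgMap_ι]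
  | add x y hx hy => simp only [map_add, hx, hy]

variable {N N' : Type} [AddCommGroup N] [Module A N] [AddCommGroup N'] [Module A' N']

/-- The elements `f a`, with coordinates given by pairing with the elements `g a`, generate. -/
def IsDualSystem {ι : Type} [Fintype ι] (b : M →ₗ[A] N →ₗ[A] A) (f : ι → M) (g : ι → N) : Prop :=
  ∀ x, ∑ a, b x (g a) • f a = x

variable {K L : Type} [AddCommGroup K] [Module A K] [AddCommGroup L] [Module A L]

/-- The tensor product of bilinear maps with values in the ring. -/
def bilinTensor (b : M →ₗ[A] N →ₗ[A] A) (c : K →ₗ[A] L →ₗ[A] A) :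
    M ⊗[A] K →ₗ[A] N ⊗[A] L →ₗ[A] A :=
  (TensorProduct.dualDistrib A N L).comp (TensorProduct.map b c)

theorem bilinTensor_tmul (b : M →ₗ[A] N →ₗ[A] A) (c : K →ₗ[A] L →ₗ[A] A) (m : M) (k : K) (n : N)
    (l : L) : bilinTensor b c (m ⊗ₜ k) (n ⊗ₜ l) = b m n * c k l := rfl

theorem IsDualSystem.tensor {ι κ : Type} [Fintype ι] [Fintype κ] {b : M →ₗ[A] N →ₗ[A] A}
    {c : K →ₗ[A] L →ₗ[A] A} {f : ι → M} {g : ι → N} {f' : κ → K} {g' : κ → L}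
    (h : IsDualSystem b f g) (h' : IsDualSystem c f' g') :
    IsDualSystem (bilinTensor b c) (fun p : ι × κ => f p.1 ⊗ₜ[A] f' p.2)
      fun p => g p.1 ⊗ₜ[A] g' p.2 := by
  intro z
  induction z with
  | zero => simp
  | tmul x x' =>
    conv_rhs => rw [← h x, ← h' x', TensorProduct.sum_tmul]
    rw [Fintype.sum_prod_type]
    refine Finset.sum_congr rfl fun a _ => ?_
    rw [TensorProduct.tmul_sum]
    refine Finset.sum_congr rfl fun a' _ => ?_
    rw [bilinTensor_tmul, TensorProduct.smul_tmul_smul]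
  | add x y hx hy =>
    conv_rhs => rw [← hx, ← hy]
    simp only [map_add, LinearMap.add_apply, add_smul, Finset.sum_add_distrib]

theorem bilinTensor_flip (b : M →ₗ[A] N →ₗ[A] A) (c : K →ₗ[A] L →ₗ[A] A) :
    (bilinTensor b c).flip = bilinTensor b.flip c.flip := by
  ext
  rfl

theorem bilinTensor_map {K' L' : Type} [AddCommGroup K'] [Module A' K'] [AddCommGroup L']
    [Module A' L'] (b : M →ₗ[A] N →ₗ[A] A) (c : K →ₗ[A] L →ₗ[A] A) (b' : M' →ₗ[A'] N' →ₗ[A'] A')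
    (c' : K' →ₗ[A'] L' →ₗ[A'] A') (rM : M →ₛₗ[ψ] M') (rN : N →ₛₗ[ψ] N') (rK : K →ₛₗ[ψ] K')
    (rL : L →ₛₗ[ψ] L') (hb : ∀ m n, b' (rM m) (rN n) = ψ (b m n))
    (hc : ∀ k l, c' (rK k) (rL l) = ψ (c k l)) (x : M ⊗[A] K) (y : N ⊗[A] L) :
    bilinTensor b' c' (TensorProduct.map rM rK x) (TensorProduct.map rN rL y) =
      ψ (bilinTensor b c x y) := by
  induction x with
  | zero => simp
  | add x x' hx hx' => simp only [map_add, LinearMap.add_apply, hx, hx']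
  | tmul x x' =>
    induction y with
    | zero => simp
    | add y y' hy hy' => simp only [map_add, hy, hy']
    | tmul y y' =>
      simp only [TensorProduct.map_tmul, bilinTensor_tmul, map_mul, hb, hc]

variable {S S' : Type} [CommRing S] [CommRing S'] (φ : A →+* S)

theorem IsDualSystem.ext {ι : Type} [Fintype ι] {b : M →ₗ[A] N →ₗ[A] A} {f : ι → M} {g : ι → N}
    (h : IsDualSystem b f g) :
    IsDualSystem (Ext.bilin φ b) (fun a => Ext.mk φ (f a)) fun a => Ext.mk φ (g a) := by
  intro z
  induction z using Ext.induction with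
  | h0 => simp
  | h s x =>
    rw [Ext.tmul_eq]
    conv_rhs => rw [← h x, map_sum, Finset.smul_sum]
    refine Finset.sum_congr rfl fun a _ => ?_
    rw [map_smul, LinearMap.smul_apply, LinearMap.map_smulₛₗ, smul_assoc, Ext.bilin_mk]
  | hadd x y hx hy =>
    conv_rhs => rw [← hx, ← hy]
    simp only [map_add, LinearMap.add_apply, add_smul, Finset.sum_add_distrib]

theorem extBilin_flip (b : M →ₗ[A] N →ₗ[A] A) : (Ext.bilin φ b).flip = Ext.bilin φ b.flip := by
  refine Ext.hom_ext fun n => Ext.hom_ext fun m => ?_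
  rw [LinearMap.flip_apply, Ext.bilin_mk, Ext.bilin_mk]
  rfl

theorem extMap_mk {φ : A →+* S} {φ' : A' →+* S'} (σ : S →+* S')
    (hσ : ∀ r, σ (φ r) = φ' (ψ r)) (f : M →ₛₗ[ψ] M') (m : M) :
    Ext.map ψ σ hσ f (Ext.mk φ m) = Ext.mk φ' (f m) :=
  (Ext.map_tmul ψ σ hσ f 1 m).trans (by rw [map_one]; rfl)

theorem extBilin_map {φ : A →+* S} {φ' : A' →+* S'} (σ : S →+* S')
    (hσ : ∀ r, σ (φ r) = φ' (ψ r)) (b : M →ₗ[A] N →ₗ[A] A) (b' : M' →ₗ[A'] N' →ₗ[A'] A')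
    (rM : M →ₛₗ[ψ] M') (rN : N →ₛₗ[ψ] N') (hb : ∀ m n, b' (rM m) (rN n) = ψ (b m n))
    (x : Ext φ M) (y : Ext φ N) :
    Ext.bilin φ' b' (Ext.map ψ σ hσ rM x) (Ext.map ψ σ hσ rN y) = σ (Ext.bilin φ b x y) := by
  induction x using Ext.induction with
  | h0 => simp
  | hadd x x' hx hx' => simp only [map_add, LinearMap.add_apply, hx, hx']
  | h s f =>
    induction y using Ext.induction with
    | h0 => simp
    | hadd y y' hy hy' => simp only [map_add, hy, hy']
    | h t g =>
      have h1 := (Ext.map ψ σ hσ rM).map_smulₛₗ s (Ext.mk φ f)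
      have h2 := (Ext.map ψ σ hσ rN).map_smulₛₗ t (Ext.mk φ g)
      rw [extMap_mk] at h1 h2
      rw [Ext.tmul_eq, Ext.tmul_eq, h1, h2]
      simp only [map_smul, LinearMap.smul_apply, smul_eq_mul, map_mul, Ext.bilin_mk, hb, hσ]

end Plain

namespace PMod

variable {B : AlgBase}

/-! ### Homomorphisms of presheaves of modules -/

/-- The identity. -/
def Hom.id (F : PMod B) : Hom F F where
  app _ := LinearMap.id
  naturality _ _ := rfl

/-- Composition. -/
def Hom.comp {F G H : PMod B} (g : Hom G H) (f : Hom F G) : Hom F H where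
  app i := (g.app i).comp (f.app i)
  naturality h m := by
    rw [LinearMap.comp_apply, f.naturality, g.naturality]
    rfl

/-- The tensor product of homomorphisms. -/
def Hom.tensor {F F' G G' : PMod B} (f : Hom F F') (g : Hom G G') :
    Hom (F.tensor G) (F'.tensor G') where
  app i := TensorProduct.map (f.app i) (g.app i)
  naturality {i j} h m := tensorMap_comm (F.res h) (F'.res h) (G.res h) (G'.res h) (f.app j)
    (f.app i) (g.app j) (g.app i) (f.naturality h) (g.naturality h) m

/-- Multiplication `S^k F ⊗ F → S^(k+1) F`. -/
def symMul (F : PMod B) (k : ℕ) : Hom ((F.sym k).tensor F) (F.sym (k + 1)) where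
  app i := symMulLin (B.A i) (F.M i) k
  naturality h m := symMulLin_map k (F.res h) m

/-- The homomorphism `F^{⊗ k} → S^k G` induced by `F → G`. -/
def powToSym {F G : PMod B} (f : Hom F G) : ∀ k, Hom (F.pow k) (G.sym k)
  | 0 =>
    { app := fun i =>
        (Algebra.linearMap (B.A i) (SymmetricAlgebra (B.A i) (G.M i))).codRestrict
          (symPower (B.A i) (G.M i) 0) fun a => by
            rw [symPower, pow_zero]
            exact Submodule.mem_one.2 ⟨a, rfl⟩
      naturality := fun {i j} h (a : B.A j) => Subtype.ext (symAlgMap_algebraMap _ _ a).symm }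
  | k + 1 => (symMul G k).comp ((powToSym f k).tensor f)

/-- The tensor power of a section. -/
def powElt (F : PMod B) {i : B.I} (v : F.M i) : ∀ k, (F.pow k).M i
  | 0 => (1 : B.A i)
  | k + 1 => (powElt F v k ⊗ₜ[B.A i] v : (F.pow k).M i ⊗[B.A i] F.M i)

theorem res_powElt (F : PMod B) {i j : B.I} (h : i ≤ j) (v : F.M j) :
    ∀ k, (F.pow k).res h (powElt F v k) = powElt F (F.res h v) k
  | 0 => map_one (B.res h)
  | k + 1 => by
    change TensorProduct.map ((F.pow k).res h) (F.res h) (powElt F v k ⊗ₜ[B.A j] v) =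
      (powElt F (F.res h v) k ⊗ₜ[B.A i] F.res h v : (F.pow k).M i ⊗[B.A i] F.M i)
    rw [TensorProduct.map_tmul, res_powElt F h v k]

theorem isBasis_powElt (F : PMod B) {i : B.I} {v : F.M i}
    (hv : IsBasis (B.A i) fun _ : Unit => v) :
    ∀ k, IsBasis (B.A i) fun _ : Unit => powElt F v k
  | 0 => by
    have h : IsBasis (B.A i) fun _ : Unit => (1 : B.A i) := by
      have := (Module.Basis.singleton Unit (B.A i)).isBasis
      convert this using 1
      funext a
      simp
    exact h
  | k + 1 => ((isBasis_powElt F hv k).tmul hv).comp_equiv (Equiv.punitProd Unit).symm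

theorem powToSym_powElt {F G : PMod B} (f : Hom F G) {i : B.I} (v : F.M i) :
    ∀ k, ((powToSym f k).app i (powElt F v k) : symPower (B.A i) (G.M i) k).1 =
      SymmetricAlgebra.ι (B.A i) (G.M i) (f.app i v) ^ k
  | 0 => (map_one (algebraMap (B.A i) (SymmetricAlgebra (B.A i) (G.M i)))).trans (pow_zero _).symm
  | k + 1 => by
    rw [pow_succ, ← powToSym_powElt f v k]
    rfl

/-! ### Hereditary bases -/

/-- The restrictions of the sections `b` to all smaller members of the base are bases. -/
def IsHBasis (F : PMod B) {i : B.I} {ι : Type} (b : ι → F.M i) : Prop :=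
  ∀ (j : B.I) (h : j ≤ i), IsBasis (B.A j) fun a => F.res h (b a)

theorem IsHBasis.res {F : PMod B} {i j : B.I} (h : j ≤ i) {ι : Type} {b : ι → F.M i}
    (hb : F.IsHBasis b) : F.IsHBasis fun a => F.res h (b a) := by
  intro l h'
  have := hb l (h'.trans h)
  simpa only [F.res_res] using this

theorem IsHBasis.isBasis {F : PMod B} {i : B.I} {ι : Type} {b : ι → F.M i}
    (hb : F.IsHBasis b) : IsBasis (B.A i) b := by
  have := hb i le_rfl
  simpa only [F.res_refl] using this

theorem isLocallyFree_of_isHBasis {F : PMod B} {r : ℕ}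
    (h : ∀ x : B.Pt, ∃ i, x ∈ B.mem i ∧ ∃ (ι : Type) (b : ι → F.M i), F.IsHBasis b ∧
      Nat.card ι = r ∧ Finite ι) : F.IsLocallyFree r := by
  intro x
  obtain ⟨i, hi, ι, b, hb, hr, _⟩ := h x
  let e : Fin r ≃ ι := (Finite.equivFinOfCardEq hr).symm
  exact ⟨i, hi, fun a => b (e a), fun j h => (hb j h).comp_equiv e⟩

/-- The coordinates with respect to a hereditary basis. -/
def IsHBasis.coord {F : PMod B} {i : B.I} {ι : Type} {b : ι → F.M i} (hb : F.IsHBasis b)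
    (a : ι) : F.dualSections i :=
  ⟨fun j => (hb j.1 j.2).basis.coord a, fun j l h m => by
    have hm : m ∈ Submodule.span (B.A j.1) (Set.range (hb j.1 j.2).basis) :=
      (hb j.1 j.2).basis.span_eq ▸ Submodule.mem_top
    induction hm using Submodule.span_induction with
    | mem m hm =>
      obtain ⟨a', rfl⟩ := hm
      have : F.res h ((hb j.1 j.2).basis a') = (hb l.1 l.2).basis a' := by
        rw [IsBasis.basis_apply, IsBasis.basis_apply, F.res_res]
      rw [this, Module.Basis.coord_apply, Module.Basis.coord_apply, Module.Basis.repr_self,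
        Module.Basis.repr_self]
      classical
      simp only [Finsupp.single_apply]
      split_ifs <;> simp
    | zero => simp
    | add m m' _ _ h h' => simp only [map_add, h, h']
    | smul c m _ h => simp [h]⟩

theorem IsHBasis.coord_res {F : PMod B} {i : B.I} {ι : Type} [DecidableEq ι] {b : ι → F.M i}
    (hb : F.IsHBasis b) (a a' : ι) (j : {j // j ≤ i}) :
    (hb.coord a).1 j (F.res j.2 (b a')) = if a = a' then 1 else 0 := by
  change (hb j.1 j.2).basis.coord a _ = _
  rw [← IsBasis.basis_apply (hb j.1 j.2), Module.Basis.coord_apply, Module.Basis.repr_self,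
    Finsupp.single_apply]
  simp only [eq_comm]

theorem IsHBasis.coord_self {F : PMod B} {i : B.I} {ι : Type} [DecidableEq ι] {b : ι → F.M i}
    (hb : F.IsHBasis b) (a a' : ι) :
    (hb.coord a).1 ⟨i, le_rfl⟩ (b a') = if a = a' then 1 else 0 := by
  have := hb.coord_res a a' ⟨i, le_rfl⟩
  rwa [F.res_refl] at this

theorem IsHBasis.sum_coord {F : PMod B} {i : B.I} {ι : Type} [Fintype ι] {b : ι → F.M i}
    (hb : F.IsHBasis b) (j : {j // j ≤ i}) (m : F.M j.1) :
    ∑ a, (hb.coord a).1 j m • F.res j.2 (b a) = m := by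
  have := (hb j.1 j.2).basis.sum_repr m
  simp only [IsBasis.basis_apply] at this
  exact this

/-- Two sections of the dual that agree on a hereditary basis are equal. -/
theorem IsHBasis.dual_ext {F : PMod B} {i : B.I} {ι : Type} {b : ι → F.M i}
    (hb : F.IsHBasis b) {u v : F.dualSections i}
    (h : ∀ a, u.1 ⟨i, le_rfl⟩ (b a) = v.1 ⟨i, le_rfl⟩ (b a)) : u = v := by
  refine Subtype.ext (funext fun j => (hb j.1 j.2).basis.ext fun a => ?_)
  rw [IsBasis.basis_apply]
  have h1 := u.2 ⟨i, le_rfl⟩ j j.2 (b a)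
  have h2 := v.2 ⟨i, le_rfl⟩ j j.2 (b a)
  rw [h1, h2, h]

/-! ### Perfect pairings -/

/-- A pairing with values in the structure sheaf. -/
structure Pairing (F G : PMod B) where
  ev : ∀ i, F.M i →ₗ[B.A i] G.M i →ₗ[B.A i] B.A i
  naturality : ∀ {i j : B.I} (h : i ≤ j) (x : F.M j) (y : G.M j),
    ev i (F.res h x) (G.res h y) = B.res h (ev j x y)

/-- The pairing identifies each of the two sheaves with the dual of the other: over each member of
the base there are dual systems of generators. -/
def Pairing.IsPerfect {F G : PMod B} (P : Pairing F G) : Prop :=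
  ∀ i, ∃ (ι : Type) (_ : Fintype ι) (f : ι → F.M i) (g : ι → G.M i),
    (∀ (j : B.I) (h : j ≤ i),
      IsDualSystem (P.ev j) (fun a => F.res h (f a)) fun a => G.res h (g a)) ∧
      IsDualSystem (P.ev i).flip g f

theorem dualSections_sum_apply {F : PMod B} {i : B.I} {ι : Type} (s : Finset ι)
    (c : ι → B.A i) (g : ι → F.dualSections i) (j : {j // j ≤ i}) (x : F.M j.1) :
    (∑ a ∈ s, c a • g a).1 j x = ∑ a ∈ s, B.res j.2 (c a) * (g a).1 j x := by
  classical
  induction s using Finset.induction_on with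
  | empty => simp
  | insert a s ha ih =>
    rw [Finset.sum_insert ha, Finset.sum_insert ha, ← ih]
    rfl

/-- The pairing of `F` with its dual. -/
def dualPairing (F : PMod B) : Pairing F F.dual where
  ev i :=
    { toFun := fun x =>
        { toFun := fun u : F.dualSections i => u.1 ⟨i, le_rfl⟩ x
          map_add' := fun u v => rfl
          map_smul' := fun a u => by
            change B.res le_rfl a • u.1 ⟨i, le_rfl⟩ x = _
            rw [B.res_refl]
            rfl }
      map_add' := fun x y => LinearMap.ext fun (u : F.dualSections i) =>
        map_add (u.1 ⟨i, le_rfl⟩) x y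
      map_smul' := fun a x => LinearMap.ext fun (u : F.dualSections i) =>
        map_smul (u.1 ⟨i, le_rfl⟩) a x }
  naturality {i j} h x (u : F.dualSections j) := u.2 ⟨j, le_rfl⟩ ⟨i, h⟩ h x

/-- Expanding x in the `f a` recovers a functional y from its values y(f a). The expansion formula
for the dual therefore follows from the one for F, provided that the latter holds on all smaller
members, since a section of the dual is a compatible family over them. -/
theorem dualPairing_isPerfect {F : PMod B}
    (hF : ∀ i, ∃ (ι : Type) (_ : Fintype ι) (f : ι → F.M i) (g : ι → F.dualSections i),
      ∀ (j : {j // j ≤ i}) (x : F.M j.1), ∑ a, (g a).1 j x • F.res j.2 (f a) = x) :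
    F.dualPairing.IsPerfect := by
  intro i
  obtain ⟨ι, _, f, g, h⟩ := hF i
  refine ⟨ι, inferInstance, f, g, fun j hj x => h ⟨j, hj⟩ x, fun (y : F.dualSections i) => ?_⟩
  refine Subtype.ext (funext fun j => LinearMap.ext fun x => ?_)
  refine (dualSections_sum_apply Finset.univ (fun a => y.1 ⟨i, le_rfl⟩ (f a)) g j x).trans ?_
  conv_rhs => rw [← h j x, map_sum]
  refine Finset.sum_congr rfl fun a _ => ?_
  rw [map_smul, smul_eq_mul, mul_comm, y.2 ⟨i, le_rfl⟩ j j.2 (f a)]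

theorem dualPairing_isPerfect_of_isHBasis {F : PMod B}
    (hF : ∀ i, ∃ (ι : Type) (_ : Fintype ι) (b : ι → F.M i), F.IsHBasis b) :
    F.dualPairing.IsPerfect :=
  dualPairing_isPerfect fun i => by
    obtain ⟨ι, _, b, hb⟩ := hF i
    exact ⟨ι, inferInstance, b, hb.coord, hb.sum_coord⟩

variable (B) in
/-- Multiplication, as a pairing of the structure sheaf with itself. -/
def unitPairing : Pairing (unit B) (unit B) where
  ev i := LinearMap.mul (B.A i) (B.A i)
  naturality {_ j} h (x y : B.A j) := (map_mul (B.res h) x y).symm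

theorem unitPairing_isPerfect : (unitPairing B).IsPerfect := by
  intro i
  refine ⟨Unit, inferInstance, fun _ => (1 : B.A i), fun _ => (1 : B.A i),
    fun j h (x : B.A j) => ?_, fun (y : B.A i) => ?_⟩
  · refine (Fintype.sum_unique _).trans ?_
    change x * B.res h 1 * B.res h 1 = x
    simp
  · refine (Fintype.sum_unique _).trans ?_
    change (1 : B.A i) * y * 1 = y
    simp

/-- The tensor product of pairings. -/
def Pairing.tensor {F G F' G' : PMod B} (P : Pairing F G) (P' : Pairing F' G') :
    Pairing (F.tensor F') (G.tensor G') where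
  ev i := bilinTensor (P.ev i) (P'.ev i)
  naturality {i j} h x y := bilinTensor_map (P.ev j) (P'.ev j) (P.ev i) (P'.ev i) (F.res h)
    (G.res h) (F'.res h) (G'.res h) (P.naturality h) (P'.naturality h) x y

theorem Pairing.IsPerfect.tensor {F G F' G' : PMod B} {P : Pairing F G} {P' : Pairing F' G'}
    (hP : P.IsPerfect) (hP' : P'.IsPerfect) : (P.tensor P').IsPerfect := by
  intro i
  obtain ⟨ι, _, f, g, h1, h2⟩ := hP i
  obtain ⟨κ, _, f', g', h1', h2'⟩ := hP' i
  have h := h2.tensor h2'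
  rw [← bilinTensor_flip] at h
  exact ⟨ι × κ, inferInstance, fun p => f p.1 ⊗ₜ[B.A i] f' p.2,
    fun p => g p.1 ⊗ₜ[B.A i] g' p.2,
    fun j hj => IsDualSystem.tensor (b := P.ev j) (c := P'.ev j)
      (f := fun a => F.res hj (f a)) (g := fun a => G.res hj (g a))
      (f' := fun a => F'.res hj (f' a)) (g' := fun a => G'.res hj (g' a)) (h1 j hj) (h1' j hj), h⟩

/-- The tensor power of a pairing. -/
def Pairing.pow {F G : PMod B} (P : Pairing F G) : ∀ k, Pairing (F.pow k) (G.pow k)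
  | 0 => unitPairing B
  | k + 1 => (P.pow k).tensor P

theorem Pairing.IsPerfect.pow {F G : PMod B} {P : Pairing F G} (hP : P.IsPerfect) :
    ∀ k, (P.pow k).IsPerfect
  | 0 => unitPairing_isPerfect
  | k + 1 => (hP.pow k).tensor hP

/-- The inverse image of a pairing. -/
def Pairing.pullback {B' : AlgBase} (p : BaseHom B B') {F G : PMod B'} (P : Pairing F G) :
    Pairing (F.pullback p) (G.pullback p) where
  ev i := Ext.bilin _ (P.ev (p.idx i))
  naturality {i j} h x y := extBilin_map (B.resHom h)
    (fun r => by simpa using (p.naturality h r).symm) (P.ev (p.idx j)) (P.ev (p.idx i))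
    (F.res (p.mono h)) (G.res (p.mono h)) (P.naturality (p.mono h)) x y

/-- The formulas of a dual system are identities between finite sums, so they survive extension of
scalars. No comparison between the dual of an inverse image and the inverse image of the dual is
needed. -/
theorem Pairing.IsPerfect.pullback {B' : AlgBase} (p : BaseHom B B') {F G : PMod B'}
    {P : Pairing F G} (hP : P.IsPerfect) : (P.pullback p).IsPerfect := by
  intro i
  obtain ⟨ι, _, f, g, h1, h2⟩ := hP (p.idx i)
  refine ⟨ι, inferInstance, fun a => Ext.mk (p.map i : B'.A (p.idx i) →+* B.A i) (f a),
    fun a => Ext.mk (p.map i : B'.A (p.idx i) →+* B.A i) (g a), fun j h => ?_, ?_⟩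
  · have := (h1 _ (p.mono h)).ext (p.map j : B'.A (p.idx j) →+* B.A j)
    have hF : (fun a => Ext.mk (p.map j : B'.A (p.idx j) →+* B.A j) (F.res (p.mono h) (f a))) =
        fun a => (F.pullback p).res h (Ext.mk (p.map i : B'.A (p.idx i) →+* B.A i) (f a)) :=
      funext fun a => (extMap_mk (B.resHom h) (fun r => (p.naturality h r).symm) _ _).symm
    have hG : (fun a => Ext.mk (p.map j : B'.A (p.idx j) →+* B.A j) (G.res (p.mono h) (g a))) =
        fun a => (G.pullback p).res h (Ext.mk (p.map i : B'.A (p.idx i) →+* B.A i) (g a)) :=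
      funext fun a => (extMap_mk (B.resHom h) (fun r => (p.naturality h r).symm) _ _).symm
    rw [hF, hG] at this
    exact this
  · have := h2.ext (p.map i : B'.A (p.idx i) →+* B.A i)
    rw [← extBilin_flip] at this
    exact this

theorem Pairing.IsPerfect.ext {F G : PMod B} {P : Pairing F G} (hP : P.IsPerfect) {i : B.I}
    {y z : G.M i} (h : ∀ x, P.ev i x y = P.ev i x z) : y = z := by
  obtain ⟨ι, _, f, g, _, h2⟩ := hP i
  rw [← h2 y, ← h2 z]
  simp only [LinearMap.flip_apply, h]

theorem Pairing.IsPerfect.exists_ev_eq {F G : PMod B} {P : Pairing F G} (hP : P.IsPerfect)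
    {i : B.I} (u : F.dualSections i) :
    ∃ y : G.M i, ∀ (j : {j // j ≤ i}) (x : F.M j.1), P.ev j.1 x (G.res j.2 y) = u.1 j x := by
  obtain ⟨ι, _, f, g, h1, h2⟩ := hP i
  -- The only possible candidate, by the expansion of a section of G in the `g a`.
  refine ⟨∑ a, u.1 ⟨i, le_rfl⟩ (f a) • g a, fun j x => ?_⟩
  conv_rhs => rw [← h1 _ j.2 x, map_sum]
  rw [map_sum, map_sum]
  refine Finset.sum_congr rfl fun a _ => ?_
  rw [LinearMap.map_smulₛₗ, map_smul, map_smul, smul_eq_mul, smul_eq_mul, mul_comm,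
    u.2 ⟨i, le_rfl⟩ j j.2 (f a)]
  rfl

/-- The section of `G` that represents a section of the dual of `F`. -/
def Pairing.ofDualFun {F G : PMod B} (P : Pairing F G) (hP : P.IsPerfect) {i : B.I}
    (u : F.dualSections i) : G.M i :=
  (hP.exists_ev_eq u).choose

theorem Pairing.ev_res_ofDualFun {F G : PMod B} (P : Pairing F G) (hP : P.IsPerfect) {i : B.I}
    (u : F.dualSections i) (j : {j // j ≤ i}) (x : F.M j.1) :
    P.ev j.1 x (G.res j.2 (P.ofDualFun hP u)) = u.1 j x :=
  (hP.exists_ev_eq u).choose_spec j x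

theorem Pairing.ev_ofDualFun {F G : PMod B} (P : Pairing F G) (hP : P.IsPerfect) {i : B.I}
    (x : F.M i) (u : F.dualSections i) :
    P.ev i x (P.ofDualFun hP u) = u.1 ⟨i, le_rfl⟩ x := by
  have h := P.ev_res_ofDualFun hP u ⟨i, le_rfl⟩ x
  rwa [G.res_refl] at h

theorem Pairing.ofDualFun_add {F G : PMod B} (P : Pairing F G) (hP : P.IsPerfect) {i : B.I}
    (u v : F.dualSections i) :
    P.ofDualFun hP (u + v) = P.ofDualFun hP u + P.ofDualFun hP v :=
  hP.ext fun x => by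
    rw [map_add, P.ev_ofDualFun hP, P.ev_ofDualFun hP, P.ev_ofDualFun hP]
    rfl

theorem Pairing.ofDualFun_smul {F G : PMod B} (P : Pairing F G) (hP : P.IsPerfect) {i : B.I}
    (a : B.A i) (u : F.dualSections i) :
    P.ofDualFun hP (a • u) = a • P.ofDualFun hP u :=
  hP.ext fun x => by
    rw [map_smul, P.ev_ofDualFun hP, P.ev_ofDualFun hP]
    exact congrArg (· * u.1 ⟨i, le_rfl⟩ x) (B.res_refl i a)

/-- The homomorphism from the dual of `F` defined by a perfect pairing of `F` and `G`. -/
def Pairing.ofDual {F G : PMod B} (P : Pairing F G) (hP : P.IsPerfect) : Hom F.dual G where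
  app _ :=
    { toFun := P.ofDualFun hP
      map_add' := P.ofDualFun_add hP
      map_smul' := P.ofDualFun_smul hP }
  naturality {i _} h u := hP.ext fun x =>
    (P.ev_ofDualFun hP x (F.dual.res h u)).trans (P.ev_res_ofDualFun hP u ⟨i, h⟩ x).symm

theorem Pairing.ofDual_surjective {F G : PMod B} (P : Pairing F G) (hP : P.IsPerfect) (i : B.I) :
    Function.Surjective ((P.ofDual hP).app i) := by
  intro y
  let u : F.dualSections i := ⟨fun j => (P.ev j.1).flip (G.res j.2 y), fun j l h x => by
    rw [LinearMap.flip_apply, LinearMap.flip_apply, ← P.naturality, G.res_res]⟩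
  refine ⟨u, hP.ext fun x => (P.ev_ofDualFun hP x u).trans ?_⟩
  change P.ev i x (G.res le_rfl y) = _
  rw [G.res_refl]

theorem Pairing.ofDual_injective {F G : PMod B} (P : Pairing F G) (hP : P.IsPerfect) (i : B.I) :
    Function.Injective ((P.ofDual hP).app i) := by
  rw [injective_iff_map_eq_zero]
  intro (u : F.dualSections i) (hu : P.ofDualFun hP u = 0)
  refine Subtype.ext (funext fun j => LinearMap.ext fun x => ?_)
  rw [← P.ev_res_ofDualFun hP u j x, hu, map_zero, map_zero]
  rfl

end PMod

end

section

/-! ### Differentials and formally étale homomorphisms -/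

section Etale

variable {A A' : Type} [CommRing A] [CommRing A'] [Algebra ℂ A] [Algebra ℂ A']

/-- Along a formally étale homomorphism the differentials are obtained by base change. -/
theorem isBasis_kaehlerMap (φ : A →ₐ[ℂ] A') (hφ : (φ : A →+* A').FormallyEtale) {ι : Type}
    {v : ι → Ω[A⁄ℂ]} (hv : IsBasis A v) : IsBasis A' fun a => kaehlerMap φ (v a) := by
  let _ : Algebra A A' := (φ : A →+* A').toAlgebra
  have : IsScalarTower ℂ A A' := IsScalarTower.of_algebraMap_eq fun r => (φ.commutes r).symm
  have : Algebra.FormallyEtale A A' := hφ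
  have hb := KaehlerDifferential.isBaseChange_of_formallyEtale ℂ A A'
  have h := (IsBaseChange.basis hv.basis hb).isBasis
  have e : (fun a => kaehlerMap φ (v a)) = IsBaseChange.basis hv.basis hb := by
    funext a
    rw [IsBaseChange.basis_apply, IsBasis.basis_apply]
    rfl
  rw [e]
  exact h

theorem span_range_kaehlerMap (φ : A →ₐ[ℂ] A') (hφ : (φ : A →+* A').FormallyEtale) :
    Submodule.span A' (Set.range (kaehlerMap φ)) = ⊤ := by
  let _ : Algebra A A' := (φ : A →+* A').toAlgebra
  have : IsScalarTower ℂ A A' := IsScalarTower.of_algebraMap_eq fun r => (φ.commutes r).symm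
  have : Algebra.FormallyEtale A A' := hφ
  have hb := KaehlerDifferential.isBaseChange_of_formallyEtale ℂ A A'
  refine Submodule.eq_top_iff'.2 fun x => ?_
  induction x using hb.inductionOn with
  | zero => exact zero_mem _
  | tmul m => exact Submodule.subset_span ⟨m, rfl⟩
  | smul s n h => exact Submodule.smul_mem _ s h
  | add x y hx hy => exact add_mem hx hy

/-- A vector field extends along a formally étale homomorphism, by the universal property of the
base change. -/
theorem exists_kaehlerMap_extension (φ : A →ₐ[ℂ] A') (hφ : (φ : A →+* A').FormallyEtale)
    (u : Ω[A⁄ℂ] →ₗ[A] A) : ∃ u' : Ω[A'⁄ℂ] →ₗ[A'] A', ∀ ω, u' (kaehlerMap φ ω) = φ (u ω) := by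
  let _ : Algebra A A' := (φ : A →+* A').toAlgebra
  have : IsScalarTower ℂ A A' := IsScalarTower.of_algebraMap_eq fun r => (φ.commutes r).symm
  have : Algebra.FormallyEtale A A' := hφ
  have hb := KaehlerDifferential.isBaseChange_of_formallyEtale ℂ A A'
  exact ⟨hb.lift ((Algebra.linearMap A A').comp u), fun ω => hb.lift_eq _ ω⟩

end Etale

/-- The algebras are smooth and the restriction maps are étale. -/
structure AlgBase.IsSmooth (B : AlgBase) : Prop where
  formallySmooth : ∀ i, Algebra.FormallySmooth ℂ (B.A i)
  finiteType : ∀ i, Algebra.FiniteType ℂ (B.A i)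
  formallyEtale : ∀ {i j : B.I} (h : i ≤ j), (B.resHom h).FormallyEtale

/-- The differentials of a smooth algebra are finite and projective, hence a direct summand of a
free module of rank n. The images of the standard basis, with the coordinate functionals of the
inclusion, form a dual system; étale restriction carries it to all smaller members. -/
theorem AlgBase.IsSmooth.cotangent_isPerfect {B : AlgBase} (hB : B.IsSmooth) :
    (PMod.cotangent B).dualPairing.IsPerfect := by
  refine PMod.dualPairing_isPerfect fun i => ?_
  have := hB.formallySmooth i
  have := hB.finiteType i
  obtain ⟨n, f, g, -, -, hfg⟩ :=
    Module.Finite.exists_comp_eq_id_of_projective (B.A i) Ω[B.A i⁄ℂ]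
  -- `w a j` is the a-th coordinate functional, extended to the smaller member j.
  choose w hw using fun (a : Fin n) (j : {j // j ≤ i}) =>
    exists_kaehlerMap_extension (B.res j.2) (hB.formallyEtale j.2) ((LinearMap.proj a).comp g)
  have hcomp : ∀ {j l : {j // j ≤ i}} (h : l.1 ≤ j.1) (ω : Ω[B.A i⁄ℂ]),
      kaehlerMap (B.res h) (kaehlerMap (B.res j.2) ω) = kaehlerMap (B.res l.2) ω :=
    fun h ω => (PMod.cotangent B).res_res h _ ω
  have hnat : ∀ (a : Fin n) (j l : {j // j ≤ i}) (h : l.1 ≤ j.1) (m : Ω[B.A j.1⁄ℂ]),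
      w a l (kaehlerMap (B.res h) m) = B.res h (w a j m) := by
    intro a j l h m
    -- Extensions are unique because the restricted differentials generate; this makes the
    -- functionals a compatible family.
    have hm : m ∈ Submodule.span (B.A j.1) (Set.range (kaehlerMap (B.res j.2))) := by
      rw [span_range_kaehlerMap _ (hB.formallyEtale j.2)]
      trivial
    induction hm using Submodule.span_induction with
    | mem m hm =>
      obtain ⟨ω, rfl⟩ := hm
      rw [hcomp, hw, hw, B.res_res]
    | zero => simp
    | add m m' _ _ h h' => simp only [map_add, h, h']
    | smul c m _ h => simp [h]
  refine ⟨Fin n, inferInstance, fun a => f (Pi.single a 1), fun a => ⟨w a, hnat a⟩, ?_⟩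
  intro j (x : Ω[B.A j.1⁄ℂ])
  change ∑ a, w a j x • kaehlerMap (B.res j.2) (f (Pi.single a 1)) = x
  have hx : x ∈ Submodule.span (B.A j.1) (Set.range (kaehlerMap (B.res j.2))) := by
    rw [span_range_kaehlerMap _ (hB.formallyEtale j.2)]
    trivial
  induction hx using Submodule.span_induction with
  | mem m hm =>
    obtain ⟨ω, rfl⟩ := hm
    have hω : ω = ∑ a, g ω a • f (Pi.single a 1) := by
      conv_lhs => rw [← LinearMap.id_apply (R := B.A i) ω, ← hfg, LinearMap.comp_apply,
        pi_eq_sum_univ' (g ω), map_sum]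
      refine Finset.sum_congr rfl fun a _ => ?_
      rw [map_smul]
    conv_rhs => rw [hω, map_sum]
    refine Finset.sum_congr rfl fun a _ => ?_
    rw [hw, LinearMap.map_smulₛₗ]
    rfl
  | zero => simp
  | add m m' _ _ h h' =>
    conv_rhs => rw [← h, ← h']
    simp only [map_add, add_smul, Finset.sum_add_distrib]
  | smul c m _ h =>
    conv_rhs => rw [← h]
    simp only [map_smul, smul_eq_mul, mul_smul, Finset.smul_sum]

/-! ### Exponents -/

section Exponents

variable {σ : Type}

/-- The exponents of degree at most one outside the variable `o`. -/
def IsScrollExp (o : σ) (α : σ →₀ ℕ) : Prop := α.degree ≤ α o + 1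

/-- The exponent `k o + c`. -/
def scrollExp (o : σ) (k : ℕ) (c : σ) : σ →₀ ℕ := Finsupp.single o k + Finsupp.single c 1

theorem degree_scrollExp (o : σ) (k : ℕ) (c : σ) : (scrollExp o k c).degree = k + 1 := by
  simp [scrollExp]

theorem isScrollExp_scrollExp (o : σ) (k : ℕ) (c : σ) : IsScrollExp o (scrollExp o k c) := by
  rw [IsScrollExp, degree_scrollExp]
  simp [scrollExp]

theorem scrollExp_injective (o : σ) (k : ℕ) : Function.Injective (scrollExp o k) := by
  intro c c' h
  exact (Finsupp.single_left_inj one_ne_zero).1 (add_left_cancel h)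

theorem _root_.Finsupp.exists_eq_single_of_degree_eq_one {β : σ →₀ ℕ} (h : β.degree = 1) :
    ∃ c, Finsupp.single c 1 = β := by
  have h0 : β ≠ 0 := by
    rintro rfl
    simp at h
  obtain ⟨c, hc⟩ := Finsupp.ne_iff.1 h0
  have hle : Finsupp.single c 1 ≤ β := by
    rw [Finsupp.single_le_iff]
    exact Nat.one_le_iff_ne_zero.2 hc
  have hd := congrArg Finsupp.degree (tsub_add_cancel_of_le hle)
  simp only [map_add, Finsupp.degree_single, h, Nat.add_eq_right] at hd
  rw [Finsupp.degree_eq_zero_iff] at hd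
  exact ⟨c, by rw [← tsub_add_cancel_of_le hle, hd, zero_add]⟩

/-- The variable o has exponent at least k, and removing k copies of it leaves an exponent of degree
one, that is, a single variable. That variable may be o itself. -/
theorem exists_eq_scrollExp (o : σ) (k : ℕ) {α : σ →₀ ℕ} (hα : α.degree = k + 1)
    (h : IsScrollExp o α) : ∃ c, scrollExp o k c = α := by
  rw [IsScrollExp, hα] at h
  have hle : Finsupp.single o k ≤ α := by
    rw [Finsupp.single_le_iff]
    omega
  have hd : (α - Finsupp.single o k).degree = 1 := by
    have := congrArg Finsupp.degree (tsub_add_cancel_of_le hle)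
    simp only [map_add, Finsupp.degree_single] at this
    omega
  obtain ⟨c, hc⟩ := Finsupp.exists_eq_single_of_degree_eq_one hd
  exact ⟨c, by rw [scrollExp, hc, add_tsub_cancel_of_le hle]⟩

variable [Fintype σ] [DecidableEq σ]

/-- The exponents of degree `k` as a finite set. -/
def expEqEquiv (k : ℕ) : ExpEq σ k ≃ (Finset.univ : Finset σ).finsuppAntidiag k :=
  Equiv.subtypeEquivRight fun α => by
    rw [Finset.mem_finsuppAntidiag, ← Finsupp.degree_eq_sum]
    exact ⟨fun h => ⟨h, Finset.subset_univ _⟩, fun h => h.1⟩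

theorem finite_expEq (k : ℕ) : Finite (ExpEq σ k) := Finite.of_equiv _ (expEqEquiv k).symm

theorem card_expEq (k : ℕ) : Nat.card (ExpEq σ k) = (Fintype.card σ + k - 1).choose k := by
  rw [Nat.card_congr (expEqEquiv k), Nat.card_eq_fintype_card, Fintype.card_coe,
    Finset.card_finsuppAntidiag_nat_eq_choose, Finset.card_univ]

/-- Splitting off the exponents of the highest degree. -/
def expLESucc (k : ℕ) : ExpLE σ (k + 1) ≃ ExpLE σ k ⊕ ExpEq σ (k + 1) where
  toFun α := if h : α.1.degree ≤ k then .inl ⟨α.1, h⟩ else .inr ⟨α.1, by have := α.2; omega⟩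
  invFun := Sum.elim (fun α => ⟨α.1, α.2.trans (Nat.le_succ k)⟩) fun α => ⟨α.1, α.2.le⟩
  left_inv α := by
    by_cases h : α.1.degree ≤ k
    · simp [h]
    · simp [h]
  right_inv := by
    rintro (α | α)
    · simp [α.2]
    · simp [α.2]

def expLEZero : ExpLE σ 0 ≃ Unit where
  toFun _ := ()
  invFun _ := ⟨0, by simp⟩
  left_inv α := Subtype.ext (by
    have := α.2
    rw [Nat.le_zero, Finsupp.degree_eq_zero_iff] at this
    exact this.symm)
  right_inv _ := rfl

theorem finite_expLE : ∀ k : ℕ, Finite (ExpLE σ k)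
  | 0 => Finite.of_equiv _ (expLEZero (σ := σ)).symm
  | k + 1 => by
    have := finite_expLE k
    have := finite_expEq (σ := σ) (k + 1)
    exact Finite.of_equiv _ (expLESucc (σ := σ) k).symm

/-- Splitting off the highest degree turns the count into Pascal's rule. -/
theorem card_expLE (k : ℕ) :
    Nat.card (ExpLE σ k) = (Fintype.card σ + k).choose (Fintype.card σ) := by
  induction k with
  | zero => rw [Nat.card_congr (expLEZero (σ := σ))]; simp
  | succ k ih =>
    have := finite_expLE (σ := σ) k
    have := finite_expEq (σ := σ) (k + 1)
    rw [Nat.card_congr (expLESucc (σ := σ) k), Nat.card_sum, ih, card_expEq,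
      ← add_assoc, Nat.add_sub_cancel, Nat.choose_symm_add,
      Nat.choose_symm_of_eq_add (n := Fintype.card σ + k + 1) (b := k + 1) (add_assoc _ _ _)]
    exact (Nat.choose_succ_succ _ _).symm

/-- The exponents of degree `k + 1` of this kind. -/
def scrollExpEquiv (o : σ) (k : ℕ) :
    σ ≃ { α : ExpEq σ (k + 1) // IsScrollExp o α.1 } :=
  Equiv.ofBijective
    (fun c => ⟨⟨scrollExp o k c, degree_scrollExp o k c⟩, isScrollExp_scrollExp o k c⟩)
    ⟨fun _ _ h => scrollExp_injective o k (congrArg (fun z => z.1.1) h), fun α => by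
      obtain ⟨c, hc⟩ := exists_eq_scrollExp o k α.1.2 α.2
      exact ⟨c, Subtype.ext (Subtype.ext hc)⟩⟩

/-- Degree zero contributes one exponent and each degree m + 1 contributes the exponents m o + c,
one for every variable c. This is the source of the number kn + 1. -/
theorem card_scrollExpLE (o : σ) (k : ℕ) :
    Nat.card { α : ExpLE σ k // IsScrollExp o α.1 } = k * Fintype.card σ + 1 := by
  induction k with
  | zero =>
    have e : { α : ExpLE σ 0 // IsScrollExp o α.1 } ≃ ExpLE σ 0 :=
      Equiv.subtypeUnivEquiv fun α => α.2.trans (Nat.zero_le _)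
    rw [Nat.card_congr (e.trans expLEZero)]
    simp
  | succ k ih =>
    have := finite_expLE (σ := σ) k
    have := finite_expEq (σ := σ) (k + 1)
    have e : { α : ExpLE σ (k + 1) // IsScrollExp o α.1 } ≃
        { α : ExpLE σ k // IsScrollExp o α.1 } ⊕ { α : ExpEq σ (k + 1) // IsScrollExp o α.1 } := by
      refine ((expLESucc k).symm.subtypeEquiv (p := fun z =>
        IsScrollExp o ((expLESucc k).symm z).1) fun a => Iff.rfl).symm.trans ?_
      exact Equiv.subtypeSum
    rw [Nat.card_congr e, Nat.card_sum, ih, ← Nat.card_congr (scrollExpEquiv o k),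
      Nat.card_eq_fintype_card]
    ring

end Exponents

end

section

/-! ### Jets of sections that are linear along the fibres -/

section ScrollJets

variable {R A : Type} [CommRing R] [CommRing A] [Algebra ℂ R] [Algebra ℂ A] (φ : R →ₐ[ℂ] A)
  {σ : Type} (x : σ → A) (o : σ)

theorem diffMon_add (α β : σ →₀ ℕ) : diffMon x (α + β) = diffMon x α * diffMon x β :=
  Finsupp.prod_add_index' (fun _ => pow_zero _) fun _ _ _ => pow_add _ _ _

theorem diffMon_single (i : σ) (m : ℕ) : diffMon x (Finsupp.single i m) = diff (x i) ^ m :=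
  Finsupp.prod_single_index (pow_zero _)

theorem map_mem_ideal_pow (m : ℕ) (z : R ⊗[ℂ] R) (hz : z ∈ KaehlerDifferential.ideal ℂ R ^ m) :
    Algebra.TensorProduct.map φ φ z ∈ KaehlerDifferential.ideal ℂ A ^ m := by
  have hle : (KaehlerDifferential.ideal ℂ R).map (Algebra.TensorProduct.map φ φ) ≤
      KaehlerDifferential.ideal ℂ A := by
    rw [← KaehlerDifferential.span_range_eq_ideal, Ideal.map_span, Ideal.span_le]
    rintro _ ⟨_, ⟨a, rfl⟩, rfl⟩
    exact (map_diff φ a).symm ▸ diff_mem (φ a)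
  have h := Ideal.mem_map_of_mem (Algebra.TensorProduct.map φ φ) hz
  rw [Ideal.map_pow] at h
  exact Ideal.pow_right_mono hle m h

/-- The span of the monomials of degree at most one outside the variable `o`, modulo a power of
the ideal of the diagonal. -/
def scrollSpan (k : ℕ) : Submodule A (A ⊗[ℂ] A) :=
  Submodule.span A (Set.range fun α : { α : ExpLE σ k // IsScrollExp o α.1 } => diffMon x α.1.1) ⊔
    (KaehlerDifferential.ideal ℂ A ^ (k + 1)).restrictScalars A

theorem diffMon_mem_scrollSpan (k : ℕ) {α : σ →₀ ℕ} (h : IsScrollExp o α) :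
    diffMon x α ∈ scrollSpan x o k := by
  by_cases hα : α.degree ≤ k
  · exact Submodule.mem_sup_left (Submodule.subset_span ⟨⟨⟨α, hα⟩, h⟩, rfl⟩)
  · refine Submodule.mem_sup_right ?_
    exact Ideal.pow_le_pow_right (by omega) (diffMon_mem x α)

/-- On the curve, 1 ⊗ q is modulo the power k + 1 of the ideal a combination of powers of `diff t`.
Its image in A ⊗ A is a combination of powers of `diff (x o)`, and multiplying by the monomial β
stays in the span by `hβ`. It is used for β = 0 and for β a single variable. -/
theorem one_tmul_mul_mem_scrollSpan {t : R} (hxt : x o = φ t)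
    (ht : Submodule.span R (Set.range fun _ : Unit => KaehlerDifferential.D ℂ R t) = ⊤) (k : ℕ)
    (q : R) {β : σ →₀ ℕ} (hβ : ∀ m, IsScrollExp o (Finsupp.single o m + β)) :
    (1 : A) ⊗ₜ[ℂ] φ q * diffMon x β ∈ scrollSpan x o k := by
  have hq : (1 : R) ⊗ₜ[ℂ] q ∈ Submodule.span R (Set.range fun α : ExpLE Unit k =>
      diffMon (fun _ : Unit => t) α.1) ⊔
      (KaehlerDifferential.ideal ℂ R ^ (k + 1)).restrictScalars R := by
    rw [span_diffMon_sup (fun _ : Unit => t) ht k]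
    trivial
  obtain ⟨y, hy, z, hz, hyz⟩ := Submodule.mem_sup.1 hq
  have h1 : (1 : A) ⊗ₜ[ℂ] φ q = Algebra.TensorProduct.map φ φ y +
      Algebra.TensorProduct.map φ φ z := by
    rw [← map_add, hyz]
    simp
  rw [h1, add_mul]
  refine add_mem ?_ (Submodule.mem_sup_right (Ideal.mul_mem_right _ _
    (map_mem_ideal_pow φ (k + 1) z hz)))
  clear h1 hyz hq hz z
  induction hy using Submodule.span_induction with
  | zero => simp
  | add y y' _ _ h h' => rw [map_add, add_mul]; exact add_mem h h'
  | smul c y _ h =>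
    have : Algebra.TensorProduct.map φ φ (c • y) = φ c • Algebra.TensorProduct.map φ φ y := by
      rw [Algebra.smul_def, map_mul, Algebra.smul_def]
      congr 1
      change Algebra.TensorProduct.map φ φ (c ⊗ₜ[ℂ] 1) = φ c ⊗ₜ[ℂ] 1
      simp
    rw [this, smul_mul_assoc]
    exact Submodule.smul_mem _ _ h
  | mem y hy =>
    obtain ⟨α, rfl⟩ := hy
    have hα : α.1 = Finsupp.single () (α.1 ()) := by
      ext
      simp
    have : Algebra.TensorProduct.map φ φ (diffMon (fun _ : Unit => t) α.1) =
        diffMon x (Finsupp.single o (α.1 ())) := by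
      rw [map_diffMon, hα, diffMon_single, diffMon_single, hxt]
      simp
    change Algebra.TensorProduct.map φ φ (diffMon (fun _ : Unit => t) α.1) * _ ∈ _
    rw [this, ← diffMon_add]
    exact diffMon_mem_scrollSpan x o k (hβ _)

theorem one_tmul_mem_scrollSpan [Fintype σ] {t : R} (hxt : x o = φ t)
    (ht : Submodule.span R (Set.range fun _ : Unit => KaehlerDifferential.D ℂ R t) = ⊤) (k : ℕ)
    (q₀ : R) (q : σ → R) :
    (1 : A) ⊗ₜ[ℂ] (φ q₀ + ∑ c, φ (q c) * x c) ∈ scrollSpan x o k := by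
  have h0 : ∀ r : R, (1 : A) ⊗ₜ[ℂ] φ r ∈ scrollSpan x o k := by
    intro r
    have := one_tmul_mul_mem_scrollSpan φ x o hxt ht k r (β := 0) fun m => by simp [IsScrollExp]
    simpa [diffMon] using this
  rw [TensorProduct.tmul_add, TensorProduct.tmul_sum]
  refine add_mem (h0 q₀) (Submodule.sum_mem _ fun c _ => ?_)
  -- Here 1 ⊗ x_c is written as `diff (x c)` plus x_c ⊗ 1: linear sections introduce at most one
  -- factor `diff (x c)` besides the powers of `diff (x o)`.
  have : (1 : A) ⊗ₜ[ℂ] (φ (q c) * x c) =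
      (1 : A) ⊗ₜ[ℂ] φ (q c) * diffMon x (Finsupp.single c 1) + x c • ((1 : A) ⊗ₜ[ℂ] φ (q c)) := by
    rw [diffMon_single, pow_one, diff, mul_sub, TensorProduct.smul_tmul']
    simp
  rw [this]
  exact add_mem (one_tmul_mul_mem_scrollSpan φ x o hxt ht k (q c)
    fun m => isScrollExp_scrollExp o m c) (Submodule.smul_mem _ _ (h0 (q c)))

variable {M : Type} [AddCommGroup M] [Module A M] [Module ℂ M] [IsScalarTower ℂ A M]

/-- This bounds the rank of j_k from above: only monomials of degree at most one outside the curve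
direction occur in the jets of sections linear along the fibres. -/
theorem jet_mem_span_jetMon [Fintype σ] {t : R} (hxt : x o = φ t)
    (ht : Submodule.span R (Set.range fun _ : Unit => KaehlerDifferential.D ℂ R t) = ⊤) (k : ℕ)
    (q₀ : R) (q : σ → R) (e : M) :
    (jet k ((φ q₀ + ∑ c, φ (q c) * x c) • e) : Jet A M k) ∈
      Submodule.span A (Set.range fun α : { α : ExpLE σ k // IsScrollExp o α.1 } =>
        jetMon x k e α.1.1) := by
  obtain ⟨y, hy, z, hz, hyz⟩ :=
    Submodule.mem_sup.1 (one_tmul_mem_scrollSpan φ x o hxt ht k q₀ q)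
  have h : (jet k ((φ q₀ + ∑ c, φ (q c) * x c) • e) : Jet A M k) =
      Submodule.Quotient.mk (jetIns e y) := by
    rw [jet, ← jetIns_one, jetIns_smul, mul_one, ← hyz, map_add, Submodule.Quotient.eq]
    simpa using jetIns_mem e (k + 1) z hz
  rw [h]
  clear h hyz hz z
  induction hy using Submodule.span_induction with
  | zero => simp
  | add y y' _ _ h h' => rw [map_add, Submodule.Quotient.mk_add]; exact add_mem h h'
  | smul c y _ h => rw [map_smul, Submodule.Quotient.mk_smul]; exact Submodule.smul_mem _ _ h
  | mem y hy =>
    obtain ⟨α, rfl⟩ := hy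
    exact Submodule.subset_span ⟨α, rfl⟩

end ScrollJets

/-- A functional on a module over a domain that vanishes on a submodule of full rank of the span of
linearly independent elements vanishes on these elements. -/
theorem apply_eq_zero_of_finrank_eq {A P ι : Type} [CommRing A] [IsDomain A] [AddCommGroup P]
    [Module A P] [Finite ι] {b : ι → P} (hb : LinearIndependent A b) {J : Submodule A P}
    (hJ : J ≤ Submodule.span A (Set.range b)) (hr : Module.finrank A J = Nat.card ι)
    (u : P →ₗ[A] A) (hu : ∀ z ∈ J, u z = 0) (a : ι) : u (b a) = 0 := by
  have := Fintype.ofFinite ι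
  let N := Submodule.span A (Set.range b)
  have hN : Module.finrank A N = Nat.card ι := by
    rw [finrank_span_eq_card hb, Nat.card_eq_fintype_card]
  have : Module.Finite A N := Module.Finite.span_of_finite A (Set.finite_range b)
  have hJ' : Module.finrank A (J.submoduleOf N) = Nat.card ι := by
    rw [← hr]
    exact (Submodule.submoduleOfEquivOfLe hJ).finrank_eq
  have hq : Module.finrank A (N ⧸ J.submoduleOf N) = 0 := by
    have := Submodule.finrank_quotient_add_finrank (J.submoduleOf N)
    omega
  -- A quotient of rank zero is torsion: some nonzero multiple of `b a` lies in J, so u vanishes on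
  -- it, and the domain allows the factor to be cancelled.
  rw [Module.finrank_eq_zero_iff] at hq
  obtain ⟨c, hc, h⟩ := hq (Submodule.Quotient.mk ⟨b a, Submodule.subset_span ⟨a, rfl⟩⟩)
  rw [← Submodule.Quotient.mk_smul, Submodule.Quotient.mk_eq_zero] at h
  have h' : c * u (b a) = 0 := by
    rw [← smul_eq_mul, ← map_smul]
    exact hu _ h
  exact (mul_eq_zero.1 h').resolve_left hc

end

section

namespace PMod

variable {B : AlgBase}

/-! ### Duals of free sheaves and of cokernels -/

theorem map_sum_smul {A M N ι : Type} [CommRing A] [AddCommGroup M] [AddCommGroup N] [Module A M]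
    [Module A N] [Fintype ι] (f : M →ₗ[A] N) (c : ι → A) (v : ι → M) :
    f (∑ a, c a • v a) = ∑ a, c a • f (v a) := by
  simp only [map_sum, map_smul]

theorem IsHBasis.sum_coord_apply {F : PMod B} {i : B.I} {ι κ : Type} [DecidableEq ι] [Fintype κ]
    {b : ι → F.M i} (hb : F.IsHBasis b) (g : κ → ι) (c : κ → B.A i) (a : ι) :
    (∑ a', c a' • hb.coord (g a')).1 ⟨i, le_rfl⟩ (b a) = ∑ a', if g a' = a then c a' else 0 := by
  refine (dualSections_sum_apply Finset.univ c (fun a' => hb.coord (g a')) ⟨i, le_rfl⟩ (b a)).trans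
    (Finset.sum_congr rfl fun a' _ => ?_)
  rw [hb.coord_self, B.res_refl, mul_ite, mul_one, mul_zero]

theorem IsHBasis.sum_coord_apply_self {F : PMod B} {i : B.I} {ι κ : Type} [Fintype κ]
    {b : ι → F.M i} (hb : F.IsHBasis b) {g : κ → ι} (hg : Function.Injective g) (c : κ → B.A i)
    (a : κ) : (∑ a', c a' • hb.coord (g a')).1 ⟨i, le_rfl⟩ (b (g a)) = c a := by
  classical
  rw [hb.sum_coord_apply]
  simp [hg.eq_iff]

theorem IsHBasis.sum_coord_apply_eq_zero {F : PMod B} {i : B.I} {ι κ : Type} [Fintype κ]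
    {b : ι → F.M i} (hb : F.IsHBasis b) (g : κ → ι) (c : κ → B.A i) {a : ι}
    (ha : ∀ a', g a' ≠ a) : (∑ a', c a' • hb.coord (g a')).1 ⟨i, le_rfl⟩ (b a) = 0 := by
  classical
  rw [hb.sum_coord_apply]
  simp [ha]

theorem IsHBasis.isBasis_coord {F : PMod B} {i : B.I} {ι : Type} [Finite ι] {b : ι → F.M i}
    (hb : F.IsHBasis b) : IsBasis (B.A i) hb.coord := by
  have := Fintype.ofFinite ι
  refine ⟨Fintype.linearIndependent_iff.2 fun c hc a => ?_,
    Submodule.eq_top_iff'.2 fun u => ?_⟩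
  · rw [← hb.sum_coord_apply_self (g := id) Function.injective_id c a]
    exact congrArg (fun u : F.dualSections i => u.1 ⟨i, le_rfl⟩ (b a)) hc
  · have h : u = ∑ a, u.1 ⟨i, le_rfl⟩ (b a) • hb.coord a := hb.dual_ext fun a =>
      (hb.sum_coord_apply_self (g := id) Function.injective_id
        (fun a => u.1 ⟨i, le_rfl⟩ (b a)) a).symm
    rw [h]
    exact Submodule.sum_mem _ fun a _ => Submodule.smul_mem _ _ (Submodule.subset_span ⟨a, rfl⟩)

theorem IsHBasis.res_coord {F : PMod B} {i j : B.I} (h : j ≤ i) {ι : Type} {b : ι → F.M i}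
    (hb : F.IsHBasis b) (a : ι) : F.dual.res h (hb.coord a) = (hb.res h).coord a := by
  classical
  exact (hb.res h).dual_ext fun a' => (hb.coord_res a a' ⟨j, h⟩).trans
    ((hb.res h).coord_self a a').symm

/-- A section of the dual that vanishes on the image of `f`, as a section of the dual of the
cokernel. -/
def cokerDualMk {F G : PMod B} (f : Hom F G) {i : B.I} (u : G.dualSections i)
    (hu : ∀ (j : {j // j ≤ i}) (x : F.M j.1), u.1 j (f.app j.1 x) = 0) :
    (coker f).dualSections i :=
  ⟨fun j => Submodule.liftQ (LinearMap.range (f.app j.1)) (u.1 j) (by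
      rintro _ ⟨x, rfl⟩
      exact hu j x), fun j l h m => by
    obtain ⟨y, rfl⟩ := Submodule.Quotient.mk_surjective _ m
    exact u.2 j l h y⟩

theorem cokerDual_ext {F G : PMod B} {f : Hom F G} {i : B.I} {u v : (coker f).dualSections i}
    (h : (dualMap (cokerProj f)).app i u = (dualMap (cokerProj f)).app i v) : u = v := by
  refine Subtype.ext (funext fun j => LinearMap.ext fun m => ?_)
  obtain ⟨y, rfl⟩ := Submodule.Quotient.mk_surjective _ m
  exact congrArg (fun w : G.dualSections i => w.1 j y) h

/-- The image of `f` spans generically the span of the members of the hereditary basis `b` that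
satisfy `S`. -/
structure IsGenericSpan {F G : PMod B} (f : Hom F G) {i : B.I} {ι : Type} (b : ι → G.M i)
    (S : ι → Prop) : Prop where
  isHBasis : G.IsHBasis b
  range_le : ∀ (j : B.I) (h : j ≤ i), LinearMap.range (f.app j) ≤
    Submodule.span (B.A j) (Set.range fun a : {a // S a} => G.res h (b a.1))
  apply_eq_zero : ∀ (j : B.I) (h : j ≤ i) (u : G.M j →ₗ[B.A j] B.A j),
    (∀ x, u (f.app j x) = 0) → ∀ a, S a → u (G.res h (b a)) = 0

namespace IsGenericSpan

variable {F G : PMod B} {f : Hom F G} {i : B.I} {ι : Type} {b : ι → G.M i} {S : ι → Prop}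
  (H : IsGenericSpan f b S)

include H

theorem res {j : B.I} (h : j ≤ i) : IsGenericSpan f (fun a => G.res h (b a)) S where
  isHBasis := H.isHBasis.res h
  range_le l h' := by
    simp only [G.res_res]
    exact H.range_le l (h'.trans h)
  apply_eq_zero l h' u hu a ha := by
    rw [G.res_res]
    exact H.apply_eq_zero l (h'.trans h) u hu a ha

theorem apply_app_eq_zero {u : G.dualSections i}
    (hu : ∀ a, S a → u.1 ⟨i, le_rfl⟩ (b a) = 0) (j : {j // j ≤ i}) (x : F.M j.1) :
    u.1 j (f.app j.1 x) = 0 := by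
  have hx := H.range_le j.1 j.2 (LinearMap.mem_range_self (f.app j.1) x)
  have hle : Submodule.span (B.A j.1) (Set.range fun a : {a // S a} => G.res j.2 (b a.1)) ≤
      LinearMap.ker (u.1 j) := by
    rw [Submodule.span_le]
    rintro _ ⟨a, rfl⟩
    have := u.2 ⟨i, le_rfl⟩ j j.2 (b a.1)
    rw [hu a.1 a.2, map_zero] at this
    exact this
  exact hle hx

/-- The section of the dual of the cokernel with the coordinate `a` as image in the dual. -/
def cokerCoord (a : {a // ¬ S a}) : (coker f).dualSections i :=
  cokerDualMk f (H.isHBasis.coord a.1) (H.apply_app_eq_zero fun a' ha' => by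
    classical
    rw [H.isHBasis.coord_self, if_neg]
    rintro rfl
    exact a.2 ha')

theorem res_cokerCoord {j : B.I} (h : j ≤ i) (a : {a // ¬ S a}) :
    (coker f).dual.res h (H.cokerCoord a) = (H.res h).cokerCoord a :=
  cokerDual_ext (H.isHBasis.res_coord h a.1)

/-- A functional on the cokernel, pulled back to G, vanishes on the image of f and so, by the
generic condition, on all `b a` with `S a`. Hence it is a combination of the other coordinates, each
of which does descend to the cokernel. -/
theorem isBasis_cokerCoord [Finite ι] : IsBasis (B.A i) H.cokerCoord := by
  classical
  have := Fintype.ofFinite ι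
  constructor
  · have h := H.isHBasis.isBasis_coord.1.comp (fun a : {a // ¬ S a} => a.1) Subtype.val_injective
    exact LinearIndependent.of_comp ((dualMap (cokerProj f)).app i) h
  · refine Submodule.eq_top_iff'.2 fun u => ?_
    let w : G.dualSections i := (dualMap (cokerProj f)).app i u
    have hw : ∀ a, S a → w.1 ⟨i, le_rfl⟩ (b a) = 0 := by
      intro a ha
      have h := H.apply_eq_zero i le_rfl (w.1 ⟨i, le_rfl⟩) (fun x => by
        have : (Submodule.Quotient.mk (f.app i x) : G.M i ⧸ LinearMap.range (f.app i)) = 0 :=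
          (Submodule.Quotient.mk_eq_zero _).2 ⟨x, rfl⟩
        exact (congrArg (u.1 ⟨i, le_rfl⟩) this).trans (map_zero _)) a ha
      rwa [G.res_refl] at h
    let v : G.dualSections i :=
      ∑ a : {a // ¬ S a}, w.1 ⟨i, le_rfl⟩ (b a.1) • H.isHBasis.coord a.1
    have hv : w = v := H.isHBasis.dual_ext fun a => by
      by_cases ha : S a
      · rw [hw a ha]
        exact (H.isHBasis.sum_coord_apply_eq_zero (fun a : {a // ¬ S a} => a.1) _
          fun a' h => a'.2 (h ▸ ha)).symm
      · exact (H.isHBasis.sum_coord_apply_self Subtype.val_injective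
          (fun a : {a // ¬ S a} => w.1 ⟨i, le_rfl⟩ (b a.1)) ⟨a, ha⟩).symm
    have h : u = ∑ a : {a // ¬ S a}, w.1 ⟨i, le_rfl⟩ (b a.1) • H.cokerCoord a :=
      cokerDual_ext (hv.trans (map_sum_smul (M := (coker f).dualSections i)
        (N := G.dualSections i) ((dualMap (cokerProj f)).app i)
        (fun a : {a // ¬ S a} => w.1 ⟨i, le_rfl⟩ (b a.1)) H.cokerCoord).symm)
    rw [h]
    exact Submodule.sum_mem _ fun a _ => Submodule.smul_mem _ _ (Submodule.subset_span ⟨a, rfl⟩)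

theorem isHBasis_cokerCoord [Finite ι] : (coker f).dual.IsHBasis H.cokerCoord := by
  intro j h
  have e : (fun a => (coker f).dual.res h (H.cokerCoord a)) = (H.res h).cokerCoord :=
    funext (H.res_cokerCoord h)
  rw [e]
  exact (H.res h).isBasis_cokerCoord

/-- The class of a coordinate in the quotient of the dual by the dual of the cokernel. -/
def coordClass (a : {a // S a}) : (coker (dualMap (cokerProj f))).M i :=
  (Submodule.Quotient.mk (p := LinearMap.range ((dualMap (cokerProj f)).app i))
    (H.isHBasis.coord a.1))

/-- The dual of the cokernel embeds in the dual of G as the span of the coordinates outside S, so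
the coordinates in S are a basis of the quotient. -/
theorem isBasis_coordClass [Finite ι] : IsBasis (B.A i) H.coordClass := by
  have h := IsBasis.coker (M := (coker f).dualSections i) (N := G.dualSections i)
    H.isHBasis.isBasis_coord H.isBasis_cokerCoord.2 ((dualMap (cokerProj f)).app i)
    (fun a : {a // ¬ S a} => a.1) fun a => rfl
  exact h.comp_equiv (κ := {a // S a}) (Equiv.subtypeEquivRight fun a => by simp)

theorem isHBasis_coordClass [Finite ι] :
    (coker (dualMap (cokerProj f))).IsHBasis H.coordClass := by
  intro j h
  have e : (fun a => (coker (dualMap (cokerProj f))).res h (H.coordClass a)) =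
      (H.res h).coordClass := funext fun a => congrArg (Submodule.Quotient.mk
        (p := LinearMap.range ((dualMap (cokerProj f)).app j))) (H.isHBasis.res_coord h a.1)
  rw [e]
  exact (H.res h).isBasis_coordClass

end IsGenericSpan

/-! ### Homomorphisms of cokernels -/

/-- The homomorphism of cokernels induced by a homomorphism. -/
def cokerMap {F G F' G' : PMod B} (f : Hom F G) (f' : Hom F' G') (a : Hom G G')
    (ha : ∀ i x, ∃ y, a.app i (f.app i x) = f'.app i y) : Hom (coker f) (coker f') where
  app i := Submodule.mapQ (LinearMap.range (f.app i)) (LinearMap.range (f'.app i)) (a.app i) (by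
    rintro _ ⟨x, rfl⟩
    obtain ⟨y, hy⟩ := ha i x
    exact ⟨y, hy.symm⟩)
  naturality {i j} h m := by
    obtain ⟨y, rfl⟩ := Submodule.Quotient.mk_surjective _ m
    exact congrArg (Submodule.Quotient.mk (p := LinearMap.range (f'.app i))) (a.naturality h y)

/-- The homomorphism from the cokernel of `f` induced by a homomorphism that vanishes on the image
of `f`. -/
def cokerLift {F G H : PMod B} (f : Hom F G) (a : Hom G H)
    (ha : ∀ i x, a.app i (f.app i x) = 0) : Hom (coker f) H where
  app i := Submodule.liftQ (LinearMap.range (f.app i)) (a.app i) (by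
    rintro _ ⟨x, rfl⟩
    exact ha i x)
  naturality {i j} h m := by
    obtain ⟨y, rfl⟩ := Submodule.Quotient.mk_surjective _ m
    exact a.naturality h y

/-- The dual of a right exact sequence is left exact. -/
theorem exists_dualMap_eq {F G H : PMod B} (a : Hom F G) (b : Hom G H)
    (hb : ∀ i, Function.Surjective (b.app i))
    (hab : ∀ i, LinearMap.ker (b.app i) ≤ LinearMap.range (a.app i)) {i : B.I}
    (v : G.dualSections i) (hv : ∀ (j : {j // j ≤ i}) (x : F.M j.1), v.1 j (a.app j.1 x) = 0) :
    ∃ w : H.dualSections i, (dualMap b).app i w = v := by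
  have hle : ∀ j : {j // j ≤ i}, LinearMap.ker (b.app j.1) ≤ LinearMap.ker (v.1 j) := by
    intro j y hy
    obtain ⟨x, rfl⟩ := hab j.1 hy
    exact hv j x
  let w (j : {j // j ≤ i}) : H.M j.1 →ₗ[B.A j.1] B.A j.1 :=
    (Submodule.liftQ _ (v.1 j) (hle j)).comp
      ((b.app j.1).quotKerEquivOfSurjective (hb j.1)).symm.toLinearMap
  have hw : ∀ (j : {j // j ≤ i}) (y : G.M j.1), w j (b.app j.1 y) = v.1 j y := by
    intro j y
    have : ((b.app j.1).quotKerEquivOfSurjective (hb j.1)).symm (b.app j.1 y) =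
        Submodule.Quotient.mk y := by
      rw [LinearEquiv.symm_apply_eq]
      rfl
    simp only [w, LinearMap.comp_apply, LinearEquiv.coe_coe, this]
    rfl
  refine ⟨⟨w, fun j l h m => ?_⟩, Subtype.ext (funext fun j => LinearMap.ext (hw j))⟩
  obtain ⟨y, rfl⟩ := hb j.1 m
  rw [← b.naturality, hw, hw, v.2 j l h]

theorem dualMap_injective {G H : PMod B} (b : Hom G H)
    (hb : ∀ i, Function.Surjective (b.app i)) (i : B.I) :
    Function.Injective ((dualMap b).app i) := by
  intro (u : H.dualSections i) (v : H.dualSections i) h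
  refine Subtype.ext (funext fun j => LinearMap.ext fun m => ?_)
  obtain ⟨y, rfl⟩ := hb j.1 m
  exact congrArg (fun w : G.dualSections i => w.1 j y) h

/-! ### Principal parts -/

attribute [local instance] complexModule complexTower

/-- The truncation `P^(k+1)(L) → P^k(L)`. -/
def partsTrunc (L : PMod B) (k : ℕ) : Hom (L.principalParts (k + 1)) (L.principalParts k) where
  app i := (jetTrunc k : Jet (B.A i) (L.M i) (k + 1) →ₗ[B.A i] Jet (B.A i) (L.M i) k)
  naturality h z := jetTrunc_jetMap (B.res h) (L.res h) k z

/-- The canonical homomorphism `S^k Ω ⊗ L → P^k(L)`. -/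
def symToParts (L : PMod B) (k : ℕ) :
    Hom (((cotangent B).sym k).tensor L) (L.principalParts k) where
  app i := (symToJet k :
    symPower (B.A i) Ω[B.A i⁄ℂ] k ⊗[B.A i] L.M i →ₗ[B.A i] Jet (B.A i) (L.M i) k)
  naturality h z := symToJet_map (B.res h) (L.res h) k z

theorem partsTrunc_jetHom (L : PMod B) (k : ℕ) {r : ℕ} (s : Fin r → L.GlobalSection) (i : B.I)
    (v : Fin r → B.A i) :
    (L.partsTrunc k).app i ((jetHom (k + 1) L s).app i v) = (jetHom k L s).app i v := by
  change (jetTrunc k : Jet (B.A i) (L.M i) (k + 1) →ₗ[B.A i] Jet (B.A i) (L.M i) k)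
    (∑ m, v m • jet (k + 1) ((s m).1 i)) = ∑ m, v m • jet k ((s m).1 i)
  rw [map_sum]
  refine Finset.sum_congr rfl fun m _ => ?_
  rw [map_smul]
  rfl

variable {B' : AlgBase}

theorem kaehlerMap_comp_comm {R R' A A' : Type} [CommRing R] [CommRing R'] [CommRing A]
    [CommRing A'] [Algebra ℂ R] [Algebra ℂ R'] [Algebra ℂ A] [Algebra ℂ A'] (φ : R →ₐ[ℂ] A)
    (φ' : R' →ₐ[ℂ] A') (ρ : R →ₐ[ℂ] R') (ψ : A →ₐ[ℂ] A') (h : ∀ r, φ' (ρ r) = ψ (φ r))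
    (ω : Ω[R⁄ℂ]) : kaehlerMap φ' (kaehlerMap ρ ω) = kaehlerMap ψ (kaehlerMap φ ω) := by
  induction ω using kaehler_induction with
  | h0 => simp
  | hadd x y hx hy => simp only [map_add, hx, hy]
  | h a b => simp [LinearMap.map_smulₛₗ, kaehlerMap_D, h]

theorem extLift_comm {R R' A A' M M' N N' : Type} [CommRing R] [CommRing R'] [CommRing A]
    [CommRing A'] [AddCommGroup M] [AddCommGroup M'] [AddCommGroup N] [AddCommGroup N']
    [Module R M] [Module R' M'] [Module A N] [Module A' N'] {φ : R →+* A} {φ' : R' →+* A'}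
    {ρ : R →+* R'} {ψ : A →+* A'} (hψ : ∀ r, ψ (φ r) = φ' (ρ r)) (r : M →ₛₗ[ρ] M')
    (g : N →ₛₗ[ψ] N') (f : M →ₛₗ[φ] N) (f' : M' →ₛₗ[φ'] N') (h : ∀ m, f' (r m) = g (f m))
    (z : Ext φ M) : Ext.lift f' (Ext.map ρ ψ hψ r z) = g (Ext.lift f z) := by
  induction z using Ext.induction with
  | h0 => simp
  | hadd x y hx hy => simp only [map_add, hx, hy]
  | h s m => rw [Ext.map_tmul, Ext.lift_tmul, Ext.lift_tmul, LinearMap.map_smulₛₗ, h]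

/-- The homomorphism `π^* Ω → Ω` of a morphism `π`. -/
def pullbackCotangent (p : BaseHom B B') : Hom ((cotangent B').pullback p) (cotangent B) where
  app i := Ext.lift (kaehlerMap (p.map i))
  naturality {i j} h z := extLift_comm (fun r => (p.naturality h r).symm)
    (kaehlerMap (B'.res (p.mono h))) (kaehlerMap (B.res h)) (kaehlerMap (p.map j))
    (kaehlerMap (p.map i))
    (kaehlerMap_comp_comm (p.map j) (p.map i) (B'.res (p.mono h)) (B.res h) (p.naturality h)) z

/-- The homomorphism `(π^* Ω)^{⊗ k} ⊗ Ω ⊗ L → S^(k+1) Ω ⊗ L`. -/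
def pullbackToSym (p : BaseHom B B') (L : PMod B) (k : ℕ) :
    Hom (((((cotangent B').pullback p).pow k).tensor (cotangent B)).tensor L)
      (((cotangent B).sym (k + 1)).tensor L) :=
  ((symMul (cotangent B) k).comp
    ((powToSym (pullbackCotangent p) k).tensor (Hom.id _))).tensor (Hom.id L)

end PMod

end

section

open PMod

attribute [local instance] complexModule complexTower

theorem symMon_scrollExp {A M σ : Type} [CommRing A] [AddCommGroup M] [Module A M] (w : σ → M)
    (o : σ) (k : ℕ) (a : σ) :
    (symMon (A := A) w (k + 1) ⟨scrollExp o k a, degree_scrollExp o k a⟩).1 =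
      SymmetricAlgebra.ι A M (w o) ^ k * SymmetricAlgebra.ι A M (w a) := by
  change (scrollExp o k a).prod (fun i m => SymmetricAlgebra.ι A M (w i) ^ m) = _
  have h (i : σ) (m : ℕ) : (Finsupp.single i m).prod (fun i m => SymmetricAlgebra.ι A M (w i) ^ m) =
      SymmetricAlgebra.ι A M (w i) ^ m := Finsupp.prod_single_index (pow_zero _)
  rw [scrollExp, Finsupp.prod_add_index' (fun _ => pow_zero _) fun _ _ _ => pow_add _ _ _, h, h,
    pow_one]

/-! ### Bases of charts of scrolls -/

/-- Coordinates on a member of the base: functions `x` with the coordinate `x o` coming from a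
coordinate `t` of the curve, and a generator `e` of `L`, with respect to which the sections `s` are
linear in the functions `x`, with functions on the curve as coefficients. -/
structure ScrollChart {B B' : AlgBase} (p : BaseHom B B') (L : PMod B) {r : ℕ}
    (s : Fin r → L.GlobalSection) {σ : Type} [Fintype σ] (o : σ) (j : B.I) where
  x : σ → B.A j
  t : B'.A (p.idx j)
  e : L.M j
  isBasis_x : IsBasis (B.A j) fun c => KaehlerDifferential.D ℂ (B.A j) (x c)
  isBasis_t : IsBasis (B'.A (p.idx j)) fun _ : Unit => KaehlerDifferential.D ℂ _ t
  x_eq : x o = p.map j t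
  isHBasis_e : L.IsHBasis fun _ : Unit => e
  section_eq : ∀ l, ∃ (q₀ : B'.A (p.idx j)) (q : σ → B'.A (p.idx j)),
    (s l).1 j = (p.map j q₀ + ∑ c, p.map j (q c) * x c) • e

/-- A base of a smooth integral space in which the members with coordinates are cofinal. -/
structure IsScrollBase {B B' : AlgBase} (p : BaseHom B B') (L : PMod B) {r : ℕ}
    (s : Fin r → L.GlobalSection) {σ : Type} [Fintype σ] (o : σ) : Prop where
  smooth : B.IsSmooth
  smooth' : B'.IsSmooth
  isDomain : ∀ i, (B.mem i).Nonempty → IsDomain (B.A i)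
  subsingleton : ∀ i, ¬ (B.mem i).Nonempty → Subsingleton (B.A i)
  res_injective : ∀ {i j : B.I} (h : i ≤ j), (B.mem i).Nonempty → Function.Injective (B.res h)
  exists_generator : ∀ i, ∃ e : L.M i, L.IsHBasis fun _ : Unit => e
  exists_chart : ∀ i, ∀ x ∈ B.mem i, ∃ j, j ≤ i ∧ x ∈ B.mem j ∧ Nonempty (ScrollChart p L s o j)
  exists_mem : ∀ x, ∃ i, x ∈ B.mem i

section

variable {B B' : AlgBase} {p : BaseHom B B'} {L : PMod B} {r : ℕ} {s : Fin r → L.GlobalSection}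
  {σ : Type} [Fintype σ] {o : σ}

/-! ### Bases of the sheaves given by coordinates of a scroll -/

namespace ScrollChart

variable {j : B.I} (c : ScrollChart p L s o j)

theorem isBasis_D_res (hB : B.IsSmooth) {i j : B.I} (h : i ≤ j) {ι : Type} {x : ι → B.A j}
    (hx : IsBasis (B.A j) fun a => KaehlerDifferential.D ℂ (B.A j) (x a)) :
    IsBasis (B.A i) fun a => KaehlerDifferential.D ℂ (B.A i) (B.res h (x a)) := by
  have := isBasis_kaehlerMap (B.res h) (hB.formallyEtale h) hx
  simpa only [kaehlerMap_D] using this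

/-- Restriction of coordinates. -/
def res (hB : B.IsSmooth) (hB' : B'.IsSmooth) {i : B.I} (h : i ≤ j) : ScrollChart p L s o i where
  x a := B.res h (c.x a)
  t := B'.res (p.mono h) c.t
  e := L.res h c.e
  isBasis_x := isBasis_D_res hB h c.isBasis_x
  isBasis_t := isBasis_D_res hB' (p.mono h) c.isBasis_t
  x_eq := by rw [p.naturality, c.x_eq]
  isHBasis_e := c.isHBasis_e.res h
  section_eq l := by
    obtain ⟨q₀, q, hq⟩ := c.section_eq l
    refine ⟨B'.res (p.mono h) q₀, fun a => B'.res (p.mono h) (q a), ?_⟩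
    rw [← (s l).2 h, hq, LinearMap.map_smulₛₗ]
    refine congrArg (· • L.res h c.e) ?_
    change B.res h _ = _
    simp only [map_add, map_sum, map_mul, ← p.naturality h]

theorem isBasis_e : IsBasis (B.A j) fun _ : Unit => c.e := c.isHBasis_e.isBasis

/-- A family of sections attached to coordinates is a hereditary basis. -/
theorem isHBasis_of_res (hB : B.IsSmooth) (hB' : B'.IsSmooth) {F : PMod B} {ι : Type}
    (fam : ∀ {j : B.I}, ScrollChart p L s o j → ι → F.M j)
    (hfam : ∀ {j : B.I} (c : ScrollChart p L s o j), IsBasis (B.A j) (fam c))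
    (hres : ∀ {i j : B.I} (h : i ≤ j) (c : ScrollChart p L s o j) (a : ι),
      F.res h (fam c a) = fam (c.res hB hB' h) a) : F.IsHBasis (fam c) := by
  intro i h
  have e : (fun a => F.res h (fam c a)) = fam (c.res hB hB' h) := funext (hres h c)
  rw [e]
  exact hfam _

/-- The monomials of principal parts. -/
def mon (k : ℕ) (α : ExpLE σ k) : (L.principalParts k).M j :=
  (jetMon c.x k c.e α.1 : Jet (B.A j) (L.M j) k)

theorem isHBasis_mon (hB : B.IsSmooth) (hB' : B'.IsSmooth) (k : ℕ) :
    (L.principalParts k).IsHBasis (c.mon k) :=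
  c.isHBasis_of_res hB hB' (fun c => c.mon k)
    (fun {j} c => by
      have := hB.formallySmooth j
      exact isBasis_jetMon c.x c.isBasis_x c.isBasis_e k)
    fun h c α => jetMap_jetMon (B.res h) (L.res h) c.x k c.e α.1

/-- The only use of the rank hypothesis. The jets lie in the span of the distinguished monomials,
whose number equals the rank of their image; so a functional that vanishes on the jets vanishes on
these monomials, although the jets need not generate the span. -/
theorem isGenericSpan_mon [DecidableEq σ] (H : IsScrollBase p L s o) {k : ℕ}
    (hr : HasGenericRank (jetHom k L s) (k * Fintype.card σ + 1)) :
    IsGenericSpan (jetHom k L s) (c.mon k) (fun α => IsScrollExp o α.1) := by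
  have hrange : ∀ {j : B.I} (c : ScrollChart p L s o j), LinearMap.range ((jetHom k L s).app j) ≤
      Submodule.span (B.A j) (Set.range fun α : {α : ExpLE σ k // IsScrollExp o α.1} =>
        c.mon k α.1) := by
    intro j c
    rintro _ ⟨v, rfl⟩
    change ∑ m, v m • (jet k ((s m).1 j) : Jet (B.A j) (L.M j) k) ∈
      Submodule.span (B.A j) (Set.range fun α : {α : ExpLE σ k // IsScrollExp o α.1} =>
        (jetMon c.x k c.e α.1.1 : Jet (B.A j) (L.M j) k))
    refine Submodule.sum_mem _ fun m _ => Submodule.smul_mem _ _ ?_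
    obtain ⟨q₀, q, hq⟩ := c.section_eq m
    rw [hq]
    exact jet_mem_span_jetMon (p.map j) c.x o c.x_eq c.isBasis_t.2 k q₀ q c.e
  have hres : ∀ {i : B.I} (h : i ≤ j) (α : ExpLE σ k),
      (L.principalParts k).res h (c.mon k α) = (c.res H.smooth H.smooth' h).mon k α :=
    fun h α => jetMap_jetMon (B.res h) (L.res h) c.x k c.e α.1
  refine ⟨c.isHBasis_mon H.smooth H.smooth' k, fun i h => ?_, fun i h u hu α hα => ?_⟩
  · have e : (fun α : {α : ExpLE σ k // IsScrollExp o α.1} =>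
        (L.principalParts k).res h (c.mon k α.1)) =
        fun α : {α : ExpLE σ k // IsScrollExp o α.1} =>
          (c.res H.smooth H.smooth' h).mon k α.1 := funext fun α => hres h α.1
    rw [e]
    exact hrange _
  · by_cases hi : (B.mem i).Nonempty
    · have := H.isDomain i hi
      have := finite_expLE (σ := σ) k
      rw [hres]
      have hli : LinearIndependent (B.A i) (fun α : {α : ExpLE σ k // IsScrollExp o α.1} =>
          (c.res H.smooth H.smooth' h).mon k α.1) :=
        ((c.res H.smooth H.smooth' h).isHBasis_mon H.smooth H.smooth' k).isBasis.1.comp _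
          Subtype.val_injective
      refine apply_eq_zero_of_finrank_eq hli (hrange _) ?_ u ?_ ⟨α, hα⟩
      · rw [hr i hi, card_scrollExpLE]
      · rintro _ ⟨v, rfl⟩
        exact hu v
    -- Over an empty member all functions vanish.
    · have := H.subsingleton i hi
      exact Subsingleton.elim _ _

/-- The monomials of symmetric powers. -/
def symElt (k : ℕ) (α : ExpEq σ k) : (((cotangent B).sym k).tensor L).M j :=
  (symMon (fun a => KaehlerDifferential.D ℂ (B.A j) (c.x a)) k α ⊗ₜ[B.A j] c.e :
    symPower (B.A j) Ω[B.A j⁄ℂ] k ⊗[B.A j] L.M j)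

theorem isBasis_symElt (k : ℕ) : IsBasis (B.A j) (c.symElt k) :=
  ((isBasis_symMon _ c.isBasis_x k).tmul c.isBasis_e).comp_equiv (Equiv.prodPUnit _).symm

theorem res_symElt (hB : B.IsSmooth) (hB' : B'.IsSmooth) (k : ℕ) {i : B.I} (h : i ≤ j)
    (α : ExpEq σ k) : (((cotangent B).sym k).tensor L).res h (c.symElt k α) =
      (c.res hB hB' h).symElt k α := by
  change TensorProduct.map (symMap _ (kaehlerMap (B.res h)) k) (L.res h)
    (symMon _ k α ⊗ₜ[B.A j] c.e) = _
  rw [TensorProduct.map_tmul, symMap_symMon]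
  simp only [kaehlerMap_D]
  rfl

theorem symToParts_symElt (k : ℕ) (α : ExpEq σ k) :
    (L.symToParts k).app j (c.symElt k α) = c.mon k ⟨α.1, α.2.le⟩ :=
  symToJet_symMon c.x k α c.e

/-- The sections `dt^k ⊗ dx_a ⊗ e`. -/
def pullElt (k : ℕ) (a : σ) :
    (((((cotangent B').pullback p).pow k).tensor (cotangent B)).tensor L).M j :=
  ((powElt ((cotangent B').pullback p) (i := j)
      (Ext.mk (p.map j : B'.A (p.idx j) →+* B.A j) (KaehlerDifferential.D ℂ _ c.t)) k ⊗ₜ[B.A j]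
    KaehlerDifferential.D ℂ (B.A j) (c.x a)) ⊗ₜ[B.A j] c.e :
    ((((cotangent B').pullback p).pow k).M j ⊗[B.A j] Ω[B.A j⁄ℂ]) ⊗[B.A j] L.M j)

theorem isBasis_pullElt (k : ℕ) : IsBasis (B.A j) (c.pullElt k) :=
  (((isBasis_powElt ((cotangent B').pullback p) (Ext.isBasis
    (p.map j : B'.A (p.idx j) →+* B.A j) c.isBasis_t) k).tmul c.isBasis_x).tmul
      c.isBasis_e).comp_equiv ((Equiv.punitProd σ).symm.trans (Equiv.prodPUnit _).symm)

theorem res_pullElt (hB : B.IsSmooth) (hB' : B'.IsSmooth) (k : ℕ) {i : B.I} (h : i ≤ j) (a : σ) :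
    (((((cotangent B').pullback p).pow k).tensor (cotangent B)).tensor L).res h
      (c.pullElt k a) = (c.res hB hB' h).pullElt k a := by
  have h1 := res_powElt ((cotangent B').pullback p) h
    (Ext.mk (p.map j : B'.A (p.idx j) →+* B.A j) (KaehlerDifferential.D ℂ _ c.t)) k
  have h2 : ((cotangent B').pullback p).res h
      (Ext.mk (p.map j : B'.A (p.idx j) →+* B.A j) (KaehlerDifferential.D ℂ _ c.t)) =
      Ext.mk (p.map i : B'.A (p.idx i) →+* B.A i)
        (KaehlerDifferential.D ℂ _ (B'.res (p.mono h) c.t)) :=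
    (extMap_mk (B.resHom h) (fun r => (p.naturality h r).symm)
      (kaehlerMap (B'.res (p.mono h))) _).trans
        (congrArg _ (kaehlerMap_D (B'.res (p.mono h)) c.t))
  rw [h2] at h1
  change TensorProduct.map (TensorProduct.map ((((cotangent B').pullback p).pow k).res h)
    (kaehlerMap (B.res h))) (L.res h) ((_ ⊗ₜ[B.A j] _) ⊗ₜ[B.A j] _) = _
  rw [TensorProduct.map_tmul, TensorProduct.map_tmul, kaehlerMap_D]
  exact congrArg (fun z => (z ⊗ₜ[B.A i] KaehlerDifferential.D ℂ (B.A i) (B.res h (c.x a)))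
    ⊗ₜ[B.A i] L.res h c.e) h1

/-- Since x_o is the pullback of t, the form dt becomes dx_o; the monomials hit are exactly the
distinguished ones of degree k + 1, each once. Injectivity and the basis of the cokernel follow. -/
theorem pullbackToSym_pullElt (k : ℕ) (a : σ) :
    (pullbackToSym p L k).app j (c.pullElt k a) =
      c.symElt (k + 1) ⟨scrollExp o k a, degree_scrollExp o k a⟩ := by
  refine congrArg (fun z : symPower (B.A j) Ω[B.A j⁄ℂ] (k + 1) => z ⊗ₜ[B.A j] c.e)
    (Subtype.ext ?_)
  have h1 := powToSym_powElt (pullbackCotangent p) (i := j)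
    (Ext.mk (p.map j : B'.A (p.idx j) →+* B.A j) (KaehlerDifferential.D ℂ _ c.t)) k
  have h2 : (pullbackCotangent p).app j
      (Ext.mk (p.map j : B'.A (p.idx j) →+* B.A j) (KaehlerDifferential.D ℂ _ c.t)) =
      KaehlerDifferential.D ℂ (B.A j) (c.x o) :=
    (Ext.lift_mk _ _).trans
      ((kaehlerMap_D (p.map j) c.t).trans (congrArg (KaehlerDifferential.D ℂ (B.A j)) c.x_eq.symm))
  rw [h2] at h1
  exact (congrArg (· * SymmetricAlgebra.ι (B.A j) Ω[B.A j⁄ℂ]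
    (KaehlerDifferential.D ℂ (B.A j) (c.x a))) h1).trans
      (symMon_scrollExp (fun a => KaehlerDifferential.D ℂ (B.A j) (c.x a)) o k a).symm

include c in
theorem pullbackToSym_injective (k : ℕ) :
    Function.Injective ((pullbackToSym p L k).app j) :=
  (c.isBasis_symElt (k + 1)).injective_of_apply_eq (c.isBasis_pullElt k) _
    (fun a => ⟨scrollExp o k a, degree_scrollExp o k a⟩)
    (fun _ _ h => scrollExp_injective o k (congrArg Subtype.val h))
    (c.pullbackToSym_pullElt k)

/-- The classes of the monomials that do not come from the curve and one further differential. -/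
def cokerElt (k : ℕ) (α : {α : ExpEq σ (k + 1) // ¬ IsScrollExp o α.1}) :
    (coker (pullbackToSym p L k)).M j :=
  Submodule.Quotient.mk (p := LinearMap.range ((pullbackToSym p L k).app j)) (c.symElt (k + 1) α.1)

theorem isBasis_cokerElt (k : ℕ) : IsBasis (B.A j) (c.cokerElt k) := by
  have h := IsBasis.coker (c.isBasis_symElt (k + 1)) (c.isBasis_pullElt k).2
    ((pullbackToSym p L k).app j)
    (fun a => (⟨scrollExp o k a, degree_scrollExp o k a⟩ : ExpEq σ (k + 1)))
    (c.pullbackToSym_pullElt k)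
  -- The exponents outside the range of `scrollExp o k` are those of degree k + 1 that are not
  -- distinguished.
  refine h.comp_equiv (κ := {α : ExpEq σ (k + 1) // ¬ IsScrollExp o α.1})
    (Equiv.subtypeEquivRight fun α => not_congr ⟨fun hα => ?_, ?_⟩)
  · obtain ⟨a, ha⟩ := exists_eq_scrollExp o k α.2 hα
    exact ⟨a, Subtype.ext ha⟩
  · rintro ⟨a, rfl⟩
    exact isScrollExp_scrollExp o k a

theorem isHBasis_pullElt (hB : B.IsSmooth) (hB' : B'.IsSmooth) (k : ℕ) :
    (((((cotangent B').pullback p).pow k).tensor (cotangent B)).tensor L).IsHBasis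
      (c.pullElt k) :=
  c.isHBasis_of_res hB hB' (fun c => c.pullElt k) (fun c => c.isBasis_pullElt k)
    fun h c a => c.res_pullElt hB hB' k h a

theorem isHBasis_cokerElt (hB : B.IsSmooth) (hB' : B'.IsSmooth) (k : ℕ) :
    (coker (pullbackToSym p L k)).IsHBasis (c.cokerElt k) :=
  c.isHBasis_of_res hB hB' (fun c => c.cokerElt k) (fun c => c.isBasis_cokerElt k)
    fun {i _} h c α => congrArg (Submodule.Quotient.mk
      (p := LinearMap.range ((pullbackToSym p L k).app i))) (c.res_symElt hB hB' (k + 1) h α.1)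

end ScrollChart

end

end

/-! ### The homomorphisms of the exact sequences and their exactness -/

section

open PMod

attribute [local instance] complexModule complexTower

/-- A homomorphism to the dual whose values vanish on the image of `f`, as a homomorphism to the
dual of the cokernel. -/
def PMod.cokerDualLift {B : AlgBase} {F G H : PMod B} (f : Hom F G) (a : Hom H G.dual)
    (ha : ∀ (i : B.I) (u : H.M i) (j : {j // j ≤ i}) (x : F.M j.1),
      (a.app i u : G.dualSections i).1 j (f.app j.1 x) = 0) : Hom H (coker f).dual where
  app i :=
    { toFun := fun u => cokerDualMk f (a.app i u) (ha i u)
      map_add' := fun u v => cokerDual_ext (map_add (a.app i) u v)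
      map_smul' := fun c u => cokerDual_ext (map_smul (a.app i) c u) }
  naturality h u := cokerDual_ext (a.naturality h u)

section

variable {B B' : AlgBase} {p : BaseHom B B'} {L : PMod B} {r : ℕ} {s : Fin r → L.GlobalSection}
  {σ : Type} [Fintype σ] {o : σ}

variable (p L) in
/-- The homomorphism `(π^* Ω)^{⊗ k} ⊗ Ω ⊗ L → P^(k+1)(L)`. -/
def pullToParts (k : ℕ) :
    Hom (((((cotangent B').pullback p).pow k).tensor (cotangent B)).tensor L)
      (L.principalParts (k + 1)) :=
  (L.symToParts (k + 1)).comp (pullbackToSym p L k)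

theorem ScrollChart.pullToParts_pullElt {j : B.I} (c : ScrollChart p L s o j) (k : ℕ) (a : σ) :
    (pullToParts p L k).app j (c.pullElt k a) =
      c.mon (k + 1) ⟨scrollExp o k a, (degree_scrollExp o k a).le⟩ :=
  (congrArg ((L.symToParts (k + 1)).app j) (c.pullbackToSym_pullElt k a)).trans
    (c.symToParts_symElt (k + 1) _)

variable [DecidableEq σ] (H : IsScrollBase p L s o) {k : ℕ}
  (hr : HasGenericRank (jetHom (k + 1) L s) ((k + 1) * Fintype.card σ + 1))

include H hr

/-- A functional that vanishes on jets also vanishes on the image of (π^*Ω)^k ⊗ Ω ⊗ L, because on a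
chart that image is generated by distinguished monomials. A general member need not have
coordinates, but the value is a function, and restriction of functions to a non-empty chart is
injective. -/
theorem IsScrollBase.apply_pullToParts {i : B.I} (u : (L.principalParts (k + 1)).dualSections i)
    (hu : ∀ (j : {j // j ≤ i}) x, u.1 j ((jetHom (k + 1) L s).app j.1 x) = 0)
    (j : {j // j ≤ i}) (z) : u.1 j ((pullToParts p L k).app j.1 z) = 0 := by
  by_cases hj : (B.mem j.1).Nonempty
  · obtain ⟨x, hx⟩ := hj
    obtain ⟨l, hl, hxl, ⟨c⟩⟩ := H.exists_chart j.1 x hx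
    refine (injective_iff_map_eq_zero _).1 (H.res_injective hl ⟨x, hxl⟩) _ ?_
    rw [← u.2 j ⟨l, hl.trans j.2⟩ hl, ← (pullToParts p L k).naturality]
    have h0 : (u.1 ⟨l, hl.trans j.2⟩).comp ((pullToParts p L k).app l) = 0 := by
      refine (c.isBasis_pullElt k).basis.ext fun a => ?_
      rw [IsBasis.basis_apply, LinearMap.comp_apply, c.pullToParts_pullElt]
      have h := (c.isGenericSpan_mon H hr).apply_eq_zero l le_rfl (u.1 ⟨l, hl.trans j.2⟩)
        (hu ⟨l, hl.trans j.2⟩) ⟨scrollExp o k a, (degree_scrollExp o k a).le⟩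
        (isScrollExp_scrollExp o k a)
      rw [PMod.res_refl] at h
      exact h
    exact LinearMap.congr_fun h0 _
  · have := H.subsingleton j.1 hj
    exact Subsingleton.elim _ _

end

section

variable {B B' : AlgBase} (p : BaseHom B B') (L : PMod B) {r : ℕ} (s : Fin r → L.GlobalSection)
  {σ : Type} [Fintype σ] [DecidableEq σ] {o : σ}

/-- The homomorphism `Q_(k+1) → Q_k` induced by the truncation. -/
def cokerTrunc (k : ℕ) : Hom (coker (jetHom (k + 1) L s)) (coker (jetHom k L s)) :=
  cokerMap _ _ (L.partsTrunc k) fun i v => ⟨v, L.partsTrunc_jetHom k s i v⟩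

theorem cokerTrunc_surjective (k : ℕ) (i : B.I) :
    Function.Surjective ((cokerTrunc L s k).app i) := by
  intro m
  obtain ⟨y, rfl⟩ := Submodule.Quotient.mk_surjective
    (LinearMap.range ((jetHom k L s).app i)) m
  obtain ⟨z, hz⟩ := jetTrunc_surjective (A := B.A i) (M := L.M i) k y
  exact ⟨Submodule.Quotient.mk (p := LinearMap.range ((jetHom (k + 1) L s).app i)) z,
    congrArg (Submodule.Quotient.mk (p := LinearMap.range ((jetHom k L s).app i))) hz⟩

/-- If the truncation of y is the k-jet of v, then y minus the (k+1)-jet of v has zero truncation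
and comes from S^(k+1) Ω ⊗ L. With surjectivity this is the right exact sequence whose dual is taken
below. -/
theorem ker_cokerTrunc_le (k : ℕ) (i : B.I) :
    LinearMap.ker ((cokerTrunc L s k).app i) ≤
      LinearMap.range (((cokerProj (jetHom (k + 1) L s)).comp (L.symToParts (k + 1))).app i) := by
  intro m hm
  obtain ⟨y, rfl⟩ := Submodule.Quotient.mk_surjective
    (LinearMap.range ((jetHom (k + 1) L s).app i)) m
  obtain ⟨v, hv⟩ := (Submodule.Quotient.mk_eq_zero
    (LinearMap.range ((jetHom k L s).app i))).1 hm
  have hker : (y - (jetHom (k + 1) L s).app i v : (L.principalParts (k + 1)).M i) ∈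
      LinearMap.ker (jetTrunc k : Jet (B.A i) (L.M i) (k + 1) →ₗ[B.A i] Jet (B.A i) (L.M i) k) := by
    have h := map_sub ((L.partsTrunc k).app i) y ((jetHom (k + 1) L s).app i v)
    exact h.trans ((congrArg₂ (· - ·) hv.symm (L.partsTrunc_jetHom k s i v)).trans (sub_self _))
  obtain ⟨w, hw⟩ := ker_jetTrunc_le k hker
  refine ⟨w, ?_⟩
  refine (congrArg (Submodule.Quotient.mk
    (p := LinearMap.range ((jetHom (k + 1) L s).app i))) hw).trans ?_
  refine (Submodule.Quotient.eq (LinearMap.range ((jetHom (k + 1) L s).app i))).2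
    ⟨-v, ?_⟩
  rw [map_neg]
  abel

variable {p L s}
variable (H : IsScrollBase p L s o) {k : ℕ}
  (hr : HasGenericRank (jetHom (k + 1) L s) ((k + 1) * Fintype.card σ + 1))

theorem dualCoker_apply_jetHom {k : ℕ} {i : B.I} (u : (coker (jetHom k L s)).dualSections i)
    (j : {j // j ≤ i}) (x) :
    ((dualMap (cokerProj (jetHom k L s))).app i u :
      (L.principalParts k).dualSections i).1 j ((jetHom k L s).app j.1 x) = 0 := by
  have : (Submodule.Quotient.mk ((jetHom k L s).app j.1 x) :
      (L.principalParts k).M j.1 ⧸ LinearMap.range ((jetHom k L s).app j.1)) = 0 :=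
    (Submodule.Quotient.mk_eq_zero _).2 ⟨x, rfl⟩
  exact (congrArg (u.1 j) this).trans (map_zero _)

/-- The homomorphism from `Q_(k+1)^∨` to the dual of the cokernel of
`(π^* Ω)^{⊗ k} ⊗ Ω ⊗ L → S^(k+1) Ω ⊗ L`. -/
def IsScrollBase.dualCokerToDual :
    Hom (coker (jetHom (k + 1) L s)).dual (coker (pullbackToSym p L k)).dual :=
  cokerDualLift _ (dualMap ((cokerProj (jetHom (k + 1) L s)).comp (L.symToParts (k + 1))))
    fun _ u j x => H.apply_pullToParts hr _ (dualCoker_apply_jetHom u) j x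

omit [DecidableEq σ] in
include H in
theorem IsScrollBase.isShortExact_pullbackToSym :
    IsShortExact (pullbackToSym p L k) (cokerProj (pullbackToSym p L k)) where
  injective i z hz x hx := by
    obtain ⟨j, hj, hxj, ⟨c⟩⟩ := H.exists_chart i x hx
    refine ⟨j, hj, hxj, c.pullbackToSym_injective k ?_⟩
    rw [(pullbackToSym p L k).naturality, hz, map_zero, map_zero]
  zero i z := (Submodule.Quotient.mk_eq_zero _).2 ⟨z, rfl⟩
  exact i t ht x hx := by
    obtain ⟨z, hz⟩ := (Submodule.Quotient.mk_eq_zero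
      (LinearMap.range ((pullbackToSym p L k).app i))).1 ht
    exact ⟨i, le_rfl, hx, z, by rw [hz, PMod.res_refl]⟩
  surjective i u x hx := by
    obtain ⟨z, rfl⟩ := Submodule.Quotient.mk_surjective
      (LinearMap.range ((pullbackToSym p L k).app i)) u
    exact ⟨i, le_rfl, hx, z, (PMod.res_refl (coker (pullbackToSym p L k)) i
      (Submodule.Quotient.mk (p := LinearMap.range ((pullbackToSym p L k).app i)) z)).symm⟩

/-- All but surjectivity is left exactness of the dual of S^(k+1) Ω ⊗ L → Q_(k+1) → Q_k → 0,
together with the fact that its functionals factor through the cokernel M. Surjectivity needs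
coordinates and the rank. -/
theorem IsScrollBase.isShortExact_dualCoker :
    IsShortExact (dualMap (cokerTrunc L s k)) (H.dualCokerToDual hr) where
  injective i u hu x hx := ⟨i, le_rfl, hx, by
    rw [dualMap_injective _ (cokerTrunc_surjective L s k) i (hu.trans (map_zero _).symm),
      map_zero]⟩
  zero i (u : (coker (jetHom k L s)).dualSections i) := by
    refine cokerDual_ext (Subtype.ext (funext fun j => LinearMap.ext fun z => ?_))
    have h : (cokerTrunc L s k).app j.1
        (((cokerProj (jetHom (k + 1) L s)).comp (L.symToParts (k + 1))).app j.1 z) = 0 :=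
      congrArg (Submodule.Quotient.mk (p := LinearMap.range ((jetHom k L s).app j.1)))
        (jetTrunc_symToJet (A := B.A j.1) (M := L.M j.1) k z)
    exact (congrArg (u.1 j) h).trans (map_zero _)
  exact i (v : (coker (jetHom (k + 1) L s)).dualSections i) hv x hx := by
    obtain ⟨w, hw⟩ := exists_dualMap_eq
      ((cokerProj (jetHom (k + 1) L s)).comp (L.symToParts (k + 1))) (cokerTrunc L s k)
      (cokerTrunc_surjective L s k) (ker_cokerTrunc_le L s k) v fun j z =>
        congrArg (fun w : (coker (pullbackToSym p L k)).dualSections i => w.1 j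
          (Submodule.Quotient.mk (p := LinearMap.range ((pullbackToSym p L k).app j.1)) z)) hv
    exact ⟨i, le_rfl, hx, w, hw⟩
  surjective i m x hx := by
    obtain ⟨j, hj, hxj, ⟨c⟩⟩ := H.exists_chart i x hx
    refine ⟨j, hj, hxj, ?_⟩
    generalize (coker (pullbackToSym p L k)).dual.res hj m = m'
    revert m'
    intro (m' : (coker (pullbackToSym p L k)).dualSections j)
    have := finite_expEq (σ := σ) (k + 1)
    have := Fintype.ofFinite {α : ExpEq σ (k + 1) // ¬ IsScrollExp o α.1}
    have G := c.isGenericSpan_mon H hr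
    let g (α : {α : ExpEq σ (k + 1) // ¬ IsScrollExp o α.1}) : ExpLE σ (k + 1) :=
      ⟨α.1.1, α.1.2.le⟩
    have hg : Function.Injective g := fun α β h =>
      Subtype.ext (Subtype.ext (congrArg (fun z : ExpLE σ (k + 1) => z.1) h))
    -- A functional on M is prescribed on the non-distinguished monomials of degree k + 1. Extended
    -- by zero to all other monomials, it vanishes on the distinguished ones, hence on all jets.
    let v : (L.principalParts (k + 1)).dualSections j :=
      ∑ α, m'.1 ⟨j, le_rfl⟩ (c.cokerElt k α) • G.isHBasis.coord (g α)
    refine ⟨cokerDualMk _ v (G.apply_app_eq_zero fun β hβ => ?_),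
      (c.isHBasis_cokerElt H.smooth H.smooth' k).dual_ext fun α => ?_⟩
    · exact G.isHBasis.sum_coord_apply_eq_zero g _ fun α h => α.2 (by
        have := congrArg (fun z : ExpLE σ (k + 1) => z.1) h
        exact this ▸ hβ)
    · refine Eq.trans ?_ (G.isHBasis.sum_coord_apply_self hg
        (fun α => m'.1 ⟨j, le_rfl⟩ (c.cokerElt k α)) α)
      exact congrArg (v.1 ⟨j, le_rfl⟩) (c.symToParts_symElt (k + 1) α.1)

/-- The homomorphism `E_k → E_(k+1)` induced by the truncation. -/
def quotientDualMap (L : PMod B) (s : Fin r → L.GlobalSection) (k : ℕ) :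
    Hom (coker (dualMap (cokerProj (jetHom k L s))))
      (coker (dualMap (cokerProj (jetHom (k + 1) L s)))) :=
  cokerMap _ _ (dualMap (L.partsTrunc k)) fun i u =>
    ⟨(dualMap (cokerTrunc L s k)).app i u, rfl⟩

/-- The homomorphism from `E_(k+1)` to the dual of `(π^* Ω)^{⊗ k} ⊗ Ω ⊗ L`. -/
def IsScrollBase.quotientToDual :
    Hom (coker (dualMap (cokerProj (jetHom (k + 1) L s))))
      (((((cotangent B').pullback p).pow k).tensor (cotangent B)).tensor L).dual :=
  cokerLift _ (dualMap (pullToParts p L k)) fun _ u =>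
    Subtype.ext (funext fun j => LinearMap.ext fun z =>
      H.apply_pullToParts hr _ (dualCoker_apply_jetHom u) j z)

theorem exists_dualMap_cokerProj_eq {k : ℕ} {i : B.I} (u : (L.principalParts k).dualSections i)
    (hu : ∀ (j : {j // j ≤ i}) x, u.1 j ((jetHom k L s).app j.1 x) = 0) :
    ∃ w, (dualMap (cokerProj (jetHom k L s))).app i w = u :=
  ⟨cokerDualMk _ u hu, rfl⟩

/-- Injectivity holds because k-jets are the truncations of (k+1)-jets: a functional on P^k vanishes
on the former once its pullback to P^(k+1) vanishes on the latter. The other two nontrivial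
properties are checked on monomials over a chart. -/
theorem IsScrollBase.isShortExact_quotient :
    IsShortExact (quotientDualMap L s k) (H.quotientToDual hr) where
  injective i m hm x hx := by
    refine ⟨i, le_rfl, hx, ?_⟩
    have hm0 : m = 0 := by
      obtain ⟨u, rfl⟩ := Submodule.Quotient.mk_surjective
        (LinearMap.range ((dualMap (cokerProj (jetHom k L s))).app i)) m
      revert u
      intro (u : (L.principalParts k).dualSections i) hm
      obtain ⟨w, hw⟩ := (Submodule.Quotient.mk_eq_zero
        (LinearMap.range ((dualMap (cokerProj (jetHom (k + 1) L s))).app i))).1 hm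
      refine (Submodule.Quotient.mk_eq_zero
        (LinearMap.range ((dualMap (cokerProj (jetHom k L s))).app i))).2
        (exists_dualMap_cokerProj_eq u fun j v => ?_)
      have h1 := dualCoker_apply_jetHom w j v
      rw [hw] at h1
      rw [← L.partsTrunc_jetHom k s j.1 v]
      exact h1
    rw [hm0, map_zero]
  zero i m := by
    obtain ⟨u, rfl⟩ := Submodule.Quotient.mk_surjective
      (LinearMap.range ((dualMap (cokerProj (jetHom k L s))).app i)) m
    revert u
    intro (u : (L.principalParts k).dualSections i)
    refine Subtype.ext (funext fun j => LinearMap.ext fun z => ?_)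
    have h : (L.partsTrunc k).app j.1 ((pullToParts p L k).app j.1 z) = 0 :=
      jetTrunc_symToJet (A := B.A j.1) (M := L.M j.1) k ((pullbackToSym p L k).app j.1 z)
    exact (congrArg (u.1 j) h).trans (map_zero _)
  exact i m hm x hx := by
    obtain ⟨j, hj, hxj, ⟨c⟩⟩ := H.exists_chart i x hx
    refine ⟨j, hj, hxj, ?_⟩
    have hm' : (H.quotientToDual hr).app j
        ((coker (dualMap (cokerProj (jetHom (k + 1) L s)))).res hj m) = 0 := by
      rw [(H.quotientToDual hr).naturality, hm, map_zero]
    generalize (coker (dualMap (cokerProj (jetHom (k + 1) L s)))).res hj m = m' at hm' ⊢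
    obtain ⟨v, rfl⟩ := Submodule.Quotient.mk_surjective
      (LinearMap.range ((dualMap (cokerProj (jetHom (k + 1) L s))).app j)) m'
    revert v
    intro (v : (L.principalParts (k + 1)).dualSections j) hm'
    have := finite_expLE (σ := σ) k
    have := Fintype.ofFinite (ExpLE σ k)
    have G := c.isGenericSpan_mon H hr
    have hb := c.isHBasis_mon H.smooth H.smooth' k
    -- w has the values of v on the monomials of degree at most k.
    let w : (L.principalParts k).dualSections j :=
      ∑ α : ExpLE σ k, v.1 ⟨j, le_rfl⟩ (c.mon (k + 1) ⟨α.1, α.2.trans (Nat.le_succ k)⟩) •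
        hb.coord (id α)
    have hw : ∀ α : ExpLE σ k, w.1 ⟨j, le_rfl⟩ (c.mon k α) =
        v.1 ⟨j, le_rfl⟩ (c.mon (k + 1) ⟨α.1, α.2.trans (Nat.le_succ k)⟩) := fun α =>
      hb.sum_coord_apply_self Function.injective_id
        (fun α => v.1 ⟨j, le_rfl⟩ (c.mon (k + 1) ⟨α.1, α.2.trans (Nat.le_succ k)⟩)) α
    let w' : (L.principalParts (k + 1)).dualSections j := (dualMap (L.partsTrunc k)).app j w
    refine ⟨Submodule.Quotient.mk
      (p := LinearMap.range ((dualMap (cokerProj (jetHom k L s))).app j)) w, ?_⟩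
    refine (Submodule.Quotient.eq
      (LinearMap.range ((dualMap (cokerProj (jetHom (k + 1) L s))).app j)) (x := w') (y := v)).2 ?_
    refine exists_dualMap_cokerProj_eq (w' - v) (G.apply_app_eq_zero fun α hα => ?_)
    have hsub : (w' - v).1 ⟨j, le_rfl⟩ (c.mon (k + 1) α) =
        w'.1 ⟨j, le_rfl⟩ (c.mon (k + 1) α) - v.1 ⟨j, le_rfl⟩ (c.mon (k + 1) α) := rfl
    rw [hsub, sub_eq_zero]
    -- It suffices to compare on distinguished monomials. In degree at most k the values agree by
    -- the choice of w; in degree k + 1 the truncation is zero, and v vanishes because the monomial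
    -- comes from (π^*Ω)^k ⊗ Ω ⊗ L.
    by_cases h : α.1.degree ≤ k
    · exact hw ⟨α.1, h⟩
    · have h1 : w'.1 ⟨j, le_rfl⟩ (c.mon (k + 1) α) = 0 :=
        (congrArg (w.1 ⟨j, le_rfl⟩) (jetMon_eq_zero c.x c.e (not_le.1 h))).trans (map_zero _)
      obtain ⟨a, ha⟩ := exists_eq_scrollExp o k (le_antisymm α.2 (not_le.1 h)) hα
      have h2 := congrArg (fun z : (((((cotangent B').pullback p).pow k).tensor
        (cotangent B)).tensor L).dualSections j => z.1 ⟨j, le_rfl⟩ (c.pullElt k a)) hm'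
      have h3 := congrArg (v.1 ⟨j, le_rfl⟩) (c.pullToParts_pullElt k a)
      have h4 : (⟨scrollExp o k a, (degree_scrollExp o k a).le⟩ : ExpLE σ (k + 1)) = α :=
        Subtype.ext ha
      rw [h4] at h3
      rw [h1, ← h3]
      exact h2.symm
  surjective i m x hx := by
    obtain ⟨j, hj, hxj, ⟨c⟩⟩ := H.exists_chart i x hx
    refine ⟨j, hj, hxj, ?_⟩
    generalize (((((cotangent B').pullback p).pow k).tensor (cotangent B)).tensor L).dual.res hj m
      = m'
    revert m'
    intro (m' : (((((cotangent B').pullback p).pow k).tensor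
      (cotangent B)).tensor L).dualSections j)
    have G := c.isGenericSpan_mon H hr
    let g (a : σ) : ExpLE σ (k + 1) := ⟨scrollExp o k a, (degree_scrollExp o k a).le⟩
    have hg : Function.Injective g := fun a b h =>
      scrollExp_injective o k (congrArg (fun z : ExpLE σ (k + 1) => z.1) h)
    -- The given functional, transported to the distinguished monomials of degree k + 1 and extended
    -- by zero.
    let v : (L.principalParts (k + 1)).dualSections j :=
      ∑ a, m'.1 ⟨j, le_rfl⟩ (c.pullElt k a) • G.isHBasis.coord (g a)
    refine ⟨Submodule.Quotient.mk
      (p := LinearMap.range ((dualMap (cokerProj (jetHom (k + 1) L s))).app j)) v,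
      (c.isHBasis_pullElt H.smooth H.smooth' k).dual_ext fun a => ?_⟩
    refine Eq.trans ?_ (G.isHBasis.sum_coord_apply_self hg
      (fun a => m'.1 ⟨j, le_rfl⟩ (c.pullElt k a)) a)
    exact congrArg (v.1 ⟨j, le_rfl⟩) (c.pullToParts_pullElt k a)

end

end

section

open PMod

/-! ### The sheaves of a base of charts of a scroll -/

theorem PMod.IsShortExact.comp_bijective {B : AlgBase} {F G H K : PMod B} {f : Hom F G}
    {g : Hom G H} (h : IsShortExact f g) (e : Hom H K)
    (he : ∀ i, Function.Bijective (e.app i)) : IsShortExact f (e.comp g) where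
  injective := h.injective
  zero i z := (congrArg (e.app i) (h.zero i z)).trans (map_zero _)
  exact i t ht := h.exact i t ((he i).1 (ht.trans (map_zero _).symm))
  surjective i u x hx := by
    obtain ⟨u, rfl⟩ := (he i).2 u
    obtain ⟨j, hj, hxj, t, ht⟩ := h.surjective i u x hx
    exact ⟨j, hj, hxj, t, (congrArg (e.app j) ht).trans (e.naturality hj u)⟩

theorem natCard_not {ι : Type} [Finite ι] (S : ι → Prop) :
    Nat.card {a // ¬ S a} = Nat.card ι - Nat.card {a // S a} := by
  classical
  rw [← Nat.card_congr (Equiv.sumCompl S), Nat.card_sum, Nat.add_sub_cancel_left]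

variable {B B' : AlgBase} {p : BaseHom B B'} {L : PMod B} {r : ℕ} {s : Fin r → L.GlobalSection}
  {σ : Type} [Fintype σ] {o : σ}

theorem IsScrollBase.isLocallyFree (H : IsScrollBase p L s o) {F : PMod B} {m : ℕ}
    (h : ∀ {j : B.I}, ScrollChart p L s o j → ∃ (ι : Type) (b : ι → F.M j),
      F.IsHBasis b ∧ Nat.card ι = m ∧ Finite ι) : F.IsLocallyFree m :=
  isLocallyFree_of_isHBasis fun x => by
    obtain ⟨i, hi⟩ := H.exists_mem x
    obtain ⟨j, -, hxj, ⟨c⟩⟩ := H.exists_chart i x hi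
    exact ⟨j, hxj, h c⟩

variable (p L) in
/-- The pairing of `(π^* Ω)^{⊗ k} ⊗ Ω ⊗ L` with `(π^* T)^{⊗ k} ⊗ T ⊗ L^∨`. -/
def pullPairing (k : ℕ) :
    Pairing (((((cotangent B').pullback p).pow k).tensor (cotangent B)).tensor L)
      (((((cotangent B').dual.pullback p).pow k).tensor (cotangent B).dual).tensor L.dual) :=
  (((((cotangent B').dualPairing.pullback p).pow k).tensor (cotangent B).dualPairing).tensor
    L.dualPairing)

/-- L has a generator on every member of the base, while the two cotangent sheaves contribute dual
systems obtained from projectivity; tensor products and inverse images preserve perfectness. -/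
theorem IsScrollBase.pullPairing_isPerfect (H : IsScrollBase p L s o) (k : ℕ) :
    (pullPairing p L k).IsPerfect := by
  refine (((H.smooth'.cotangent_isPerfect.pullback p).pow k).tensor
    H.smooth.cotangent_isPerfect).tensor (dualPairing_isPerfect_of_isHBasis fun i => ?_)
  obtain ⟨e, he⟩ := H.exists_generator i
  exact ⟨Unit, inferInstance, fun _ => e, he⟩

/-- M is the cokernel of (π^*Ω)^k ⊗ Ω ⊗ L → S^(k+1) Ω ⊗ L. The ranks are numbers of monomials, and
the perfect pairing replaces the dual of the tensor product by the tensor product of the duals. -/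
theorem IsScrollBase.main [DecidableEq σ] (H : IsScrollBase p L s o) {n : ℕ} (hn : Fintype.card σ = n) {k : ℕ}
    (hr : HasGenericRank (jetHom (k + 1) L s) ((k + 1) * n + 1)) :
    (coker (jetHom (k + 1) L s)).dual.IsLocallyFree
      ((n + (k + 1)).choose n - ((k + 1) * n + 1)) ∧
    (∃ M : PMod B, M.IsLocallyFree ((n + (k + 1) - 1).choose (n - 1) - n) ∧
      (∃ (f : Hom (coker (jetHom k L s)).dual (coker (jetHom (k + 1) L s)).dual)
        (g : Hom (coker (jetHom (k + 1) L s)).dual M.dual), IsShortExact f g) ∧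
      (∃ (f : Hom (((((cotangent B').pullback p).pow k).tensor (cotangent B)).tensor L)
          (((cotangent B).sym (k + 1)).tensor L))
        (g : Hom (((cotangent B).sym (k + 1)).tensor L) M), IsShortExact f g)) ∧
    (coker (dualMap (cokerProj (jetHom (k + 1) L s)))).IsLocallyFree ((k + 1) * n + 1) ∧
    (∃ (f : Hom (coker (dualMap (cokerProj (jetHom k L s))))
        (coker (dualMap (cokerProj (jetHom (k + 1) L s)))))
      (g : Hom (coker (dualMap (cokerProj (jetHom (k + 1) L s))))
        (((((cotangent B').dual.pullback p).pow k).tensor (cotangent B).dual).tensor L.dual)),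
      IsShortExact f g) := by
  subst hn
  have := finite_expLE (σ := σ) (k + 1)
  have := finite_expEq (σ := σ) (k + 1)
  have hσ : 0 < Fintype.card σ := Fintype.card_pos_iff.2 ⟨o⟩
  refine ⟨H.isLocallyFree fun c => ⟨_, _, (c.isGenericSpan_mon H hr).isHBasis_cokerCoord, ?_,
      inferInstance⟩, ⟨coker (pullbackToSym p L k), H.isLocallyFree fun c =>
      ⟨_, _, c.isHBasis_cokerElt H.smooth H.smooth' k, ?_, inferInstance⟩,
      ⟨_, _, H.isShortExact_dualCoker hr⟩, ⟨_, _, H.isShortExact_pullbackToSym⟩⟩,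
    H.isLocallyFree fun c => ⟨_, _, (c.isGenericSpan_mon H hr).isHBasis_coordClass,
      card_scrollExpLE o (k + 1), inferInstance⟩,
    ⟨_, _, (H.isShortExact_quotient hr).comp_bijective
      ((pullPairing p L k).ofDual (H.pullPairing_isPerfect k)) fun i =>
        ⟨(pullPairing p L k).ofDual_injective _ i, (pullPairing p L k).ofDual_surjective _ i⟩⟩⟩
  · rw [natCard_not, card_expLE, card_scrollExpLE]
  -- Among the monomials of degree k + 1 exactly n are distinguished. The symmetry of the binomial
  -- coefficient needs n > 0, which holds since o is an index.
  · rw [natCard_not, card_expEq, ← Nat.card_congr (scrollExpEquiv o k), Nat.card_eq_fintype_card]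
    congr 1
    exact Nat.choose_symm_of_eq_add (by omega)

end

section

attribute [local instance] MvPolynomial.gradedAlgebra

/-! ### Smooth schemes -/

theorem smooth_structureHom {T : Scheme.{0}} (f : T ⟶ Spec (.of ℂ)) [Smooth f]
    (U : T.affineOpens) : (structureHom f U.1).Smooth := by
  have h1 : ((Scheme.ΓSpecIso (.of ℂ)).inv.hom).Smooth :=
    RingHom.Smooth.of_bijective (ConcreteCategory.bijective_of_isIso (Scheme.ΓSpecIso (.of ℂ)).inv)
  exact h1.comp (Smooth.smooth_appLE f (isAffineOpen_top _) U.2 (le_preimage_top f U.1))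

/-- Restriction is the homomorphism induced by the identity of T on the affine open sets V ≤ U, and
the identity is étale. -/
theorem etale_rs {T : Scheme.{0}} {U V : T.affineOpens} (h : V.1 ≤ U.1) :
    (rs h : Γ(T, U.1) →+* Γ(T, V.1)).Etale := by
  have h1 := HasRingHomProperty.appLE @Etale (𝟙 T) inferInstance U V h
  have h2 : (𝟙 T : T ⟶ T).appLE U.1 V.1 h = T.presheaf.map (homOfLE h).op := by
    simp only [Scheme.Hom.appLE, Scheme.Hom.id_app]
    exact Category.id_comp _
  rw [h2] at h1
  exact h1

theorem isSmooth_affineBase {T : Scheme.{0}} (f : T ⟶ Spec (.of ℂ)) [Smooth f] :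
    (affineBase f).IsSmooth where
  formallySmooth U := (smooth_structureHom f U).formallySmooth
  finiteType U := by
    have := (smooth_structureHom f U).finitePresentation
    let _ : Algebra ℂ Γ(T, U.1) := (structureHom f U.1).toAlgebra
    have : Algebra.FinitePresentation ℂ Γ(T, U.1) := this
    exact (inferInstance : Algebra.FiniteType ℂ Γ(T, U.1))
  formallyEtale {U V} h := by
    let _ : Algebra Γ(T, V.1) Γ(T, U.1) := (rs h).toAlgebra
    have : Algebra.Etale Γ(T, V.1) Γ(T, U.1) := etale_rs h
    exact (inferInstance : Algebra.FormallyEtale Γ(T, V.1) Γ(T, U.1))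

theorem AlgBase.IsSmooth.reindex {B : AlgBase} (hB : B.IsSmooth) {J : Type} [Preorder J]
    (g : J → B.I) (hg : Monotone g) : (B.reindex g hg).IsSmooth where
  formallySmooth j := hB.formallySmooth (g j)
  finiteType j := hB.finiteType (g j)
  formallyEtale h := hB.formallyEtale (hg h)

theorem rs_injective {T : Scheme.{0}} [IsIntegral T] {U V : T.Opens} (h : V ≤ U)
    (hV : (V : Set T).Nonempty) : Function.Injective (rs h) :=
  have : Nonempty V := hV.to_subtype
  map_injective_of_isIntegral T (homOfLE h)

theorem subsingleton_of_not_nonempty {T : Scheme.{0}} {U : T.Opens}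
    (hU : ¬ (U : Set T).Nonempty) : Subsingleton Γ(T, U) := by
  have : U = ⊥ := by
    ext x
    simpa using fun hx => hU ⟨x, hx⟩
  rw [this]
  infer_instance

/-! ### The twisting sheaf -/

theorem PP.ratio_self {m : ℕ} (a : Fin m) : PP.ratio a a = 1 := by
  have h : HomogeneousLocalization.Away.mk (grading m) (d := 1) (MvPolynomial.isHomogeneous_X ℂ a) 1
      (MvPolynomial.X a) (MvPolynomial.isHomogeneous_X ℂ a) = 1 := by
    apply HomogeneousLocalization.val_injective
    have key : ∀ (y : MvPolynomial (Fin m) ℂ)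
        (s : Submonoid.powers (MvPolynomial.X a : MvPolynomial (Fin m) ℂ)),
        y = s.1 → Localization.mk y s = 1 := by
      rintro _ s rfl
      exact Localization.mk_self s
    exact ((HomogeneousLocalization.Away.val_mk (grading m) 1 _ _ _).trans
      (key _ _ (pow_one _).symm)).trans HomogeneousLocalization.val_one.symm
  exact (congrArg (Proj.awayToSection (grading m) (MvPolynomial.X a)).hom h).trans (map_one _)

theorem PP.iSup_chart (m : ℕ) : ⨆ a : Fin m, PP.chart a = ⊤ := by
  refine Proj.iSup_basicOpen_eq_top' (grading m) (fun a : Fin m => MvPolynomial.X a)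
    (fun a => ⟨1, MvPolynomial.isHomogeneous_X ℂ a⟩) ?_
  rw [eq_top_iff]
  intro p _
  induction p using MvPolynomial.induction_on with
  | C r =>
    have := Subalgebra.algebraMap_mem (Algebra.adjoin (grading m 0)
      (Set.range fun a : Fin m => (MvPolynomial.X a : MvPolynomial (Fin m) ℂ)))
      (⟨MvPolynomial.C r, MvPolynomial.isHomogeneous_C _ r⟩ : grading m 0)
    exact this
  | add p q hp hq => exact add_mem (hp trivial) (hq trivial)
  | mul_X p a hp => exact mul_mem (hp trivial) (Algebra.subset_adjoin ⟨a, rfl⟩)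

theorem exists_mem_stdOpen {T : Scheme.{0}} {m : ℕ} (f : T ⟶ PP m) (x : T) :
    ∃ a, x ∈ stdOpen f a := by
  have h : f x ∈ ⨆ a : Fin m, PP.chart a := by
    rw [PP.iSup_chart]
    trivial
  obtain ⟨a, ha⟩ := Opens.mem_iSup.1 h
  exact ⟨a, ha⟩

theorem ratio_self {T : Scheme.{0}} {m : ℕ} (f : T ⟶ PP m) (a : Fin m) : ratio f a a = 1 :=
  (congrArg (f.app (PP.chart a)).hom (PP.ratio_self a)).trans (map_one _)

/-- The section `x_l` of `f^* O(1)` over an open set. -/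
def coordElt {T : Scheme.{0}} {m : ℕ} (f : T ⟶ PP m) (U : T.Opens) (l : Fin m) :
    twistSections f U :=
  ⟨fun i => rs inf_le_right (ratio f i l), fun i j V hi hj => by
    simp only [rs_rs]
    exact ratio_mul f i j l _ _⟩

/-- A section of `f^* O(1)` over a part of the open set `x_a ≠ 0` is a multiple of `x_a`. -/
theorem twist_eq_smul {T : Scheme.{0}} {m : ℕ} (f : T ⟶ PP m) {a : Fin m} {U : T.Opens}
    (hU : U ≤ stdOpen f a) (t : twistSections f U) :
    t = rs (le_inf le_rfl hU) (t.1 a) • coordElt f U a := by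
  refine Subtype.ext (funext fun b => ?_)
  change t.1 b = rs inf_le_left (rs (le_inf le_rfl hU) (t.1 a)) * rs inf_le_right (ratio f b a)
  have h := t.2 b a (U ⊓ stdOpen f b) le_rfl (le_inf inf_le_left (inf_le_left.trans hU))
  rw [rs_refl] at h
  rw [h, rs_rs, mul_comm]

theorem smul_coordElt_apply {T : Scheme.{0}} {m : ℕ} (f : T ⟶ PP m) {a : Fin m} {U : T.Opens}
    (hU : U ≤ stdOpen f a) (c : Γ(T, U)) (l : Fin m) :
    rs (le_inf le_rfl hU) ((c • coordElt f U l).1 a) = c * rs hU (ratio f a l) := by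
  change rs _ (rs inf_le_left c * rs inf_le_right (ratio f a l)) = _
  rw [map_mul, rs_rs, rs_rs, rs_refl]

theorem isBasis_coordElt {T : Scheme.{0}} {m : ℕ} (f : T ⟶ PP m) {a : Fin m} {U : T.Opens}
    (hU : U ≤ stdOpen f a) : IsBasis Γ(T, U) fun _ : Unit => coordElt f U a := by
  constructor
  · rw [Fintype.linearIndependent_iff]
    intro c hc _
    simp only [Finset.univ_unique, Finset.sum_singleton] at hc
    have h := smul_coordElt_apply f hU (c default) a
    rw [hc, ratio_self, map_one, mul_one] at h
    rw [show c _ = c default from rfl, ← h]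
    exact map_zero _
  · refine Submodule.eq_top_iff'.2 fun t => ?_
    rw [twist_eq_smul f hU t]
    exact Submodule.smul_mem _ _ (Submodule.subset_span ⟨(), rfl⟩)

/-! ### The base of charts -/

section Charts

variable {X C : Scheme.{0}} (pX : X ⟶ Spec (.of ℂ)) {N : ℕ}
  (i : X ⟶ PP (N + 1)) (π : X ⟶ C)

theorem isHBasis_hyperplaneBundle (c : Chart i π) {l : Fin (N + 1)} (hl : c.U.1 ≤ stdOpen i l) :
    (hyperplaneBundle pX i π).IsHBasis fun _ : Unit =>
      ((coordSection i pX l).reindex _ (Chart.mono i π)).1 c := by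
  intro d h
  have e : (fun _ : Unit => (hyperplaneBundle pX i π).res h
      (((coordSection i pX l).reindex _ (Chart.mono i π)).1 c)) =
      fun _ : Unit => ((coordSection i pX l).reindex _ (Chart.mono i π)).1 d :=
    funext fun _ => ((coordSection i pX l).reindex _ (Chart.mono i π)).2 h
  rw [e]
  exact isBasis_coordElt i (U := d.U.1) (le_trans h.1 hl)

theorem exists_affineOpens_mem {T : Scheme.{0}} {x : T} {U : T.Opens} (hx : x ∈ U) :
    ∃ V : T.affineOpens, x ∈ V.1 ∧ V.1 ≤ U := by
  obtain ⟨_, ⟨V, hV, rfl⟩, hxV, hVU⟩ :=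
    T.isBasis_affineOpens.exists_subset_of_mem_open hx U.isOpen
  exact ⟨⟨V, hV⟩, hxV, hVU⟩

theorem exists_chart_mem (x : X) : ∃ c : Chart i π, x ∈ c.U.1 := by
  obtain ⟨l, hl⟩ := exists_mem_stdOpen i x
  obtain ⟨W, hW, -⟩ := exists_affineOpens_mem (T := C) (x := π x) (U := ⊤) trivial
  obtain ⟨U, hU, hle⟩ := exists_affineOpens_mem (x := x) (U := π ⁻¹ᵁ W.1 ⊓ stdOpen i l) ⟨hW, hl⟩
  exact ⟨⟨U, W, hle.trans inf_le_left, l, hle.trans inf_le_right⟩, hU⟩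

end Charts

end

section

attribute [local instance] MvPolynomial.gradedAlgebra

/-! ### Functions on the standard open sets of a projective space -/

section Away

variable {m : ℕ} (a : Fin m)

/-- The ring of functions of degree zero with powers of `x_a` as denominators. -/
abbrev AwayRing : Type := HomogeneousLocalization.Away (grading m) (MvPolynomial.X a)

/-- The constants. -/
def awayConst : ℂ →+* AwayRing a :=
  (HomogeneousLocalization.fromZeroRingHom (grading m) _).comp (algebraMap ℂ (grading m 0))

/-- The function `x_b / x_a`. -/
def awayVar (b : Fin m) : AwayRing a :=
  HomogeneousLocalization.Away.mk (grading m) (d := 1) (MvPolynomial.isHomogeneous_X ℂ a) 1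
    (MvPolynomial.X b) (MvPolynomial.isHomogeneous_X ℂ b)

/-- The homomorphism from the polynomial ring in the functions `x_b / x_a`. -/
def polyToAway : MvPolynomial {b // b ≠ a} ℂ →+* AwayRing a :=
  MvPolynomial.eval₂Hom (awayConst a) fun b => awayVar a b.1

/-- Substitution of `1` for `x_a`. -/
def dehom : MvPolynomial (Fin m) ℂ →+* MvPolynomial {b // b ≠ a} ℂ :=
  MvPolynomial.eval₂Hom MvPolynomial.C fun b => if h : b = a then 1 else MvPolynomial.X ⟨b, h⟩

/-- The inclusion into the ring of all fractions. -/
def awayVal : AwayRing a →+* Localization.Away (MvPolynomial.X a : MvPolynomial (Fin m) ℂ) :=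
  algebraMap _ _

theorem awayVal_injective : Function.Injective (awayVal a) :=
  HomogeneousLocalization.val_injective _

theorem awayVal_const (r : ℂ) : awayVal a (awayConst a r) =
    algebraMap (MvPolynomial (Fin m) ℂ) _ (MvPolynomial.C r) := by
  change Localization.mk _ _ = _
  rw [← Localization.mk_one_eq_algebraMap]
  rfl

theorem awayVal_mk (n : ℕ) (p : MvPolynomial (Fin m) ℂ) (hp : p ∈ grading m (n • 1)) :
    awayVal a (HomogeneousLocalization.Away.mk (grading m) (d := 1)
      (MvPolynomial.isHomogeneous_X ℂ a) n p hp) *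
      algebraMap (MvPolynomial (Fin m) ℂ) _ (MvPolynomial.X a) ^ n =
        algebraMap (MvPolynomial (Fin m) ℂ) _ p := by
  rw [← map_pow]
  have key : ∀ s : Submonoid.powers (MvPolynomial.X a : MvPolynomial (Fin m) ℂ),
      Localization.mk p s * algebraMap (MvPolynomial (Fin m) ℂ) _ s.1 =
        algebraMap (MvPolynomial (Fin m) ℂ) _ p := fun s => by
    rw [Localization.mk_eq_mk']
    exact IsLocalization.mk'_spec _ p s
  exact (congrArg (fun z => z * _) (HomogeneousLocalization.Away.val_mk (grading m) n
    (MvPolynomial.isHomogeneous_X ℂ a) p hp)).trans (key _)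

theorem awayVal_var (b : Fin m) : awayVal a (awayVar a b) *
    algebraMap (MvPolynomial (Fin m) ℂ) _ (MvPolynomial.X a) =
      algebraMap (MvPolynomial (Fin m) ℂ) _ (MvPolynomial.X b) := by
  have := awayVal_mk a 1 (MvPolynomial.X b) (MvPolynomial.isHomogeneous_X ℂ b)
  rwa [pow_one] at this

/-- Substituting 1 for x_a extends to the localization and is a left inverse. -/
theorem polyToAway_injective : Function.Injective (polyToAway a) := by
  have hunit : IsUnit (dehom a (MvPolynomial.X a)) := by simp [dehom]
  let ψ : Localization.Away (MvPolynomial.X a : MvPolynomial (Fin m) ℂ) →+*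
      MvPolynomial {b // b ≠ a} ℂ := IsLocalization.Away.lift (MvPolynomial.X a) hunit
  have hψ : ∀ p, ψ (algebraMap _ _ p) = dehom a p := IsLocalization.Away.lift_eq _ hunit
  have hid : (ψ.comp (awayVal a)).comp (polyToAway a) = RingHom.id _ := by
    refine MvPolynomial.ringHom_ext (fun r => ?_) fun b => ?_
    · simp [polyToAway, awayVal_const, hψ, dehom]
    · have h := congrArg ψ (awayVal_var a b.1)
      rw [map_mul, hψ, hψ] at h
      simpa [polyToAway, dehom, b.2] using h
  intro p q h
  have h' := congrArg (ψ.comp (awayVal a)) h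
  rwa [← RingHom.comp_apply, ← RingHom.comp_apply, hid] at h'

/-- Homogeneity is what matters: in each monomial of degree n the factor x_a^n is distributed over
the n quotients x_b/x_a. Surjectivity follows, as a fraction p/x_a^n is the image of the
dehomogenization of p. -/
theorem polyToAway_dehom (n : ℕ) (p : MvPolynomial (Fin m) ℂ) (hp : p.IsHomogeneous n) :
    awayVal a (polyToAway a (dehom a p)) *
      algebraMap (MvPolynomial (Fin m) ℂ) _ (MvPolynomial.X a) ^ n =
        algebraMap (MvPolynomial (Fin m) ℂ) _ p := by
  have hcomp : ((awayVal a).comp (polyToAway a)).comp (dehom a) =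
      MvPolynomial.eval₂Hom ((algebraMap (MvPolynomial (Fin m) ℂ) _).comp MvPolynomial.C)
        fun b => awayVal a (awayVar a b) := by
    refine MvPolynomial.ringHom_ext (fun r => ?_) fun b => ?_
    · simp [polyToAway, awayVal_const, dehom]
    · by_cases h : b = a
      · subst h
        have : awayVar b b = 1 := by
          have h1 := awayVal_var b b
          have hu : IsUnit (algebraMap (MvPolynomial (Fin m) ℂ)
              (Localization.Away (MvPolynomial.X b : MvPolynomial (Fin m) ℂ)) (MvPolynomial.X b)) :=
            IsLocalization.Away.algebraMap_isUnit _
          refine awayVal_injective b (hu.mul_right_cancel ?_)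
          rw [h1, map_one, one_mul]
        simp [dehom, this]
      · simp [polyToAway, dehom, h]
  have h := congrArg (fun φ => φ p) hcomp
  simp only [RingHom.comp_apply] at h
  rw [h]
  change MvPolynomial.eval₂ _ _ p * _ = _
  rw [MvPolynomial.eval₂_eq']
  conv_rhs => rw [p.as_sum, map_sum]
  rw [Finset.sum_mul]
  refine Finset.sum_congr rfl fun α hα => ?_
  have hdeg : ∑ i, α i = n := by
    rw [← Finsupp.degree_eq_sum]
    exact (MvPolynomial.IsHomogeneous.coeff_eq_zero hp).mt (MvPolynomial.mem_support_iff.1 hα)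
      |> not_not.1
  rw [MvPolynomial.monomial_eq, map_mul, mul_assoc]
  congr 1
  rw [← hdeg, ← Finset.prod_pow_eq_pow_sum, ← Finset.prod_mul_distrib, Finsupp.prod_fintype _ _
    (fun _ => pow_zero _), map_prod]
  refine Finset.prod_congr rfl fun b _ => ?_
  rw [← mul_pow, awayVal_var, map_pow]

theorem polyToAway_surjective : Function.Surjective (polyToAway a) := by
  intro z
  obtain ⟨n, p, hp, rfl⟩ := HomogeneousLocalization.Away.mk_surjective (grading m)
    (d := 1) (MvPolynomial.isHomogeneous_X ℂ a) z
  have hp' : p.IsHomogeneous n := by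
    have := hp
    rwa [smul_eq_mul, mul_one] at this
  have hu : IsUnit (algebraMap (MvPolynomial (Fin m) ℂ)
      (Localization.Away (MvPolynomial.X a : MvPolynomial (Fin m) ℂ)) (MvPolynomial.X a) ^ n) :=
    (IsLocalization.Away.algebraMap_isUnit _).pow n
  refine ⟨dehom a p, awayVal_injective a (hu.mul_right_cancel ?_)⟩
  rw [polyToAway_dehom a n p hp']
  exact (awayVal_mk a n p hp).symm

theorem isAffineOpen_chart : IsAffineOpen (PP.chart a) :=
  Proj.isAffineOpen_basicOpen (grading m) (MvPolynomial.X a) (MvPolynomial.isHomogeneous_X ℂ a)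
    Nat.one_pos

theorem awayToSection_bijective :
    Function.Bijective (Proj.awayToSection (grading m) (MvPolynomial.X a)).hom :=
  ConcreteCategory.bijective_of_isIso (Proj.basicOpenIsoAway (grading m) (MvPolynomial.X a)
    (MvPolynomial.isHomogeneous_X ℂ a) Nat.one_pos).hom

theorem appLE_top_eq {T S : Scheme.{0}} (f : T ⟶ S) (U : T.Opens) :
    f.appLE ⊤ U (le_preimage_top f U) = (U.ι ≫ f).appTop ≫ U.topIso.hom := by
  rw [Scheme.Hom.comp_appTop, Category.assoc, Scheme.Opens.ι_appTop, Scheme.Opens.topIso_hom]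
  exact congrArg (f.app ⊤ ≫ ·) (T.presheaf.map_comp (homOfLE _).op (eqToHom _).op)

theorem awayι_comp_toSpec : Proj.awayι (grading m) (MvPolynomial.X a)
      (MvPolynomial.isHomogeneous_X ℂ a) Nat.one_pos ≫ PP.toSpec m =
    Spec.map (CommRingCat.ofHom (awayConst a)) := by
  have h := Proj.awayι_toSpecZero (grading m) (MvPolynomial.X a)
    (MvPolynomial.isHomogeneous_X ℂ a) Nat.one_pos
  have h' : CommRingCat.ofHom (awayConst a) = CommRingCat.ofHom (algebraMap ℂ (grading m 0)) ≫
    CommRingCat.ofHom (HomogeneousLocalization.fromZeroRingHom (grading m) _) := rfl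
  refine (Category.assoc _ _ _).symm.trans ((congrArg (· ≫ _) h).trans ?_)
  rw [h', Spec.map_comp]

theorem basicOpen_ι_comp_toSpec :
    (Proj.basicOpen (grading m) (MvPolynomial.X a)).ι ≫ PP.toSpec m =
      Proj.basicOpenToSpec (grading m) (MvPolynomial.X a) ≫
        Spec.map (CommRingCat.ofHom (awayConst a)) := by
  have h1 := Proj.basicOpenIsoSpec_inv_ι (grading m) (MvPolynomial.X a)
    (MvPolynomial.isHomogeneous_X ℂ a) Nat.one_pos
  have h2 := Proj.basicOpenIsoSpec_hom (grading m) (MvPolynomial.X a)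
    (MvPolynomial.isHomogeneous_X ℂ a) Nat.one_pos
  rw [← awayι_comp_toSpec, ← h2, ← h1, Category.assoc, Iso.hom_inv_id_assoc]

/-- The constants defined through the structure morphism and those of the homogeneous localization
agree. This permits the comparison of `chartPoly` with the algebraic description `polyToAway`. -/
theorem structureHom_chart :
    structureHom (PP.toSpec m) (PP.chart a) =
      (Proj.awayToSection (grading m) (MvPolynomial.X a)).hom.comp (awayConst a) := by
  have h3 : (Scheme.ΓSpecIso (.of ℂ)).inv ≫ (PP.toSpec m).appLE ⊤
      (Proj.basicOpen (grading m) (MvPolynomial.X a)) (le_preimage_top _ _) =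
        CommRingCat.ofHom (awayConst a) ≫ Proj.awayToSection (grading m) (MvPolynomial.X a) := by
    rw [appLE_top_eq, basicOpen_ι_comp_toSpec, Scheme.Hom.comp_appTop, Category.assoc,
      ← Scheme.ΓSpecIso_inv_naturality_assoc]
    refine congrArg (CommRingCat.ofHom (awayConst a) ≫ ·) ?_
    rw [Iso.inv_comp_eq, ← Iso.eq_comp_inv, Category.assoc]
    exact Proj.basicOpenToSpec_app_top (grading m) (MvPolynomial.X a)
  exact congrArg CommRingCat.Hom.hom h3

/-- The homomorphism from the polynomial ring to the functions on the open set `x_a ≠ 0`. -/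
def chartPoly : MvPolynomial {b // b ≠ a} ℂ →+* Γ(PP m, PP.chart a) :=
  MvPolynomial.eval₂Hom (structureHom (PP.toSpec m) (PP.chart a)) fun b => PP.ratio a b.1

theorem polyToAway_C (r : ℂ) : polyToAway a (MvPolynomial.C r) = awayConst a r :=
  MvPolynomial.eval₂Hom_C _ _ r

theorem polyToAway_X (b : {b // b ≠ a}) : polyToAway a (MvPolynomial.X b) = awayVar a b.1 :=
  MvPolynomial.eval₂Hom_X' _ _ b

theorem chartPoly_C (r : ℂ) :
    chartPoly a (MvPolynomial.C r) = structureHom (PP.toSpec m) (PP.chart a) r :=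
  MvPolynomial.eval₂Hom_C _ _ r

theorem chartPoly_X (b : {b // b ≠ a}) : chartPoly a (MvPolynomial.X b) = PP.ratio a b.1 :=
  MvPolynomial.eval₂Hom_X' _ _ b

theorem awayToSection_polyToAway (p : MvPolynomial {b // b ≠ a} ℂ) :
    (Proj.awayToSection (grading m) (MvPolynomial.X a)).hom (polyToAway a p) = chartPoly a p := by
  induction p using MvPolynomial.induction_on with
  | C r =>
    rw [chartPoly_C, polyToAway_C]
    exact (DFunLike.congr_fun (structureHom_chart a) r).symm
  | add p q hp hq => rw [map_add, map_add, map_add, hp, hq]; rfl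
  | mul_X p b hp =>
    rw [map_mul, map_mul, map_mul, hp, chartPoly_X, polyToAway_X]
    rfl

theorem chartPoly_bijective : Function.Bijective (chartPoly a) := by
  have h := (awayToSection_bijective a).comp
    (⟨polyToAway_injective a, polyToAway_surjective a⟩ : Function.Bijective (polyToAway a))
  exact (funext (awayToSection_polyToAway a) : _ = ⇑(chartPoly a)) ▸ h

end Away

end

section

/-! ### Polynomials in two charts of a projective space -/

section Polynomials

variable {σ τ R A : Type} [CommRing R] [CommRing A]

theorem eq_of_totalDegree_le_one [Fintype σ] (p : MvPolynomial σ R) (hp : p.totalDegree ≤ 1) :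
    p = MvPolynomial.C (p.coeff 0) +
      ∑ c, MvPolynomial.C (p.coeff (Finsupp.single c 1)) * MvPolynomial.X c := by
  classical
  ext α
  simp only [MvPolynomial.coeff_add, MvPolynomial.coeff_sum, MvPolynomial.coeff_C_mul,
    MvPolynomial.coeff_C, MvPolynomial.coeff_X]
  rcases lt_trichotomy α.degree 1 with h | h | h
  · obtain rfl : α = 0 := (Finsupp.degree_eq_zero_iff α).1 (by omega)
    simp
  · obtain ⟨c, rfl⟩ : ∃ c, Finsupp.single c 1 = α := Finsupp.exists_eq_single_of_degree_eq_one h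
    have h0 : (0 : σ →₀ ℕ) ≠ Finsupp.single c 1 := fun h => by
      simpa using (DFunLike.congr_fun h c).symm
    simp [h0, Finsupp.single_left_inj]
  · rw [MvPolynomial.coeff_eq_zero_of_totalDegree_lt (by rw [← Finsupp.degree_apply]; omega)]
    have h0 : (0 : σ →₀ ℕ) ≠ α := by
      rintro rfl
      simp at h
    have h1 : ∀ c : σ, Finsupp.single c 1 ≠ α := by
      rintro c rfl
      simp at h
    simp [h0, h1]

/-- A polynomial in `v` of degree `d` becomes a polynomial in `u` of degree `d` after multiplication
by the `d`-th power of a common denominator `u β` of the `v`. -/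
theorem exists_eval₂_eq_pow_mul (φ : R →+* A) (u : σ → A) (v : τ → A) (β : σ)
    (w : τ → MvPolynomial σ R) (hw : ∀ c, (w c).totalDegree ≤ 1)
    (hwv : ∀ c, MvPolynomial.eval₂ φ u (w c) = u β * v c) (q : MvPolynomial τ R) {d : ℕ}
    (hd : q.totalDegree ≤ d) :
    ∃ p : MvPolynomial σ R, p.totalDegree ≤ d ∧
      MvPolynomial.eval₂ φ u p = u β ^ d * MvPolynomial.eval₂ φ v q := by
  -- Homogenization of q to degree d with the variable β, each v_c being replaced by the linear form
  -- `w c` that represents u_β v_c.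
  refine ⟨∑ α ∈ q.support, MvPolynomial.C (q.coeff α) * (MvPolynomial.X β ^ (d - α.degree) *
    α.prod fun c m => w c ^ m), ?_, ?_⟩
  · refine (MvPolynomial.totalDegree_finsetSum _ _).trans (Finset.sup_le fun α hα => ?_)
    have hα' : α.degree ≤ d := (MvPolynomial.le_totalDegree hα).trans hd
    refine (MvPolynomial.totalDegree_mul _ _).trans ?_
    rw [MvPolynomial.totalDegree_C, zero_add]
    refine (MvPolynomial.totalDegree_mul _ _).trans ?_
    have h1 : (MvPolynomial.X β ^ (d - α.degree) : MvPolynomial σ R).totalDegree ≤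
        d - α.degree := by
      refine (MvPolynomial.totalDegree_pow _ _).trans ?_
      refine (Nat.mul_le_mul_left _ (MvPolynomial.totalDegree_monomial_le _ _)).trans ?_
      simp
    have h2 : (α.prod fun c m => w c ^ m).totalDegree ≤ α.degree := by
      refine (MvPolynomial.totalDegree_finsetProd _ _).trans ?_
      rw [Finsupp.degree_apply]
      refine Finset.sum_le_sum fun c _ => (MvPolynomial.totalDegree_pow _ _).trans ?_
      simpa using Nat.mul_le_mul_left (α c) (hw c)
    omega
  · rw [MvPolynomial.eval₂_eq φ v q, Finset.mul_sum, MvPolynomial.eval₂_sum]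
    refine Finset.sum_congr rfl fun α hα => ?_
    have hα' : α.degree ≤ d := (MvPolynomial.le_totalDegree hα).trans hd
    simp only [MvPolynomial.eval₂_mul, MvPolynomial.eval₂_C, MvPolynomial.eval₂_pow,
      MvPolynomial.eval₂_X, Finsupp.prod, MvPolynomial.eval₂_prod, hwv, mul_pow,
      Finset.prod_mul_distrib, Finset.prod_pow_eq_pow_sum]
    rw [show ∑ i ∈ α.support, α i = α.degree from rfl, ← Nat.sub_add_cancel hα', pow_add]
    simp only [Nat.sub_add_cancel hα']
    ring

/-- Clearing denominators with the power D = deg q of u_β turns the relation into p X_β^D = X_β q'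
with deg q' ≤ D. Over a domain degrees add, so deg p + D ≤ 1 + D. This is the reason why sections of
O(1) are linear. -/
theorem totalDegree_le_one_of_eval₂_eq_mul [IsDomain R] (φ : R →+* A) (u : σ → A) (v : τ → A)
    (β : σ) (w : τ → MvPolynomial σ R) (hw : ∀ c, (w c).totalDegree ≤ 1)
    (hwv : ∀ c, MvPolynomial.eval₂ φ u (w c) = u β * v c)
    (hinj : Function.Injective (MvPolynomial.eval₂Hom φ u)) (p : MvPolynomial σ R)
    (q : MvPolynomial τ R)
    (h : MvPolynomial.eval₂ φ u p = u β * MvPolynomial.eval₂ φ v q) : p.totalDegree ≤ 1 := by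
  obtain ⟨q', hq', he⟩ := exists_eval₂_eq_pow_mul φ u v β w hw hwv q le_rfl
  by_cases hp : p = 0
  · simp [hp]
  have key : p * MvPolynomial.X β ^ q.totalDegree = MvPolynomial.X β * q' := by
    refine hinj ?_
    change MvPolynomial.eval₂ φ u _ = MvPolynomial.eval₂ φ u _
    simp only [MvPolynomial.eval₂_mul, MvPolynomial.eval₂_pow, MvPolynomial.eval₂_X, h, he]
    ring
  have h1 := congrArg MvPolynomial.totalDegree key
  rw [MvPolynomial.totalDegree_mul_of_isDomain hp (pow_ne_zero _ (MvPolynomial.X_ne_zero β)),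
    MvPolynomial.totalDegree_X_pow] at h1
  have h2 := MvPolynomial.totalDegree_mul (MvPolynomial.X β) q'
  rw [MvPolynomial.totalDegree_X] at h2
  omega

end Polynomials

/-! ### Differentials of polynomial algebras -/

/-- By the Leibniz rule the differentials of the coefficients and of the variables generate, and
those of the coefficients are multiples of the image of dt. -/
theorem span_D_of_eval₂Hom_surjective {σ R A : Type} [CommRing R] [CommRing A] [Algebra ℂ R]
    [Algebra ℂ A] (φ : R →ₐ[ℂ] A) (u : σ → A)
    (hsurj : Function.Surjective (MvPolynomial.eval₂Hom (φ : R →+* A) u)) (t : R)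
    (ht : Submodule.span R (Set.range fun _ : Unit => KaehlerDifferential.D ℂ R t) = ⊤)
    (M : Submodule A Ω[A⁄ℂ]) (htM : KaehlerDifferential.D ℂ A (φ t) ∈ M)
    (huM : ∀ c, KaehlerDifferential.D ℂ A (u c) ∈ M) : M = ⊤ := by
  have hφ : ∀ r : R, KaehlerDifferential.D ℂ A (φ r) ∈ M := fun r => by
    have h : KaehlerDifferential.D ℂ R r ∈ Submodule.span R
        (Set.range fun _ : Unit => KaehlerDifferential.D ℂ R t) := by rw [ht]; trivial
    rw [Set.range_const] at h
    obtain ⟨a, ha⟩ := Submodule.mem_span_singleton.1 h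
    rw [← kaehlerMap_D, ← ha, LinearMap.map_smulₛₗ, kaehlerMap_D]
    exact M.smul_mem _ htM
  rw [eq_top_iff, ← KaehlerDifferential.span_range_derivation, Submodule.span_le]
  rintro _ ⟨a, rfl⟩
  obtain ⟨p, rfl⟩ := hsurj a
  induction p using MvPolynomial.induction_on with
  | C r =>
    rw [MvPolynomial.eval₂Hom_C]
    exact hφ r
  | add p q hp hq =>
    rw [map_add, map_add]
    exact M.add_mem hp hq
  | mul_X p c hp =>
    rw [map_mul, MvPolynomial.eval₂Hom_X', Derivation.leibniz]
    exact M.add_mem (M.smul_mem _ (huM c)) (M.smul_mem _ hp)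

/-- If the module of differentials has a basis of one element, then locally the differential of
a function is one. -/
theorem exists_D_eq_smul {A : Type} [CommRing A] [Algebra ℂ A] {ω : Ω[A⁄ℂ]}
    (hω : IsBasis A fun _ : Unit => ω) (I : Ideal A) (hI : I ≠ ⊤) :
    ∃ a f : A, KaehlerDifferential.D ℂ A a = f • ω ∧ f ∉ I := by
  by_contra! hcon
  have hmem : ∀ a : A, ∃ f : A, KaehlerDifferential.D ℂ A a = f • ω := fun a => by
    have h : KaehlerDifferential.D ℂ A a ∈ Submodule.span A (Set.range fun _ : Unit => ω) := by
      rw [hω.2]; trivial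
    rw [Set.range_const] at h
    obtain ⟨f, hf⟩ := Submodule.mem_span_singleton.1 h
    exact ⟨f, hf.symm⟩
  have hall : ∀ x : Ω[A⁄ℂ], ∃ f ∈ I, x = f • ω := fun x => by
    induction x using kaehler_induction with
    | h0 => exact ⟨0, I.zero_mem, by simp⟩
    | hadd x y hx hy =>
      obtain ⟨f, hf, rfl⟩ := hx
      obtain ⟨g, hg, rfl⟩ := hy
      exact ⟨f + g, I.add_mem hf hg, (add_smul _ _ _).symm⟩
    | h a b =>
      obtain ⟨f, hf⟩ := hmem b
      exact ⟨a * f, I.mul_mem_left _ (hcon b f hf), by rw [hf, mul_smul]⟩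
  obtain ⟨f, hf, h⟩ := hall ω
  have h1 : (1 - f) • ω = 0 := by rw [sub_smul, one_smul, ← h, sub_self]
  have h2 := Fintype.linearIndependent_iff.1 hω.1 (fun _ => 1 - f) (by simpa using h1) ()
  exact hI (I.eq_top_iff_one.2 (by rwa [sub_eq_zero.1 h2]))

end

section

attribute [local instance] MvPolynomial.gradedAlgebra

/-! ### Products with a projective space -/

theorem exists_desc_of_isPushout {Z A₁ A₂ P : CommRingCat.{0}} {f : Z ⟶ A₁} {g : Z ⟶ A₂}
    {i₁ : A₁ ⟶ P} {i₂ : A₂ ⟶ P} (h : IsPushout f g i₁ i₂) {S : Type} [CommRing S] (α : A₁ →+* S)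
    (β : A₂ →+* S) (hαβ : ∀ z, α (f.hom z) = β (g.hom z)) :
    ∃ ψ : P →+* S, (∀ a, ψ (i₁.hom a) = α a) ∧ ∀ a, ψ (i₂.hom a) = β a := by
  have hw : f ≫ CommRingCat.ofHom α = g ≫ CommRingCat.ofHom β := by
    ext z
    exact hαβ z
  refine ⟨(h.desc (CommRingCat.ofHom α) (CommRingCat.ofHom β) hw).hom, fun a => ?_, fun a => ?_⟩
  · exact congrArg (fun φ => φ.hom a) (h.inl_desc (CommRingCat.ofHom α) (CommRingCat.ofHom β) hw)
  · exact congrArg (fun φ => φ.hom a) (h.inr_desc (CommRingCat.ofHom α) (CommRingCat.ofHom β) hw)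

theorem eq_of_isPushout {Z A₁ A₂ P : CommRingCat.{0}} {f : Z ⟶ A₁} {g : Z ⟶ A₂}
    {i₁ : A₁ ⟶ P} {i₂ : A₂ ⟶ P} (h : IsPushout f g i₁ i₂) (ψ ψ' : P →+* P)
    (h₁ : ∀ a, ψ (i₁.hom a) = ψ' (i₁.hom a)) (h₂ : ∀ a, ψ (i₂.hom a) = ψ' (i₂.hom a)) :
    ψ = ψ' := by
  have : CommRingCat.ofHom ψ = CommRingCat.ofHom ψ' := by
    refine h.hom_ext ?_ ?_
    · ext a
      exact h₁ a
    · ext a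
      exact h₂ a
  exact congrArg CommRingCat.Hom.hom this

section Product

variable {Y T : Scheme.{0}} {n : ℕ} (g : Y ⟶ PP n) (ρ : Y ⟶ T)

/-- The part of the open set `x_b ≠ 0` over `W`. -/
def fibOpen (W : T.Opens) (b : Fin n) : Y.Opens := stdOpen g b ⊓ ρ ⁻¹ᵁ W

theorem fibOpen_le_stdOpen (W : T.Opens) (b : Fin n) : fibOpen g ρ W b ≤ stdOpen g b :=
  inf_le_left

theorem fibOpen_le_preimage (W : T.Opens) (b : Fin n) : fibOpen g ρ W b ≤ ρ ⁻¹ᵁ W := inf_le_right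

/-- Functions on `W` as functions on `fibOpen g ρ W b`. -/
def fibBase (W : T.Opens) (b : Fin n) : Γ(T, W) →+* Γ(Y, fibOpen g ρ W b) :=
  (ρ.appLE W (fibOpen g ρ W b) (fibOpen_le_preimage g ρ W b)).hom

/-- The functions `x_c / x_b` on `fibOpen g ρ W b`. -/
def fibVar (W : T.Opens) (b c : Fin n) : Γ(Y, fibOpen g ρ W b) :=
  rs (fibOpen_le_stdOpen g ρ W b) (ratio g b c)

/-- The homomorphism from a polynomial ring to the functions on `fibOpen g ρ W b`. -/
def fibPoly (W : T.Opens) (b : Fin n) :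
    MvPolynomial {c // c ≠ b} Γ(T, W) →+* Γ(Y, fibOpen g ρ W b) :=
  MvPolynomial.eval₂Hom (fibBase g ρ W b) fun c => fibVar g ρ W b c.1

variable {g ρ} {q : T ⟶ Spec (.of ℂ)} (H : IsPullback g ρ (PP.toSpec n) q)

include H in
theorem isAffineOpen_fibOpen {W : T.Opens} (hW : IsAffineOpen W) (b : Fin n) :
    IsAffineOpen (fibOpen g ρ W b) := by
  have h1 : IsAffine _ := isAffineOpen_top (Spec (.of ℂ))
  have h2 : IsAffine _ := hW
  have h3 : IsAffine _ := isAffineOpen_chart b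
  have e := (Scheme.Hom.isPullback_resLE H (le_preimage_top q W)
    (le_preimage_top (PP.toSpec n) (PP.chart b)) (UY := fibOpen g ρ W b) rfl).isoPullback
  exact IsAffine.of_isIso e.hom

include H in
-- A fibre product of affine schemes corresponds to a pushout of rings.
theorem isPushout_fibOpen {W : T.Opens} (hW : IsAffineOpen W) (b : Fin n) :
    IsPushout ((PP.toSpec n).appLE ⊤ (PP.chart b) (le_preimage_top _ _))
      (q.appLE ⊤ W (le_preimage_top _ _)) (g.appLE (PP.chart b) (fibOpen g ρ W b) (fibOpen_le_stdOpen g ρ W b))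
      (ρ.appLE W (fibOpen g ρ W b) (fibOpen_le_preimage g ρ W b)) :=
  (isIso_pushoutSection_iff H (le_preimage_top q W)
    (le_preimage_top (PP.toSpec n) (PP.chart b)) rfl).1
      (isIso_pushoutSection_of_isAffineOpen H _ _ _ (isAffineOpen_top _) hW (isAffineOpen_chart b))

theorem appLE_structureHom {T S : Scheme.{0}} (f : T ⟶ S) (q : S ⟶ Spec (.of ℂ)) {U : T.Opens}
    {V : S.Opens} (h : U ≤ f ⁻¹ᵁ V) (r : ℂ) :
    (f.appLE V U h).hom (structureHom q V r) = structureHom (f ≫ q) U r := by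
  change ((Scheme.ΓSpecIso (.of ℂ)).inv ≫ q.appLE ⊤ V (le_preimage_top q V) ≫
    f.appLE V U h).hom r = _
  rw [Scheme.Hom.appLE_comp_appLE]
  rfl

theorem fibVar_eq (W : T.Opens) (b c : Fin n) :
    (g.appLE (PP.chart b) (fibOpen g ρ W b) (fibOpen_le_stdOpen g ρ W b)).hom (PP.ratio b c) = fibVar g ρ W b c :=
  rfl

theorem fibPoly_C (W : T.Opens) (b : Fin n) (r : Γ(T, W)) :
    fibPoly g ρ W b (MvPolynomial.C r) = fibBase g ρ W b r :=
  MvPolynomial.eval₂Hom_C _ _ r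

theorem fibPoly_X (W : T.Opens) (b : Fin n) (c : {c // c ≠ b}) :
    fibPoly g ρ W b (MvPolynomial.X c) = fibVar g ρ W b c.1 :=
  MvPolynomial.eval₂Hom_X' _ _ c

include H in
theorem fibPoly_map (W : T.Opens) (b : Fin n) (p : MvPolynomial {c // c ≠ b} ℂ) :
    fibPoly g ρ W b (MvPolynomial.map (structureHom q W) p) =
      (g.appLE (PP.chart b) (fibOpen g ρ W b) (fibOpen_le_stdOpen g ρ W b)).hom (chartPoly b p) := by
  induction p using MvPolynomial.induction_on with
  | C r =>
    rw [MvPolynomial.map_C, fibPoly_C, chartPoly_C]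
    refine (appLE_structureHom ρ q (fibOpen_le_preimage g ρ W b) r).trans ?_
    rw [← H.w]
    exact (appLE_structureHom g (PP.toSpec n) (fibOpen_le_stdOpen g ρ W b) r).symm
  | add p q hp hq => rw [map_add, map_add, map_add, map_add, hp, hq]
  | mul_X p c hp =>
    rw [map_mul, map_mul, map_mul, map_mul, hp, MvPolynomial.map_X, fibPoly_X, chartPoly_X,
      fibVar_eq]

include H in
-- The functions on the product of W with affine space are polynomials over the functions on W. The
-- inverse comes from the universal property of the pushout, the functions on x_b ≠ 0 being
-- themselves a polynomial ring over ℂ.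
theorem fibPoly_bijective {W : T.Opens} (hW : IsAffineOpen W) (b : Fin n) :
    Function.Bijective (fibPoly g ρ W b) := by
  have hP := isPushout_fibOpen H hW b
  let e := RingEquiv.ofBijective (chartPoly b) (chartPoly_bijective b)
  have he : ∀ p, e.symm (chartPoly b p) = p := e.symm_apply_apply
  let α : Γ(PP n, PP.chart b) →+* MvPolynomial {c // c ≠ b} Γ(T, W) :=
    (MvPolynomial.map (structureHom q W)).comp (e.symm : _ →+* _)
  have hα : ∀ p, α (chartPoly b p) = MvPolynomial.map (structureHom q W) p := fun p =>
    congrArg (MvPolynomial.map (structureHom q W)) (he p)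
  have hαC : ∀ r : ℂ, α (structureHom (PP.toSpec n) (PP.chart b) r) =
      MvPolynomial.C (structureHom q W r) := fun r => by
    rw [← chartPoly_C, hα, MvPolynomial.map_C]
  have hcompat : ∀ z, α (((PP.toSpec n).appLE ⊤ (PP.chart b) (le_preimage_top _ _)).hom z) =
      MvPolynomial.C ((q.appLE ⊤ W (le_preimage_top _ _)).hom z) := fun z => by
    obtain ⟨r, rfl⟩ :=
      (ConcreteCategory.bijective_of_isIso (Scheme.ΓSpecIso (.of ℂ)).inv).2 z
    exact hαC r
  obtain ⟨ψ, h₁, h₂⟩ := exists_desc_of_isPushout hP α MvPolynomial.C hcompat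
  have hψ : ψ.comp (fibPoly g ρ W b) = RingHom.id _ := by
    refine MvPolynomial.ringHom_ext (fun r => ?_) fun c => ?_
    · rw [RingHom.comp_apply, fibPoly_C]
      exact h₂ r
    · rw [RingHom.comp_apply, fibPoly_X]
      refine (h₁ (PP.ratio b c.1)).trans ?_
      rw [← chartPoly_X, hα, MvPolynomial.map_X]
      rfl
  have hψ' : (fibPoly g ρ W b).comp ψ = RingHom.id _ := by
    refine eq_of_isPushout hP _ _ (fun z => ?_) fun r => ?_
    · obtain ⟨p, rfl⟩ := (chartPoly_bijective b).2 z
      refine (congrArg (fibPoly g ρ W b) (h₁ _)).trans ?_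
      rw [hα, fibPoly_map H]
      rfl
    · exact (congrArg (fibPoly g ρ W b) (h₂ r)).trans (fibPoly_C W b r)
  exact Function.bijective_iff_has_inverse.2 ⟨ψ, DFunLike.congr_fun hψ, DFunLike.congr_fun hψ'⟩

include H in
theorem fibOpen_nonempty [IsIntegral T] {W : T.Opens} (hW : IsAffineOpen W)
    (hne : (W : Set T).Nonempty) (b : Fin n) : (fibOpen g ρ W b : Set Y).Nonempty := by
  by_contra h
  have h1 := subsingleton_of_not_nonempty h
  have : Nonempty W := hne.to_subtype
  have : Nontrivial Γ(T, W) := inferInstance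
  exact not_subsingleton _ ((fibPoly_bijective H hW b).1.subsingleton)

include H in
/-- The components of a section of `O(1)` are polynomials of degree at most one. -/
theorem exists_linear [IsIntegral T] [IsIntegral Y] {W : T.Opens} (hW : IsAffineOpen W)
    (hne : (W : Set T).Nonempty) (z : ∀ b, Γ(Y, fibOpen g ρ W b))
    (hz : ∀ (a b : Fin n) (V : Y.Opens) (_ : IsAffineOpen V) (ha : V ≤ fibOpen g ρ W a)
      (hb : V ≤ fibOpen g ρ W b),
      rs ha (z a) = rs ha (fibVar g ρ W a b) * rs hb (z b)) (a : Fin n) :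
    ∃ (q₀ : Γ(T, W)) (q : {c // c ≠ a} → Γ(T, W)),
      z a = fibBase g ρ W a q₀ + ∑ c, fibBase g ρ W a (q c) * fibVar g ρ W a c.1 := by
  obtain ⟨p, hp⟩ := (fibPoly_bijective H hW a).2 (z a)
  have hdeg : p.totalDegree ≤ 1 := by
    by_cases hb : ∃ b, b ≠ a
    · obtain ⟨b, hb⟩ := hb
      obtain ⟨r, hr⟩ := (fibPoly_bijective H hW b).2 (z b)
      have : Nonempty W := hne.to_subtype
      have hdom : IsDomain Γ(T, W) := inferInstance
      -- By irreducibility the two open sets meet, and restriction to an affine open set in the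
      -- intersection loses no information.
      obtain ⟨y, hy⟩ := nonempty_preirreducible_inter
        (fibOpen g ρ W a).isOpen (fibOpen g ρ W b).isOpen (fibOpen_nonempty H hW hne a)
        (fibOpen_nonempty H hW hne b)
      obtain ⟨⟨V, hVaff⟩, hyV, hle⟩ := exists_affineOpens_mem
        (U := fibOpen g ρ W a ⊓ fibOpen g ρ W b) hy
      have hV : (V : Set Y).Nonempty := ⟨y, hyV⟩
      have hVa : V ≤ fibOpen g ρ W a := hle.trans inf_le_left
      have hVb : V ≤ fibOpen g ρ W b := hle.trans inf_le_right
      have hbase : (rs hVb).comp (fibBase g ρ W b) = (rs hVa).comp (fibBase g ρ W a) := by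
        ext x
        change (ρ.appLE W _ _ ≫ Y.presheaf.map (homOfLE hVb).op).hom x =
          (ρ.appLE W _ _ ≫ Y.presheaf.map (homOfLE hVa).op).hom x
        rw [Scheme.Hom.appLE_map, Scheme.Hom.appLE_map]
      have hmul : ∀ c, rs hVa (fibVar g ρ W a c) =
          rs hVa (fibVar g ρ W a b) * rs hVb (fibVar g ρ W b c) := fun c => by
        simp only [fibVar, rs_rs]
        exact ratio_mul g a b c _ _
      have hone : fibVar g ρ W a a = 1 := (congrArg (rs _) (ratio_self g a)).trans (map_one _)
      have hpa : ∀ p, rs hVa (fibPoly g ρ W a p) = MvPolynomial.eval₂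
          ((rs hVa).comp (fibBase g ρ W a)) (fun c => rs hVa (fibVar g ρ W a c.1)) p :=
        fun p => MvPolynomial.eval₂_comp_left _ _ _ p
      have hpb : ∀ p, rs hVb (fibPoly g ρ W b p) = MvPolynomial.eval₂
          ((rs hVa).comp (fibBase g ρ W a)) (fun c => rs hVb (fibVar g ρ W b c.1)) p :=
        fun p => by
          rw [← hbase]
          exact MvPolynomial.eval₂_comp_left _ _ _ p
      -- Here u_c = x_c/x_a, v_c = x_c/x_b and β = b. The product u_b v_c is x_c/x_a, that is, a
      -- variable, or 1 when c = a.
      refine totalDegree_le_one_of_eval₂_eq_mul ((rs hVa).comp (fibBase g ρ W a))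
        (fun c : {c // c ≠ a} => rs hVa (fibVar g ρ W a c.1))
        (fun c : {c // c ≠ b} => rs hVb (fibVar g ρ W b c.1)) ⟨b, hb⟩
        (fun c => if h : c.1 = a then 1 else MvPolynomial.X ⟨c.1, h⟩) ?_ ?_ ?_ p r ?_
      · intro c
        split_ifs
        · simp
        · simp
      · intro c
        rw [← hmul]
        split_ifs with h
        · rw [MvPolynomial.eval₂_one, h, hone, map_one]
        · rw [MvPolynomial.eval₂_X]
      · have h1 : Function.Injective fun p => rs hVa (fibPoly g ρ W a p) :=
          (rs_injective hVa hV).comp (fibPoly_bijective H hW a).1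
        simp only [hpa] at h1
        exact h1
      · rw [← hpa, ← hpb, hp, hr]
        exact hz a b V hVaff hVa hVb
    · have : IsEmpty {c // c ≠ a} := ⟨fun c => hb ⟨c.1, c.2⟩⟩
      rw [MvPolynomial.eq_C_of_isEmpty p]
      simp
  refine ⟨p.coeff 0, fun c => p.coeff (Finsupp.single c 1), ?_⟩
  rw [← hp]
  conv_lhs => rw [eq_of_totalDegree_le_one p hdeg]
  simp only [map_add, map_sum, map_mul, fibPoly_C, fibPoly_X]

end Product

end

section

attribute [local instance] MvPolynomial.gradedAlgebra

/-! ### Local coordinates of smooth schemes -/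

/-- The differentials of the functions `x` are a basis of the module of differentials of the
`ℂ`-algebra given by `φ`. -/
def IsCoord {A ι : Type} [CommRing A] (φ : ℂ →+* A) (x : ι → A) : Prop :=
  letI := φ.toAlgebra
  IsBasis A fun c => KaehlerDifferential.D ℂ A (x c)

/-- The differentials of the functions `x` span the module of differentials of the
`ℂ`-algebra given by `φ`. -/
def IsSpanning {A ι : Type} [CommRing A] (φ : ℂ →+* A) (x : ι → A) : Prop :=
  letI := φ.toAlgebra
  Submodule.span A (Set.range fun c => KaehlerDifferential.D ℂ A (x c)) = ⊤

/-- The module of differentials of the `ℂ`-algebra given by `φ` has a basis of `n` elements. -/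
def HasDim {A : Type} [CommRing A] (φ : ℂ →+* A) (n : ℕ) : Prop :=
  letI := φ.toAlgebra
  ∃ b : Fin n → Ω[A⁄ℂ], IsBasis A b

theorem IsBasis.unit_smul {A M : Type} [CommRing A] [AddCommGroup M] [Module A M] {e : M}
    (he : IsBasis A fun _ : Unit => e) {c : A} (hc : IsUnit c) :
    IsBasis A fun _ : Unit => c • e := by
  obtain ⟨c, rfl⟩ := hc
  refine ⟨he.1.units_smul fun _ => c, ?_⟩
  have h := he.2
  rw [Set.range_const] at h ⊢
  rw [Submodule.span_singleton_smul_eq c.isUnit, h]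

/-- Over a nonzero commutative ring, as many generators as the rank of a free module are
independent. It therefore suffices to check that the intended coordinates generate. -/
theorem IsSpanning.isCoord {A ι : Type} [CommRing A] [Fintype ι] {φ : ℂ →+* A} {x : ι → A}
    (h : IsSpanning φ x) (hn : HasDim φ (Fintype.card ι)) : IsCoord φ x := by
  let _ := φ.toAlgebra
  obtain ⟨b, hb⟩ := hn
  refine ⟨?_, h⟩
  rcases subsingleton_or_nontrivial A with hA | hA
  · exact linearIndependent_of_subsingleton
  have := Module.Finite.of_basis hb.basis
  exact linearIndependent_of_top_le_span_of_card_eq_finrank (R := A) (ge_of_eq h)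
    (by rw [Module.finrank_eq_card_basis hb.basis, Fintype.card_fin])

section Restriction

variable {T : Scheme.{0}} (f : T ⟶ Spec (.of ℂ)) {U V : T.Opens} (hU : IsAffineOpen U)
  (hV : IsAffineOpen V) (h : V ≤ U)

include hU hV h

theorem HasDim.rs {n : ℕ} (hn : HasDim (structureHom f U) n) : HasDim (structureHom f V) n := by
  let _ := (structureHom f U).toAlgebra
  let _ := (structureHom f V).toAlgebra
  obtain ⟨b, hb⟩ := hn
  let φ : Γ(T, U) →ₐ[ℂ] Γ(T, V) := { Scroll.rs h with commutes' := rs_structureHom f h }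
  exact ⟨_, isBasis_kaehlerMap φ ((etale_rs (U := ⟨U, hU⟩) (V := ⟨V, hV⟩) h).formallyEtale) hb⟩

theorem IsSpanning.rs {ι : Type} {x : ι → Γ(T, U)} (hx : IsSpanning (structureHom f U) x) :
    IsSpanning (structureHom f V) fun c => Scroll.rs h (x c) := by
  let _ := (structureHom f U).toAlgebra
  let _ := (structureHom f V).toAlgebra
  let φ : Γ(T, U) →ₐ[ℂ] Γ(T, V) := { Scroll.rs h with commutes' := rs_structureHom f h }
  have h1 := span_range_kaehlerMap φ ((etale_rs (U := ⟨U, hU⟩) (V := ⟨V, hV⟩) h).formallyEtale)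
  have hx' : Submodule.span Γ(T, U) (Set.range fun c => KaehlerDifferential.D ℂ Γ(T, U) (x c)) = ⊤ :=
    hx
  change Submodule.span Γ(T, V)
    (Set.range fun c => KaehlerDifferential.D ℂ Γ(T, V) (φ (x c))) = ⊤
  rw [eq_top_iff, ← h1, Submodule.span_le]
  rintro _ ⟨ω, rfl⟩
  have hω : ω ∈ Submodule.span Γ(T, U)
      (Set.range fun c => KaehlerDifferential.D ℂ Γ(T, U) (x c)) := by rw [hx']; trivial
  induction hω using Submodule.span_induction with
  | mem y hy =>
    obtain ⟨c, rfl⟩ := hy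
    rw [kaehlerMap_D]
    exact Submodule.subset_span ⟨c, rfl⟩
  | zero =>
    rw [map_zero]
    exact Submodule.zero_mem _
  | add y z _ _ hy hz =>
    rw [map_add]
    exact Submodule.add_mem _ hy hz
  | smul a y _ hy =>
    rw [LinearMap.map_smulₛₗ]
    exact Submodule.smul_mem _ _ hy

end Restriction

section Smooth

variable {T : Scheme.{0}} (f : T ⟶ Spec (.of ℂ))

theorem exists_hasDim (n : ℕ) [SmoothOfRelativeDimension n f] {x : T} {U : T.Opens} (hx : x ∈ U) :
    ∃ V : T.Opens, IsAffineOpen V ∧ x ∈ V ∧ V ≤ U ∧ HasDim (structureHom f V) n := by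
  obtain ⟨S, hS, V, hV, hxV, e, hsm⟩ :=
    SmoothOfRelativeDimension.exists_isStandardSmoothOfRelativeDimension (n := n) (f := f) x
  -- The base Spec ℂ has a single point.
  obtain rfl : S = ⊤ := by
    refine SetLike.ext fun y => ⟨fun _ => trivial, fun _ => ?_⟩
    have : Subsingleton (PrimeSpectrum ℂ) := inferInstance
    rw [show y = f x from Subsingleton.elim (α := PrimeSpectrum ℂ) _ _]
    exact e hxV
  have hdim : HasDim (structureHom f V) n := by
    have hst : RingHom.IsStandardSmoothOfRelativeDimension n (structureHom f V) := by
      have h1 := (RingHom.isStandardSmoothOfRelativeDimension_respectsIso (n := n)).2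
        (f.appLE ⊤ V e).hom (Scheme.ΓSpecIso (.of ℂ)).symm.commRingCatIsoToRingEquiv hsm
      exact h1
    let _ := (structureHom f V).toAlgebra
    have h1 : Algebra.IsStandardSmoothOfRelativeDimension n ℂ Γ(T, V) := hst
    have h2 : Algebra.IsStandardSmooth ℂ Γ(T, V) := h1.isStandardSmooth
    have : Nonempty V := ⟨⟨x, hxV⟩⟩
    have : Nontrivial Γ(T, V) := inferInstance
    have h3 := Algebra.IsStandardSmoothOfRelativeDimension.rank_kaehlerDifferential
      (R := ℂ) (S := Γ(T, V)) n
    have : Module.Finite Γ(T, V) Ω[Γ(T, V)⁄ℂ] := inferInstance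
    exact ⟨_, (Module.finBasisOfFinrankEq Γ(T, V) Ω[Γ(T, V)⁄ℂ]
      (Module.finrank_eq_of_rank_eq h3)).isBasis⟩
  obtain ⟨V', hxV', hle⟩ := exists_affineOpens_mem (x := x) (U := V ⊓ U) ⟨hxV, hx⟩
  exact ⟨V'.1, V'.2, hxV', hle.trans inf_le_right,
    hdim.rs f hV V'.2 (hle.trans inf_le_left)⟩

/-- Near x some exact differential is dt = w ω with ω the basis element and w not vanishing at x;
where w is invertible, dt is itself a basis. -/
theorem exists_isCoord [SmoothOfRelativeDimension 1 f] {x : T} {U : T.Opens} (hx : x ∈ U) :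
    ∃ V : T.Opens, IsAffineOpen V ∧ x ∈ V ∧ V ≤ U ∧
      ∃ t : Γ(T, V), IsCoord (structureHom f V) fun _ : Unit => t := by
  obtain ⟨V, hV, hxV, hle, hdim⟩ := exists_hasDim f 1 hx
  let _ := (structureHom f V).toAlgebra
  obtain ⟨b, hb⟩ := hdim
  have hω : IsBasis Γ(T, V) fun _ : Unit => b 0 := by
    have := hb.comp_equiv (Equiv.ofUnique Unit (Fin 1))
    exact this
  obtain ⟨t, w, htw, hw⟩ := exists_D_eq_smul hω ((IsLocalRing.maximalIdeal
    (T.presheaf.stalk x)).comap (T.presheaf.germ V x hxV).hom)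
      (Ideal.comap_ne_top _ (Ideal.IsPrime.ne_top inferInstance))
  have hle' : T.basicOpen w ≤ V := T.basicOpen_le w
  have hxw : x ∈ T.basicOpen w := by
    rw [T.mem_basicOpen w x hxV]
    by_contra hcon
    exact hw hcon
  refine ⟨T.basicOpen w, hV.basicOpen w, hxw, hle'.trans hle, rs hle' t, ?_⟩
  let _ := (structureHom f (T.basicOpen w)).toAlgebra
  let φ : Γ(T, V) →ₐ[ℂ] Γ(T, T.basicOpen w) :=
    { rs hle' with commutes' := rs_structureHom f hle' }
  have h1 := isBasis_kaehlerMap φ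
    ((etale_rs (U := ⟨V, hV⟩) (V := ⟨_, hV.basicOpen w⟩) hle').formallyEtale) hω
  have hu : IsUnit (φ w) := RingedSpace.isUnit_res_basicOpen _ w
  have h2 : KaehlerDifferential.D ℂ Γ(T, T.basicOpen w) (φ t) = φ w • kaehlerMap φ (b 0) := by
    rw [← kaehlerMap_D, htw, LinearMap.map_smulₛₗ]
    rfl
  have h3 := h1.unit_smul hu
  rw [← h2] at h3
  exact h3

end Smooth

end

section

attribute [local instance] MvPolynomial.gradedAlgebra

/-! ### Coordinates of a product with a projective space -/

section Product

variable {Y T : Scheme.{0}} {n : ℕ} (g : Y ⟶ PP n) (ρ : Y ⟶ T)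

/-- The function `t` on the base together with the functions `x_c / x_a`. -/
def fibCoord (W : T.Opens) (t : Γ(T, W)) (a c : Fin n) : Γ(Y, fibOpen g ρ W a) :=
  if c = a then fibBase g ρ W a t else fibVar g ρ W a c

variable {g ρ} {q : T ⟶ Spec (.of ℂ)} (H : IsPullback g ρ (PP.toSpec n) q)

include H in
-- The functions are polynomials over those on W. The quotient x_a/x_a = 1 is useless as a
-- coordinate, so the function t takes the place a, and the family is indexed by all of `Fin n`.
theorem isSpanning_fibCoord {W : T.Opens} (hW : IsAffineOpen W) {t : Γ(T, W)}
    (ht : IsCoord (structureHom q W) fun _ : Unit => t) (a : Fin n) :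
    IsSpanning (structureHom (ρ ≫ q) (fibOpen g ρ W a)) (fibCoord g ρ W t a) := by
  let _ := (structureHom q W).toAlgebra
  let _ := (structureHom (ρ ≫ q) (fibOpen g ρ W a)).toAlgebra
  let φ : Γ(T, W) →ₐ[ℂ] Γ(Y, fibOpen g ρ W a) :=
    { fibBase g ρ W a with
      commutes' := appLE_structureHom ρ q (fibOpen_le_preimage g ρ W a) }
  refine span_D_of_eval₂Hom_surjective φ (fun c : {c // c ≠ a} => fibVar g ρ W a c.1)
    (fibPoly_bijective H hW a).2 t ht.2 _ ?_ fun c => ?_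
  · refine Submodule.subset_span ⟨a, congrArg _ ?_⟩
    exact if_pos rfl
  · refine Submodule.subset_span ⟨c.1, congrArg _ ?_⟩
    exact if_neg c.2

include H in
theorem exists_linear_fibCoord [IsIntegral T] [IsIntegral Y] {W : T.Opens} (hW : IsAffineOpen W)
    (hne : (W : Set T).Nonempty) (t : Γ(T, W)) (z : ∀ b, Γ(Y, fibOpen g ρ W b))
    (hz : ∀ (a b : Fin n) (V : Y.Opens) (_ : IsAffineOpen V) (ha : V ≤ fibOpen g ρ W a)
      (hb : V ≤ fibOpen g ρ W b),
      rs ha (z a) = rs ha (fibVar g ρ W a b) * rs hb (z b)) (a : Fin n) :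
    ∃ (q₀ : Γ(T, W)) (q : Fin n → Γ(T, W)),
      z a = fibBase g ρ W a q₀ + ∑ c, fibBase g ρ W a (q c) * fibCoord g ρ W t a c := by
  obtain ⟨q₀, q, h⟩ := exists_linear H hW hne z hz a
  -- At the place a the coordinate is t, which the linear form does not involve.
  refine ⟨q₀, fun c => if h : c = a then 0 else q ⟨c, h⟩, ?_⟩
  rw [h, Fintype.sum_eq_add_sum_subtype_ne _ a]
  simp only [dif_pos, map_zero, zero_mul, zero_add]
  refine congrArg _ (Finset.sum_congr rfl fun c _ => ?_)
  rw [dif_neg c.2, fibCoord, if_neg c.2]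

/-- The component of a section of `f^* O(1)` over a part of the open set `x_a ≠ 0`. -/
def component {Y : Scheme.{0}} {m : ℕ} (f : Y ⟶ PP m) {a : Fin m} {U : Y.Opens}
    (hU : U ≤ stdOpen f a) (s : twistSections f U) : Γ(Y, U) := rs (le_inf le_rfl hU) (s.1 a)

theorem component_smul {Y : Scheme.{0}} {m : ℕ} (f : Y ⟶ PP m) {a : Fin m} {U : Y.Opens}
    (hU : U ≤ stdOpen f a) (c : Γ(Y, U)) (s : twistSections f U) :
    component f hU (c • s) = c * component f hU s := by
  change rs _ (rs inf_le_left c * s.1 a) = _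
  rw [map_mul, rs_rs, rs_refl]
  rfl

theorem component_coordElt {Y : Scheme.{0}} {m : ℕ} (f : Y ⟶ PP m) {a : Fin m} {U : Y.Opens}
    (hU : U ≤ stdOpen f a) (l : Fin m) : component f hU (coordElt f U l) = rs hU (ratio f a l) :=
  rs_rs _ _ _

theorem eq_component_smul {Y : Scheme.{0}} {m : ℕ} (f : Y ⟶ PP m) {a : Fin m} {U : Y.Opens}
    (hU : U ≤ stdOpen f a) (s : twistSections f U) : s = component f hU s • coordElt f U a :=
  twist_eq_smul f hU s

theorem component_eq_mul {Y : Scheme.{0}} {m : ℕ} (f : Y ⟶ PP m) {a b : Fin m} {U : Y.Opens}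
    (ha : U ≤ stdOpen f a) (hb : U ≤ stdOpen f b) (s : twistSections f U) :
    component f ha s = rs ha (ratio f a b) * component f hb s :=
  s.2 a b U (le_inf le_rfl ha) (le_inf le_rfl hb)

/-- A homomorphism of twisting sheaves on the sections over an affine open set. -/
def twistApp {Y : Scheme.{0}} {p : Y ⟶ Spec (.of ℂ)} {m m' : ℕ} {f : Y ⟶ PP m} {f' : Y ⟶ PP m'}
    (ε : PMod.Hom (twist f p) (twist f' p)) {U : Y.Opens} (hU : IsAffineOpen U) :
    twistSections f U →ₗ[Γ(Y, U)] twistSections f' U := ε.app ⟨U, hU⟩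

theorem rs_component_twistApp {Y : Scheme.{0}} {p : Y ⟶ Spec (.of ℂ)} {m m' : ℕ} {f : Y ⟶ PP m}
    {f' : Y ⟶ PP m'} (ε : PMod.Hom (twist f p) (twist f' p)) {U V : Y.Opens} (hU : IsAffineOpen U)
    (hV : IsAffineOpen V) (h : V ≤ U) {a : Fin m'} (ha : U ≤ stdOpen f' a) (l : Fin m) :
    rs h (component f' ha (twistApp ε hU (coordElt f U l))) =
      component f' (h.trans ha) (twistApp ε hV (coordElt f V l)) := by
  have h1 := ε.naturality (i := ⟨V, hV⟩) (j := ⟨U, hU⟩) h (coordElt f U l)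
  have h2 : (twist f p).res (i := ⟨V, hV⟩) (j := ⟨U, hU⟩) h (coordElt f U l) = coordElt f V l :=
    (coordSection f p l).2 (i := ⟨V, hV⟩) (j := ⟨U, hU⟩) h
  rw [h2] at h1
  refine Eq.trans ?_ (congrArg (component f' (h.trans ha)) h1.symm)
  change rs h (rs _ _) = rs _ (rs _ _)
  rw [rs_rs, rs_rs]
  rfl

include H in
/-- If a twisting sheaf is isomorphic to `O(1)`, then the quotients of its coordinates are linear
up to a common factor. -/
theorem exists_ratio_eq_mul_linear [IsIntegral T] [IsIntegral Y] {W : T.Opens}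
    (hW : IsAffineOpen W) (hne : (W : Set T).Nonempty) (t : Γ(T, W)) {p : Y ⟶ Spec (.of ℂ)} {m : ℕ}
    (f : Y ⟶ PP m) (hε : PMod.IsIsomorphic (twist f p) (twist g p)) (a : Fin n) {V : Y.Opens}
    (hV : IsAffineOpen V) (ha : V ≤ fibOpen g ρ W a) {b : Fin m} (hb : V ≤ stdOpen f b) :
    ∃ e : Γ(Y, V), IsUnit e ∧ ∀ l, ∃ (q₀ : Γ(T, W)) (q : Fin n → Γ(T, W)),
      rs hb (ratio f b l) = rs ha (fibBase g ρ W a q₀ +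
        ∑ c, fibBase g ρ W a (q c) * fibCoord g ρ W t a c) * e := by
  obtain ⟨ε, hε⟩ := hε
  have hVa : V ≤ stdOpen g a := ha.trans (fibOpen_le_stdOpen g ρ W a)
  -- s is the section that the isomorphism carries to x_a; its component e with respect to x_b is
  -- the common factor, a unit because the isomorphism sends x_b to a multiple of x_a inverse to it.
  obtain ⟨s, hs⟩ : ∃ s, twistApp ε hV s = coordElt g V a := (hε ⟨V, hV⟩).2 (coordElt g V a)
  have h1 : component f hb s * component g hVa (twistApp ε hV (coordElt f V b)) = 1 := by
    rw [← component_smul, ← map_smul, ← eq_component_smul f hb s, hs, component_coordElt,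
      ratio_self, map_one]
  refine ⟨component f hb s, IsUnit.of_mul_eq_one _ h1, fun l => ?_⟩
  -- The image of x_l is a section of O(1) over the whole part of Y above W, so its component with
  -- respect to x_a is linear.
  obtain ⟨q₀, q, hq⟩ := exists_linear_fibCoord H hW hne t
    (fun c => component g (fibOpen_le_stdOpen g ρ W c) (twistApp ε (isAffineOpen_fibOpen H hW c)
      (coordElt f (fibOpen g ρ W c) l))) (fun c d U hU hc hd => by
        rw [rs_component_twistApp ε _ hU hc, rs_component_twistApp ε _ hU hd]
        refine (component_eq_mul g _ (hd.trans (fibOpen_le_stdOpen g ρ W d)) _).trans ?_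
        exact congrArg (· * _) (rs_rs _ _ _).symm) a
  refine ⟨q₀, q, ?_⟩
  rw [← hq, rs_component_twistApp ε _ hV ha, eq_component_smul f hb (coordElt f V l), map_smul,
    component_smul, component_coordElt, mul_assoc, mul_comm (component g _ _), h1, mul_one]

end Product

/-- Renumbering of coordinates. -/
def ScrollChart.permute {B B' : AlgBase} {p : BaseHom B B'} {L : PMod B} {r : ℕ}
    {s : Fin r → L.GlobalSection} {σ : Type} [Fintype σ] {a : σ} {j : B.I}
    (c : ScrollChart p L s a j) (o : σ) (π : σ ≃ σ) (hπ : π o = a) : ScrollChart p L s o j where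
  x b := c.x (π b)
  t := c.t
  e := c.e
  isBasis_x := c.isBasis_x.comp_equiv π
  isBasis_t := c.isBasis_t
  x_eq := by rw [hπ, c.x_eq]
  isHBasis_e := c.isHBasis_e
  section_eq l := by
    obtain ⟨q₀, q, hq⟩ := c.section_eq l
    refine ⟨q₀, fun b => q (π b), ?_⟩
    rw [Equiv.sum_comp π fun b => p.map j (q b) * c.x b]
    exact hq

end

section

attribute [local instance] MvPolynomial.gradedAlgebra

/-! ### Coordinates of scrolls -/

theorem structureHom_image {X : Scheme.{0}} (p : X ⟶ Spec (.of ℂ)) (U : X.Opens)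
    (V : U.toScheme.Opens) : structureHom (U.ι ≫ p) V = structureHom p (U.ι ''ᵁ V) := by
  ext r
  rw [← appLE_structureHom U.ι p (V := U.ι ''ᵁ V) (U := V) (U.ι.preimage_image_eq V).ge r,
    Scheme.Opens.ι_appLE]
  exact rs_refl _ _

theorem rs_ratio_image {X : Scheme.{0}} {m : ℕ} (i : X ⟶ PP m) (U : X.Opens)
    (V : U.toScheme.Opens) {b : Fin m} (h : V ≤ stdOpen (U.ι ≫ i) b)
    (h' : U.ι ''ᵁ V ≤ stdOpen i b) (l : Fin m) :
    (rs h (ratio (U.ι ≫ i) b l) : Γ(U.toScheme, V)) = rs h' (ratio i b l) := by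
  have h1 : ratio (U.ι ≫ i) b l = (U.ι.app (stdOpen i b)).hom (ratio i b l) := by
    change ((U.ι ≫ i).app (PP.chart b)).hom _ = _
    rw [Scheme.Hom.comp_app]
    rfl
  exact (congrArg (rs h) h1).trans (rs_rs (T := X) (U := stdOpen i b)
    (V := U.ι ''ᵁ U.ι ⁻¹ᵁ stdOpen i b) (W := U.ι ''ᵁ V) (U.ι.image_preimage_le _)
    (U.ι.image_mono h) (ratio i b l))

theorem rs_fibBase_image {X C : Scheme.{0}} (π : X ⟶ C) (W₁ : C.Opens) {n : ℕ}
    (g : (π ⁻¹ᵁ W₁).toScheme ⟶ PP n) (W : W₁.toScheme.Opens) (a : Fin n)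
    (V : (π ⁻¹ᵁ W₁).toScheme.Opens) (ha : V ≤ fibOpen g (π ∣_ W₁) W a)
    (h : (π ⁻¹ᵁ W₁).ι ''ᵁ V ≤ π ⁻¹ᵁ (W₁.ι ''ᵁ W)) (r : Γ(W₁.toScheme, W)) :
    (rs ha (fibBase g (π ∣_ W₁) W a r) : Γ((π ⁻¹ᵁ W₁).toScheme, V)) =
      (π.appLE (W₁.ι ''ᵁ W) ((π ⁻¹ᵁ W₁).ι ''ᵁ V) h).hom r := by
  have h1 : (π ∣_ W₁).appLE W _ (fibOpen_le_preimage g (π ∣_ W₁) W a) ≫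
      (π ⁻¹ᵁ W₁).toScheme.presheaf.map (homOfLE ha).op = (π ∣_ W₁).appLE W V
        (ha.trans (fibOpen_le_preimage g (π ∣_ W₁) W a)) := Scheme.Hom.appLE_map _ _ _
  have h2 := morphismRestrict_appLE π W₁ W V (ha.trans (fibOpen_le_preimage g (π ∣_ W₁) W a))
  exact congrArg (fun φ => φ.hom r) (h1.trans h2)

section Coordinates

variable {X C : Scheme.{0}} (pX : X ⟶ Spec (.of ℂ)) (pC : C ⟶ Spec (.of ℂ)) {n N : ℕ}
  (i : X ⟶ PP (N + 1)) (π : X ⟶ C)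

/-- Coordinates of a scroll on an open set `U` over an open set `W` of the curve. -/
structure LocalCoord (U : X.Opens) (W : C.Opens) (a : Fin n) where
  le : U ≤ π ⁻¹ᵁ W
  x : Fin n → Γ(X, U)
  t : Γ(C, W)
  isCoord_x : IsCoord (structureHom pX U) x
  isCoord_t : IsCoord (structureHom pC W) fun _ : Unit => t
  x_eq : x a = (π.appLE W U le).hom t
  ratio_eq : ∀ {b : Fin (N + 1)} (hb : U ≤ stdOpen i b), ∃ e : Γ(X, U), IsUnit e ∧
    ∀ l, ∃ (q₀ : Γ(C, W)) (q : Fin n → Γ(C, W)), rs hb (ratio i b l) =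
      ((π.appLE W U le).hom q₀ + ∑ c, (π.appLE W U le).hom (q c) * x c) * e

/-- Over an open set of the curve trivializing the scroll, choose a coordinate t of the curve and a
homogeneous coordinate x_a of the fibre nonzero at the point. The dimension of X turns the
generating differentials into a basis. The product lives on open subschemes, so everything is
finally carried to X and C by the open immersions. -/
theorem exists_localCoord [IsIntegral X] [IsIntegral C] [SmoothOfRelativeDimension n pX]
    [SmoothOfRelativeDimension 1 pC] (hπ : π ≫ pC = pX) (hscroll : IsScroll pX pC i π n) {y : X}
    {U₀ : X.Opens} {W₀ : C.Opens} (hU : y ∈ U₀) (hW : π y ∈ W₀) :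
    ∃ (U : X.Opens) (W : C.Opens) (a : Fin n), IsAffineOpen U ∧ IsAffineOpen W ∧ y ∈ U ∧ U ≤ U₀ ∧
      W ≤ W₀ ∧ Nonempty (LocalCoord pX pC i π U W a) := by
  obtain ⟨W₁, hyW₁, g, H, hε⟩ := hscroll (π y)
  have hne₁ : Nonempty W₁ := ⟨⟨_, hyW₁⟩⟩
  let y' : (π ⁻¹ᵁ W₁).toScheme := ⟨y, hyW₁⟩
  have hne₂ : Nonempty (π ⁻¹ᵁ W₁).toScheme := ⟨y'⟩
  have hne₃ : Nonempty W₁.toScheme := hne₁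
  have hint₁ : IsIntegral W₁.toScheme := isIntegral_of_isOpenImmersion W₁.ι
  have hint₂ : IsIntegral (π ⁻¹ᵁ W₁).toScheme := isIntegral_of_isOpenImmersion (π ⁻¹ᵁ W₁).ι
  -- Open immersions have relative dimension 0, and dimensions add under composition.
  have hsm₁ : SmoothOfRelativeDimension 1 (W₁.ι ≫ pC) := by
    have : SmoothOfRelativeDimension (0 + 1) (W₁.ι ≫ pC) := inferInstance
    rwa [zero_add] at this
  have hsm₂ : SmoothOfRelativeDimension n ((π ⁻¹ᵁ W₁).ι ≫ pX) := by
    have : SmoothOfRelativeDimension (0 + n) ((π ⁻¹ᵁ W₁).ι ≫ pX) := inferInstance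
    rwa [zero_add] at this
  have hp : (π ∣_ W₁) ≫ W₁.ι ≫ pC = (π ⁻¹ᵁ W₁).ι ≫ pX := by
    rw [← Category.assoc, morphismRestrict_ι, Category.assoc, hπ]
  have hpt : ∀ v, W₁.ι ((π ∣_ W₁) v) = π ((π ⁻¹ᵁ W₁).ι v) := fun v => by
    rw [← Scheme.Hom.comp_apply, morphismRestrict_ι, Scheme.Hom.comp_apply]
  have hy' : (π ∣_ W₁) y' ∈ W₁.ι ⁻¹ᵁ W₀ := by
    change W₁.ι ((π ∣_ W₁) y') ∈ W₀
    rw [hpt]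
    exact hW
  obtain ⟨W, hWaff, hyW, hWle, t, ht⟩ := exists_isCoord (W₁.ι ≫ pC) hy'
  obtain ⟨a, ha⟩ := exists_mem_stdOpen g y'
  have hya : y' ∈ fibOpen g (π ∣_ W₁) W a := ⟨ha, hyW⟩
  obtain ⟨V, hVaff, hyV, hVle, hdim⟩ := exists_hasDim ((π ⁻¹ᵁ W₁).ι ≫ pX) n
    (show y' ∈ fibOpen g (π ∣_ W₁) W a ⊓ (π ⁻¹ᵁ W₁).ι ⁻¹ᵁ U₀ from ⟨hya, hU⟩)
  have hVa : V ≤ fibOpen g (π ∣_ W₁) W a := hVle.trans inf_le_left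
  have hle : (π ⁻¹ᵁ W₁).ι ''ᵁ V ≤ π ⁻¹ᵁ (W₁.ι ''ᵁ W) := by
    rintro _ ⟨v, hv, rfl⟩
    exact ⟨(π ∣_ W₁) v, fibOpen_le_preimage g (π ∣_ W₁) W a (hVa hv), hpt v⟩
  have hspan := isSpanning_fibCoord H hWaff ht a
  rw [hp] at hspan
  have hcoord : IsCoord (structureHom ((π ⁻¹ᵁ W₁).ι ≫ pX) V)
      fun c => rs hVa (fibCoord g (π ∣_ W₁) W t a c) :=
    (hspan.rs _ (isAffineOpen_fibOpen H hWaff a) hVaff hVa).isCoord (by rwa [Fintype.card_fin])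
  rw [structureHom_image] at hcoord
  rw [structureHom_image] at ht
  refine ⟨(π ⁻¹ᵁ W₁).ι ''ᵁ V, W₁.ι ''ᵁ W, a, hVaff.image_of_isOpenImmersion _,
    hWaff.image_of_isOpenImmersion _, ⟨y', hyV, rfl⟩, ?_, ?_, ⟨⟨hle,
      fun c => rs hVa (fibCoord g (π ∣_ W₁) W t a c), t, hcoord, ht, ?_, ?_⟩⟩⟩
  · rintro _ ⟨v, hv, rfl⟩
    exact (hVle hv).2
  · rintro _ ⟨v, hv, rfl⟩
    exact hWle hv
  · refine Eq.trans ?_ (rs_fibBase_image π W₁ g W a V hVa hle t)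
    exact congrArg (rs hVa) (if_pos rfl)
  · intro b hb
    have hb' : V ≤ stdOpen ((π ⁻¹ᵁ W₁).ι ≫ i) b := fun v hv => hb ⟨v, hv, rfl⟩
    obtain ⟨e, he, h⟩ := exists_ratio_eq_mul_linear H hWaff ⟨_, hyW⟩ t ((π ⁻¹ᵁ W₁).ι ≫ i) hε a
      hVaff hVa hb'
    refine ⟨e, he, fun l => ?_⟩
    obtain ⟨q₀, q, hq⟩ := h l
    refine ⟨q₀, q, ?_⟩
    rw [map_add, map_sum] at hq
    simp only [map_mul] at hq
    refine (rs_ratio_image i (π ⁻¹ᵁ W₁) V hb' hb l).symm.trans (hq.trans ?_)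
    refine congrArg (fun z : Γ((π ⁻¹ᵁ W₁).toScheme, V) => z * e) ?_
    refine congrArg₂ (fun z w : Γ((π ⁻¹ᵁ W₁).toScheme, V) => z + w)
      (rs_fibBase_image π W₁ g W a V hVa hle q₀) (Finset.sum_congr rfl fun c _ => ?_)
    exact congrArg (fun z : Γ((π ⁻¹ᵁ W₁).toScheme, V) => z * _)
      (rs_fibBase_image π W₁ g W a V hVa hle (q c))

theorem IsHBasis.unit_smul {B : AlgBase} {F : PMod B} {j : B.I} {e : F.M j}
    (he : F.IsHBasis fun _ : Unit => e) {u : B.A j} (hu : IsUnit u) :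
    F.IsHBasis fun _ : Unit => u • e := by
  intro l h
  have h1 := (he l h).unit_smul (hu.map (B.res h))
  have h2 : F.res h (u • e) = B.res h u • F.res h e := LinearMap.map_smulₛₗ _ _ _
  exact (funext fun _ => h2 : (fun _ : Unit => F.res h (u • e)) = _) ▸ h1

/-- The sections of the hyperplane bundle given by the homogeneous coordinates. -/
def hyperplaneSection (l : Fin (N + 1)) : (hyperplaneBundle pX i π).GlobalSection :=
  (coordSection i pX l).reindex _ (Chart.mono i π)

variable {pX pC i π}

/-- Coordinates of a scroll are coordinates on the base of charts. -/
theorem LocalCoord.nonempty_scrollChart (hπ : π ≫ pC = pX) {c : Chart i π} {a : Fin n}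
    (d : LocalCoord pX pC i π c.U.1 c.W.1 a) :
    Nonempty (ScrollChart (projHom pX pC i π hπ) (hyperplaneBundle pX i π)
      (hyperplaneSection pX i π) a c) := by
  obtain ⟨b, hb⟩ := c.std
  obtain ⟨e, he, hq⟩ := d.ratio_eq hb
  -- The common unit factor e of the quotients by x_b is absorbed into the generator, so that the
  -- coefficients of the sections come from the curve.
  refine ⟨⟨d.x, d.t, (e • coordElt i c.U.1 b : twistSections i c.U.1), d.isCoord_x, d.isCoord_t,
    d.x_eq, IsHBasis.unit_smul (isHBasis_hyperplaneBundle pX i π c hb) he, fun l => ?_⟩⟩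
  obtain ⟨q₀, q, h⟩ := hq l
  refine ⟨q₀, q, ?_⟩
  have h1 : coordElt i c.U.1 l = (((π.appLE c.W.1 c.U.1 d.le).hom q₀ +
      ∑ b, (π.appLE c.W.1 c.U.1 d.le).hom (q b) * d.x b) * e) • coordElt i c.U.1 b := by
    rw [← h, ← component_coordElt]
    exact eq_component_smul i hb _
  exact h1.trans (mul_smul _ _ _)

/-- Coordinates can be found inside any given pair of open sets of X and C, which makes the members
with coordinates cofinal; the remaining conditions express smoothness, integrality and the choice of
members on which some x_l generates L. -/
theorem isScrollBase [IsIntegral X] [IsIntegral C] [SmoothOfRelativeDimension n pX]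
    [SmoothOfRelativeDimension 1 pC] (hπ : π ≫ pC = pX) (hscroll : IsScroll pX pC i π n)
    (o : Fin n) : IsScrollBase (projHom pX pC i π hπ) (hyperplaneBundle pX i π)
      (hyperplaneSection pX i π) o where
  smooth := by
    have := SmoothOfRelativeDimension.smooth n pX
    exact (isSmooth_affineBase pX).reindex _ (Chart.mono i π)
  smooth' := by
    have := SmoothOfRelativeDimension.smooth 1 pC
    exact isSmooth_affineBase pC
  isDomain c hc := by
    have : Nonempty c.U.1 := hc.to_subtype
    exact (inferInstance : IsDomain Γ(X, c.U.1))
  subsingleton c hc := subsingleton_of_not_nonempty hc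
  res_injective h hc := rs_injective h.1 hc
  exists_generator c := by
    obtain ⟨b, hb⟩ := c.std
    exact ⟨_, isHBasis_hyperplaneBundle pX i π c hb⟩
  exists_chart c y hy := by
    obtain ⟨U, W, a, hU, hW, hyU, hle, hle', ⟨d⟩⟩ :=
      exists_localCoord pX pC i π hπ hscroll (y := y) (U₀ := c.U.1) (W₀ := c.W.1) hy (c.le hy)
    obtain ⟨b, hb⟩ := c.std
    let c' : Chart i π := ⟨⟨U, hU⟩, ⟨W, hW⟩, d.le, b, hle.trans hb⟩
    obtain ⟨e⟩ := LocalCoord.nonempty_scrollChart hπ (c := c') d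
    -- The place a of the curve coordinate depends on the chart; a transposition moves it to the
    -- fixed place o.
    exact ⟨c', ⟨hle, hle'⟩, hyU, ⟨e.permute o (Equiv.swap o a) (Equiv.swap_apply_left o a)⟩⟩
  exists_mem y := exists_chart_mem i π y

theorem pos_of_isScroll [IsIntegral X] (hscroll : IsScroll pX pC i π n) : 0 < n := by
  obtain ⟨y⟩ : Nonempty X := inferInstance
  obtain ⟨W, hy, g, -⟩ := hscroll (π y)
  obtain ⟨a, -⟩ := exists_mem_stdOpen g ⟨y, hy⟩
  exact a.pos

end Coordinates

end

end Scroll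

end

theorem theorem1 {X C : Scheme.{0}} (pX : X ⟶ Spec (.of ℂ)) (pC : C ⟶ Spec (.of ℂ))
    [IsIntegral X] [IsIntegral C] (n N : ℕ)
    [SmoothOfRelativeDimension n pX] [SmoothOfRelativeDimension 1 pC] [IsSeparated pC]
    (i : X ⟶ Scroll.PP (N + 1)) [IsClosedImmersion i] (hi : i ≫ Scroll.PP.toSpec (N + 1) = pX)
    (π : X ⟶ C) (hπ : π ≫ pC = pX) (hscroll : Scroll.IsScroll pX pC i π n)
    (k : ℕ) (hk : 1 ≤ k) (hkN : k * n ≤ N)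
    (hrank : Scroll.PMod.HasGenericRank (Scroll.jetMorphism pX i π k) (k * n + 1)) :
    (Scroll.Q pX i π k).dual.IsLocallyFree ((n + k).choose n - (k * n + 1)) ∧
    (∃ M : Scroll.PMod (Scroll.chartBase pX i π),
      M.IsLocallyFree ((n + k - 1).choose (n - 1) - n) ∧
      (∃ (f : Scroll.PMod.Hom (Scroll.Q pX i π (k - 1)).dual (Scroll.Q pX i π k).dual)
        (g : Scroll.PMod.Hom (Scroll.Q pX i π k).dual M.dual), Scroll.PMod.IsShortExact f g) ∧
      (∃ (f : Scroll.PMod.Hom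
          ((((Scroll.pullCotangentC pX pC i π hπ).pow (k - 1)).tensor
            (Scroll.cotangentX pX i π)).tensor (Scroll.hyperplaneBundle pX i π))
          (((Scroll.cotangentX pX i π).sym k).tensor (Scroll.hyperplaneBundle pX i π)))
        (g : Scroll.PMod.Hom
          (((Scroll.cotangentX pX i π).sym k).tensor (Scroll.hyperplaneBundle pX i π)) M),
        Scroll.PMod.IsShortExact f g)) ∧
    (Scroll.E pX i π k).IsLocallyFree (k * n + 1) ∧
    (∃ (f : Scroll.PMod.Hom (Scroll.E pX i π (k - 1)) (Scroll.E pX i π k))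
      (g : Scroll.PMod.Hom (Scroll.E pX i π k)
        ((((Scroll.pullTangentC pX pC i π hπ).pow (k - 1)).tensor
          (Scroll.cotangentX pX i π).dual).tensor (Scroll.hyperplaneBundle pX i π).dual)),
      Scroll.PMod.IsShortExact f g) := by
  -- With k + 1 in place of k, the exponent k - 1 of the statement becomes k. The distinguished
  -- index can be any element of `Fin n`, which is non-empty because X has a point.
  obtain ⟨k, rfl⟩ := Nat.exists_eq_add_of_le' hk
  exact (Scroll.isScrollBase hπ hscroll ⟨0, Scroll.pos_of_isScroll hscroll⟩).main
    (Fintype.card_fin n) hrank
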